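/- **Setting.** Let $R$ be a commutative semiring. *Colours and objects.* Colours are generated by $A,B ::= \mathbb 0 \mid \mathbb 1 \mid A\oplus B \mid A\otimes B$. Let $\approx$ be the equivalence relation on colours generated by $A\oplus\mathbb 0\approx A$, $\mathbb 0\oplus A\approx A$, $A\otimes\mathbb 1\approx A$, $\mathbb 1\otimes A\approx A$, $(A\oplus B)\oplus C\approx A\oplus(B\oplus C)$, $(A\otimes B)\otimes C\approx A\otimes(B\otimes C)$ and closed under congruence for $\oplus$ and $\otimes$ on either side. Objects are finite lists of colours, with concatenation $\parallel$ and the empty list $\varnothing$. *Diagrams.* The functional Tensor-Plus Calculus $\mathbf{FCat}$ is the coloured PROP (strict symmetric monoidal category with monoidal product $\parallel$) whose diagrams are generated, under sequential composition $d;e$ ("$d$, then $e$") and parallel composition $d\parallel e$, by identities, the swaps $\sigma_{A,B}:A\parallel B\to B\parallel A$ and $$T_{A,B}:A\parallel B\to A\otimes B,\quad P_{A,B}:A\parallel B\to A\oplus B,\quad C_A:A\parallel A\to A,\quad Z_A:\varnothing\to A,\quad M_{A,A'}:A\to A'\ (A\approx A'),\quad [s]_A:A\to A\ (s\in R),$$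 together with the mirror images $T^\circ_{A,B}$, $P^\circ_{A,B}$, $C^\circ_A$, $Z^\circ_A$ of $T,P,C,Z$. The up-down mirror $d\mapsto d^\circ$ reverses sequential composition, preserves parallel composition and fixes identities and scalars, with $\sigma_{A,B}^\circ=\sigma_{B,A}$ and $M_{A,A'}^\circ=M_{A',A}$. Write $D_{A,B}:=P_{A,B};P^\circ_{A,B}$, and write $A$ for $\mathrm{id}_A$; $\parallel$ binds tighter than $;$. *Equational theory.* $\equiv$ is the smallest congruence (for $;$ and $\parallel$) on diagrams containing the laws of a coloured PROP and, for all colours and all scalars $s,t$ such that the adapters exist, the following equations and their up-down mirror images. - Main equations: $T^\circ_{A,B};T_{A,B}= A\otimes B$; $P^\circ_{A,B};P_{A,B}=A\oplus B$; $T^\circ_{A,B};P_{A,B}=Z^\circ_{A\otimes B};Z_{A\oplus B}$; $\mathrm{id}_{\mathbb 0}=Z^\circ_{\mathbb 0};Z_{\mathbb 0}$; $\sigma_{A,A};C_A=C_A$; $(T^\circ_{A,B}\parallel C);(A\parallel T_{B,C})=T_{A\otimes B,C};M;T^\circ_{A,B\otimes C}$; $D_{A,B}=(M_{A,A\otimes\mathbb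 1}\parallel M_{B,\mathbb 1\otimes B});(T^\circ_{A,\mathbb 1}\parallel T^\circ_{\mathbb 1,B});(A\parallel (C_{\mathbb 1};C^\circ_{\mathbb 1})\parallel B);(T_{A,\mathbb 1}\parallel T_{\mathbb 1,B});(M_{A\otimes\mathbb 1,A}\parallel M_{\mathbb 1\otimes B,B})$; $P_{A,B}=(M_{A,A\otimes\mathbb 1}\parallel M_{B,B\otimes\mathbb 1});(T^\circ_{A,\mathbb 1}\parallel T^\circ_{B,\mathbb 1});(A\parallel\sigma_{\mathbb 1,B}\parallel\mathbb 1);(P_{A,B}\parallel C_{\mathbb 1});T_{A\oplus B,\mathbb 1};M_{(A\oplus B)\otimes\mathbb 1,A\oplus B}$; $(C^\circ_A\parallel C^\circ_B);(A\parallel\sigma_{A,B}\parallel B);((T_{A,B};T^\circ_{A,B})\parallel D_{A,B});(A\parallel\sigma_{B,A}\parallel B);(C_A\parallel C_B)=A\parallel B$. - Null: $Z_{A\otimes B};T^\circ_{A,B}=Z_A\parallel Z_B$; $Z_{A\oplus B};P^\circ_{A,B}=Z_A\parallel Z_B$; $Z_A;C^\circ_A=Z_A\parallel Z_A$; $Z_A;Z^\circ_A=\mathrm{id}_\varnothing$;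 $Z_A;M_{A,A'}=Z_{A'}$; $Z_A;[s]_A=Z_A$; $(A\parallel Z_A);C_A=A$. - Contraction: $C_{A\otimes B};T^\circ_{A,B}=(T^\circ_{A,B}\parallel T^\circ_{A,B});(A\parallel\sigma_{B,A}\parallel B);(C_A\parallel C_B)$; $(C_A\parallel B);T_{A,B}=(A\parallel A\parallel C^\circ_B);(A\parallel\sigma_{A,B}\parallel B);(T_{A,B}\parallel T_{A,B});C_{A\otimes B}$; $C_{A\oplus B};P^\circ_{A,B}=D_{A\oplus B,A\oplus B};(P^\circ_{A,B}\parallel P^\circ_{A,B});(A\parallel\sigma_{B,A}\parallel B);(C_A\parallel C_B)$; $(C_A\parallel B);D_{A,B}=(A\parallel D_{A,B});(A\parallel\sigma_{A,B});(D_{A,B}\parallel A);(A\parallel\sigma_{B,A});(C_A\parallel B)$; $C_A;C^\circ_A=D_{A,A};(C^\circ_A\parallel C^\circ_A);(A\parallel\sigma_{A,A}\parallel A);(C_A\parallel C_A)$; $(C_A\parallel A);C_A=(A\parallel C_A);C_A$; $([s]_A\parallel[s]_A);C_A=C_A;[s]_A$; $(M_{A,A'}\parallel M_{A,A'});C_{A'}=C_A;M_{A,A'}$.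 - Adapter: $T^\circ_{A,B\otimes C};(A\parallel T^\circ_{B,C})=M;T^\circ_{A\otimes B,C};(T^\circ_{A,B}\parallel C)$, and the same with $P,\oplus$ for $T,\otimes$; $(M_{A,A'}\parallel M_{B,B'});T_{A',B'}=T_{A,B};M$ and $(M_{A,A'}\parallel M_{B,B'});P_{A',B'}=P_{A,B};M$; $T_{A,\mathbb 1};M_{A\otimes\mathbb 1,A}=\sigma_{A,\mathbb 1};T_{\mathbb 1,A};M_{\mathbb 1\otimes A,A}$; $P_{A,\mathbb 0};M_{A\oplus\mathbb 0,A}=A\parallel Z^\circ_{\mathbb 0}$; $P_{\mathbb 0,A};M_{\mathbb 0\oplus A,A}=Z^\circ_{\mathbb 0}\parallel A$; $M_{A,B};M_{B,C}=M_{A,C}$; $M_{A,A}=A$. - Scalars: $[1]_A=A$; $[0]_A=Z^\circ_A;Z_A$; $[s+t]_A=C^\circ_A;([s]_A\parallel[t]_A);C_A$; $([s]_A\parallel[t]_B);T_{A,B}=T_{A,B};[st]_{A\otimes B}$; $[s]_A;M_{A,A'}=M_{A,A'};[s]_{A'}$. *Semantics.* Let $\mathbf H$ be a category with finite biproducts $(\oplus,0)$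 and a symmetric monoidal structure $(\otimes,\mathbb 1)$ that is distributive, i.e. the canonical morphisms $H\otimes(K\oplus L)\to(H\otimes K)\oplus(H\otimes L)$ and $H\otimes 0\to 0$ are isomorphisms, and let $\mathbf{scal}:R\to\mathbf H(\mathbb 1,\mathbb 1)$ be an isomorphism of semirings. Then $H\mid K:=(H\otimes K)\oplus(H\oplus K)$ is a symmetric monoidal product with unit $0$, and $f\mid g:=(f\otimes g)\oplus(f\oplus g)$. Interpret colours by $\llbracket\mathbb 0\rrbracket=0$, $\llbracket\mathbb 1\rrbracket=\mathbb 1$, $\llbracket A\oplus B\rrbracket=\llbracket A\rrbracket\oplus\llbracket B\rrbracket$, $\llbracket A\otimes B\rrbracket=\llbracket A\rrbracket\otimes\llbracket B\rrbracket$, and objects by $\llbracket\varnothing\rrbracket=0$, $\llbracket\mathcal X\parallel B\rrbracket=\llbracket\mathcal X\rrbracket\mid\llbracket B\rrbracket$. Up to the structural isomorphisms of $\mid$ needed for typing, diagrams are interpreted by: $\mathrm{id}\mapsto\mathrm{id}$; $\sigma_{A,B}\mapsto\sigma^{\otimes}\oplus\sigma^{\oplus}$; $P,P^\circ\mapsto$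 the projection onto, resp. injection of, the summand $\llbracket A\rrbracket\oplus\llbracket B\rrbracket$ of $\llbracket A\rrbracket\mid\llbracket B\rrbracket$; $T,T^\circ\mapsto$ the projection onto, resp. injection of, the summand $\llbracket A\rrbracket\otimes\llbracket B\rrbracket$; $C_A\mapsto\nabla\circ\pi_r$ and $C_A^\circ\mapsto\iota_r\circ\Delta$, where $\pi_r,\iota_r$ are the projection and injection of the summand $\llbracket A\rrbracket\oplus\llbracket A\rrbracket$; $Z,Z^\circ\mapsto$ zero morphisms; $M_{A,A'}\mapsto$ the structural isomorphism built from associators and unitors of $\otimes$ and $\oplus$; $[s]_A\mapsto s\cdot\mathrm{id}_{\llbracket A\rrbracket}:=\lambda\circ(\mathbf{scal}(s)\otimes\mathrm{id})\circ\lambda^{-1}$; $d;e\mapsto\llbracket e\rrbracket\circ\llbracket d\rrbracket$; $d\parallel e\mapsto\llbracket d\rrbracket\mid\llbracket e\rrbracket$. **Theorem (Completeness).** For every such $\mathbf H$ and $\mathbf{scal}$, all objects $\mathcal X,\mathcal Y$ and all diagrams $d,e\in\mathbf{FCat}(\mathcal X,\mathcal Y)$: if $\llbracket d\rrbracket=\llbracket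 e\rrbracket$, then $d\equiv e$. -/

import Mathlib

open CategoryTheory CategoryTheory.Limits CategoryTheory.MonoidalCategory

namespace TensorPlus

universe u v w

/-! ## Syntax: colours, objects, diagrams -/

/-- Colours `A, B ::= 𝟘 | 𝟙 | A ⊕ B | A ⊗ B`. -/
inductive Color : Type
  | zero : Color
  | one : Color
  | plus (A B : Color) : Color
  | tensor (A B : Color) : Color

/-- Formal derivations of `A ≈ A'`, where `≈` is the equivalence relation generated by the unit
laws, the associativity laws and the congruence rules of `⊕` and `⊗`. -/
inductive Adapt : Color → Color → Type
  | refl (A : Color) : Adapt A A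
  | symm {A B : Color} (h : Adapt A B) : Adapt B A
  | trans {A B C : Color} (h : Adapt A B) (k : Adapt B C) : Adapt A C
  | plusZero (A : Color) : Adapt (.plus A .zero) A
  | zeroPlus (A : Color) : Adapt (.plus .zero A) A
  | tensorOne (A : Color) : Adapt (.tensor A .one) A
  | oneTensor (A : Color) : Adapt (.tensor .one A) A
  | plusAssoc (A B C : Color) : Adapt (.plus (.plus A B) C) (.plus A (.plus B C))
  | tensorAssoc (A B C : Color) : Adapt (.tensor (.tensor A B) C) (.tensor A (.tensor B C))
  | plusLeft {A B : Color} (h : Adapt A B) (C : Color) : Adapt (.plus A C) (.plus B C)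
  | plusRight (C : Color) {A B : Color} (h : Adapt A B) : Adapt (.plus C A) (.plus C B)
  | tensorLeft {A B : Color} (h : Adapt A B) (C : Color) : Adapt (.tensor A C) (.tensor B C)
  | tensorRight (C : Color) {A B : Color} (h : Adapt A B) : Adapt (.tensor C A) (.tensor C B)

/-- The equivalence relation `≈` on colours. -/
def Approx (A B : Color) : Prop := Nonempty (Adapt A B)

theorem Approx.symm {A B : Color} (h : Approx A B) : Approx B A := h.map Adapt.symm

theorem Approx.trans {A B C : Color} (h : Approx A B) (k : Approx B C) : Approx A C :=
  h.elim fun a => k.map fun b => a.trans b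

/-- Objects: finite lists of colours, written from the left, `snoc X B` being `X ∥ B`. -/
inductive Obj : Type
  | empty : Obj
  | snoc (X : Obj) (B : Color) : Obj

/-- The object made of a single wire. -/
abbrev wire (A : Color) : Obj := .snoc .empty A

/-- Parallel composition (concatenation) of objects. -/
@[reducible] def Obj.par : Obj → Obj → Obj
  | X, .empty => X
  | X, .snoc Y B => .snoc (Obj.par X Y) B

theorem Obj.empty_par (X : Obj) : Obj.par .empty X = X := by
  induction X with
  | empty => rfl
  | snoc X B ih => rw [Obj.par, ih]

theorem Obj.par_assoc (X Y Z : Obj) : Obj.par (Obj.par X Y) Z = Obj.par X (Obj.par Y Z) := by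
  induction Z with
  | empty => rfl
  | snoc Z B ih => rw [Obj.par, Obj.par, Obj.par, ih]

/-- Terms for the diagrams of the functional calculus; the identification of terms by the laws of
a coloured PROP is part of `Equiv` below. -/
inductive Diag (R : Type u) : Obj → Obj → Type u
  | id (X : Obj) : Diag R X X
  | swap (A B : Color) : Diag R ((wire A).par (wire B)) ((wire B).par (wire A))
  | tensor (A B : Color) : Diag R ((wire A).par (wire B)) (wire (.tensor A B))
  | tensorInv (A B : Color) : Diag R (wire (.tensor A B)) ((wire A).par (wire B))
  | plus (A B : Color) : Diag R ((wire A).par (wire B)) (wire (.plus A B))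
  | plusInv (A B : Color) : Diag R (wire (.plus A B)) ((wire A).par (wire B))
  | contr (A : Color) : Diag R ((wire A).par (wire A)) (wire A)
  | contrInv (A : Color) : Diag R (wire A) ((wire A).par (wire A))
  | null (A : Color) : Diag R .empty (wire A)
  | nullInv (A : Color) : Diag R (wire A) .empty
  | adapter {A A' : Color} (h : Approx A A') : Diag R (wire A) (wire A')
  | scalar (s : R) (A : Color) : Diag R (wire A) (wire A)
  | comp {X Y Z : Obj} (d : Diag R X Y) (e : Diag R Y Z) : Diag R X Z
  | par {X Y X' Y' : Obj} (d : Diag R X Y) (e : Diag R X' Y') : Diag R (X.par X') (Y.par Y')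

-- `d ⨾ e` is `d` followed by `e`; `d ∥ e` is `d` to the left of `e`.
local notation:60 d:61 " ⨾ " e:60 => Diag.comp (d :) (e :)
local notation:70 d:70 " ∥ " e:71 => Diag.par (d :) (e :)

namespace Diag

variable {R : Type u}

/-- Transport of a diagram along equalities of its source and target. -/
def cast {X X' Y Y' : Obj} (hX : X = X') (hY : Y = Y') (d : Diag R X Y) : Diag R X' Y' :=
  hX ▸ hY ▸ d

/-- The up-down mirror image of a diagram. -/
def mirror : {X Y : Obj} → Diag R X Y → Diag R Y X
  | _, _, .id X => .id X
  | _, _, .swap A B => .swap B A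
  | _, _, .tensor A B => .tensorInv A B
  | _, _, .tensorInv A B => .tensor A B
  | _, _, .plus A B => .plusInv A B
  | _, _, .plusInv A B => .plus A B
  | _, _, .contr A => .contrInv A
  | _, _, .contrInv A => .contr A
  | _, _, .null A => .nullInv A
  | _, _, .nullInv A => .null A
  | _, _, .adapter h => .adapter h.symm
  | _, _, .scalar s A => .scalar s A
  | _, _, .comp d e => .comp e.mirror d.mirror
  | _, _, .par d e => .par d.mirror e.mirror

/-- The identity on one wire. -/
abbrev idw (A : Color) : Diag R (wire A) (wire A) := .id (wire A)

/-- The wire `B` crossing all the wires of `X` from right to left. -/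
def swapWire : (X : Obj) → (B : Color) → Diag R (X.par (wire B)) ((wire B).par X)
  | .empty, B => Diag.id (wire B)
  | .snoc X A, B => (Diag.id X ∥ swap A B) ⨾ (swapWire X B ∥ idw A)

/-- Two Pluses head to head, `A ∥ B → A ⊕ B → A ∥ B`. -/
abbrev plusPlus (A B : Color) : Diag R ((wire A).par (wire B)) ((wire A).par (wire B)) :=
  plus A B ⨾ plusInv A B

end Diag

/-! ## The equational theory -/

open Diag in
/-- The equations of the functional calculus (their mirror images are added in `Equiv`). -/
inductive Axiom {R : Type u} [CommSemiring R] : {X Y : Obj} → Diag R X Y → Diag R X Y → Prop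
  -- main equations
  | tensor_tensor (A B : Color) :
      Axiom (tensorInv A B ⨾ tensor A B) (idw (.tensor A B))
  | plus_plus (A B : Color) :
      Axiom (plusInv A B ⨾ plus A B) (idw (.plus A B))
  | tensor_plus (A B : Color) :
      Axiom (tensorInv A B ⨾ plus A B) (nullInv (.tensor A B) ⨾ null (.plus A B))
  | id_zero :
      Axiom (idw .zero) (nullInv .zero ⨾ null .zero)
  | swap_contr (A : Color) :
      Axiom (swap A A ⨾ contr A) (contr A)
  | n_tensor (A B C : Color)
      (h : Approx (.tensor (.tensor A B) C) (.tensor A (.tensor B C))) :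
      Axiom ((tensorInv A B ∥ idw C) ⨾ (idw A ∥ tensor B C))
        (tensor (.tensor A B) C ⨾ adapter h ⨾ tensorInv A (.tensor B C))
  | x_plus (A B : Color) (h : Approx A (.tensor A .one)) (k : Approx B (.tensor .one B)) :
      Axiom (plusPlus A B)
        ((adapter h ∥ adapter k) ⨾ (tensorInv A .one ∥ tensorInv .one B) ⨾
          (idw A ∥ (contr .one ⨾ contrInv .one) ∥ idw B) ⨾
          (tensor A .one ∥ tensor .one B) ⨾ (adapter h.symm ∥ adapter k.symm))
  | plus_contr (A B : Color) (hA : Approx A (.tensor A .one)) (hB : Approx B (.tensor B .one))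
      (h : Approx (.tensor (.plus A B) .one) (.plus A B)) :
      Axiom (plus A B)
        ((adapter hA ∥ adapter hB) ⨾ (tensorInv A .one ∥ tensorInv B .one) ⨾
          (idw A ∥ swap .one B ∥ idw .one) ⨾ (plus A B ∥ contr .one) ⨾
          tensor (.plus A B) .one ⨾ adapter h)
  | mix (A B : Color) :
      Axiom
        ((contrInv A ∥ contrInv B) ⨾ (idw A ∥ swap A B ∥ idw B) ⨾
          ((tensor A B ⨾ tensorInv A B) ∥ plusPlus A B) ⨾
          (idw A ∥ swap B A ∥ idw B) ⨾ (contr A ∥ contr B))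
        (idw A ∥ idw B)
  -- equations for the Null
  | null_tensor (A B : Color) :
      Axiom (null (.tensor A B) ⨾ tensorInv A B) (null A ∥ null B)
  | null_plus (A B : Color) :
      Axiom (null (.plus A B) ⨾ plusInv A B) (null A ∥ null B)
  | null_contr (A : Color) :
      Axiom (null A ⨾ contrInv A) (null A ∥ null A)
  | null_null (A : Color) :
      Axiom (null A ⨾ nullInv A) (Diag.id .empty)
  | null_adapter {A A' : Color} (h : Approx A A') :
      Axiom (null A ⨾ adapter h) (null A')
  | null_scalar (s : R) (A : Color) :
      Axiom (null A ⨾ scalar s A) (null A)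
  | contr_unit (A : Color) :
      Axiom ((idw A ∥ null A) ⨾ contr A) (idw A)
  -- equations for the Contraction
  | contr_tensorInv (A B : Color) :
      Axiom (contr (.tensor A B) ⨾ tensorInv A B)
        ((tensorInv A B ∥ tensorInv A B) ⨾ (idw A ∥ swap B A ∥ idw B) ⨾ (contr A ∥ contr B))
  | contr_tensor (A B : Color) :
      Axiom ((contr A ∥ idw B) ⨾ tensor A B)
        ((idw A ∥ idw A ∥ contrInv B) ⨾ (idw A ∥ swap A B ∥ idw B) ⨾
          (tensor A B ∥ tensor A B) ⨾ contr (.tensor A B))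
  | contr_plusInv (A B : Color) :
      Axiom (contr (.plus A B) ⨾ plusInv A B)
        (plusPlus (.plus A B) (.plus A B) ⨾ (plusInv A B ∥ plusInv A B) ⨾
          (idw A ∥ swap B A ∥ idw B) ⨾ (contr A ∥ contr B))
  | contr_plusPlus (A B : Color) :
      Axiom ((contr A ∥ idw B) ⨾ plusPlus A B)
        ((idw A ∥ plusPlus A B) ⨾ (idw A ∥ swap A B) ⨾ (plusPlus A B ∥ idw A) ⨾
          (idw A ∥ swap B A) ⨾ (contr A ∥ idw B))
  | contr_contrInv (A : Color) :
      Axiom (contr A ⨾ contrInv A)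
        (plusPlus A A ⨾ (contrInv A ∥ contrInv A) ⨾ (idw A ∥ swap A A ∥ idw A) ⨾
          (contr A ∥ contr A))
  | contr_assoc (A : Color) :
      Axiom ((contr A ∥ idw A) ⨾ contr A) ((idw A ∥ contr A) ⨾ contr A)
  | contr_scalar (s : R) (A : Color) :
      Axiom ((scalar s A ∥ scalar s A) ⨾ contr A) (contr A ⨾ scalar s A)
  | contr_adapter {A A' : Color} (h : Approx A A') :
      Axiom ((adapter h ∥ adapter h) ⨾ contr A') (contr A ⨾ adapter h)
  -- equations for the Adapter
  | assoc_tensor (A B C : Color)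
      (h : Approx (.tensor A (.tensor B C)) (.tensor (.tensor A B) C)) :
      Axiom (tensorInv A (.tensor B C) ⨾ (idw A ∥ tensorInv B C))
        (adapter h ⨾ tensorInv (.tensor A B) C ⨾ (tensorInv A B ∥ idw C))
  | assoc_plus (A B C : Color)
      (h : Approx (.plus A (.plus B C)) (.plus (.plus A B) C)) :
      Axiom (plusInv A (.plus B C) ⨾ (idw A ∥ plusInv B C))
        (adapter h ⨾ plusInv (.plus A B) C ⨾ (plusInv A B ∥ idw C))
  | adapter_tensor {A A' B B' : Color} (h : Approx A A') (k : Approx B B')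
      (hk : Approx (.tensor A B) (.tensor A' B')) :
      Axiom ((adapter h ∥ adapter k) ⨾ tensor A' B') (tensor A B ⨾ adapter hk)
  | adapter_plus {A A' B B' : Color} (h : Approx A A') (k : Approx B B')
      (hk : Approx (.plus A B) (.plus A' B')) :
      Axiom ((adapter h ∥ adapter k) ⨾ plus A' B') (plus A B ⨾ adapter hk)
  | unit_tensor (A : Color) (h : Approx (.tensor A .one) A) (k : Approx (.tensor .one A) A) :
      Axiom (tensor A .one ⨾ adapter h) (swap A .one ⨾ tensor .one A ⨾ adapter k)
  | plus_zero (A : Color) (h : Approx (.plus A .zero) A) :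
      Axiom (plus A .zero ⨾ adapter h) (idw A ∥ nullInv .zero)
  | zero_plus (A : Color) (h : Approx (.plus .zero A) A) :
      Axiom (plus .zero A ⨾ adapter h) (nullInv .zero ∥ idw A)
  | adapter_adapter {A B C : Color} (h : Approx A B) (k : Approx B C) :
      Axiom (adapter h ⨾ adapter k) (adapter (h.trans k))
  | adapter_id (A : Color) (h : Approx A A) :
      Axiom (adapter h) (idw A)
  -- equations for the Scalar
  | scalar_one (A : Color) :
      Axiom (scalar 1 A) (idw A)
  | scalar_zero (A : Color) :
      Axiom (scalar 0 A) (nullInv A ⨾ null A)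
  | scalar_add (s t : R) (A : Color) :
      Axiom (scalar (s + t) A) (contrInv A ⨾ (scalar s A ∥ scalar t A) ⨾ contr A)
  | scalar_tensor (s t : R) (A B : Color) :
      Axiom ((scalar s A ∥ scalar t B) ⨾ tensor A B) (tensor A B ⨾ scalar (s * t) (.tensor A B))
  | scalar_adapter (s : R) {A A' : Color} (h : Approx A A') :
      Axiom (scalar s A ⨾ adapter h) (adapter h ⨾ scalar s A')

/-- The relation `≡`: the smallest congruence on diagrams that contains the laws of a coloured PROP
(strict symmetric monoidal category), the equations `Axiom` and their up-down mirror images. -/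
inductive Equiv {R : Type u} [CommSemiring R] : {X Y : Obj} → Diag R X Y → Diag R X Y → Prop
  | refl {X Y : Obj} (d : Diag R X Y) : Equiv d d
  | symm {X Y : Obj} {d e : Diag R X Y} (h : Equiv d e) : Equiv e d
  | trans {X Y : Obj} {d e f : Diag R X Y} (h : Equiv d e) (k : Equiv e f) : Equiv d f
  | comp {X Y Z : Obj} {d d' : Diag R X Y} {e e' : Diag R Y Z} (h : Equiv d d') (k : Equiv e e') :
      Equiv (d ⨾ e) (d' ⨾ e')
  | par {X Y X' Y' : Obj} {d d' : Diag R X Y} {e e' : Diag R X' Y'}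
      (h : Equiv d d') (k : Equiv e e') : Equiv (d ∥ e) (d' ∥ e')
  -- category laws
  | id_comp {X Y : Obj} (d : Diag R X Y) : Equiv (Diag.id X ⨾ d) d
  | comp_id {X Y : Obj} (d : Diag R X Y) : Equiv (d ⨾ Diag.id Y) d
  | assoc {X Y Z W : Obj} (d : Diag R X Y) (e : Diag R Y Z) (f : Diag R Z W) :
      Equiv ((d ⨾ e) ⨾ f) (d ⨾ (e ⨾ f))
  -- strict monoidal laws
  | id_par_id (X Y : Obj) : Equiv (Diag.id X ∥ Diag.id Y) (Diag.id (X.par Y) : Diag R _ _)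
  | interchange {X Y Z X' Y' Z' : Obj} (d : Diag R X Y) (e : Diag R Y Z)
      (d' : Diag R X' Y') (e' : Diag R Y' Z') :
      Equiv ((d ⨾ e) ∥ (d' ⨾ e')) ((d ∥ d') ⨾ (e ∥ e'))
  | par_empty {X Y : Obj} (d : Diag R X Y) : Equiv (d ∥ Diag.id .empty) d
  | empty_par {X Y : Obj} (d : Diag R X Y) :
      Equiv ((Diag.id .empty ∥ d).cast (Obj.empty_par X) (Obj.empty_par Y)) d
  | par_assoc {X Y X' Y' X'' Y'' : Obj} (d : Diag R X Y) (e : Diag R X' Y')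
      (f : Diag R X'' Y'') :
      Equiv ((d ∥ e ∥ f).cast (Obj.par_assoc X X' X'') (Obj.par_assoc Y Y' Y'')) (d ∥ (e ∥ f))
  -- symmetry laws
  | swap_swap (A B : Color) :
      Equiv (Diag.swap A B ⨾ Diag.swap B A) (Diag.id ((wire A).par (wire B)) : Diag R _ _)
  | swap_natural {X Y : Obj} (d : Diag R X Y) (B : Color) :
      Equiv ((d ∥ Diag.id (wire B)) ⨾ Diag.swapWire Y B) (Diag.swapWire X B ⨾ (Diag.id (wire B) ∥ d))
  -- the equations of the calculus
  | ax {X Y : Obj} {d e : Diag R X Y} (h : Axiom d e) : Equiv d e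
  | ax_mirror {X Y : Obj} {d e : Diag R X Y} (h : Axiom d e) : Equiv d.mirror e.mirror

/-! ## The categorical semantics -/

section Semantics

open scoped ZeroObject

/-- The tensor product is distributive over the biproduct: the left distributor
`X ⊗ (Y ⊞ Z) ⟶ (X ⊗ Y) ⊞ (X ⊗ Z)` and the left annihilator `X ⊗ 0 ⟶ 0` are isomorphisms. -/
class Distributive (H : Type v) [Category.{w} H] [MonoidalCategory H] [HasZeroMorphisms H]
    [HasZeroObject H] [HasBinaryBiproducts H] : Prop where
  isIso_distL (X Y Z : H) :
    IsIso (biprod.lift (X ◁ biprod.fst) (X ◁ biprod.snd) : X ⊗ (Y ⊞ Z) ⟶ (X ⊗ Y) ⊞ (X ⊗ Z))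
  isIso_annihil (X : H) : IsIso (0 : X ⊗ (0 : H) ⟶ (0 : H))

/-- An isomorphism of semirings from `R` to the endomorphisms of the tensor unit, where the sum of
`f` and `g` is `∇ ∘ (f ⊞ g) ∘ Δ` and the product is composition. -/
structure ScalarIso (R : Type u) [CommSemiring R] (H : Type v) [Category.{w} H]
    [MonoidalCategory H] [HasZeroMorphisms H] [HasBinaryBiproducts H] where
  toFun : R → (𝟙_ H ⟶ 𝟙_ H)
  bijective : Function.Bijective toFun
  map_zero : toFun 0 = 0
  map_one : toFun 1 = 𝟙 (𝟙_ H)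
  map_add (s t : R) : toFun (s + t) =
    biprod.lift (𝟙 (𝟙_ H)) (𝟙 (𝟙_ H)) ≫ biprod.map (toFun s) (toFun t) ≫
      biprod.desc (𝟙 (𝟙_ H)) (𝟙 (𝟙_ H))
  map_mul (s t : R) : toFun (s * t) = toFun t ≫ toFun s

variable {H : Type v} [Category.{w} H] [MonoidalCategory H] [HasZeroMorphisms H]
  [HasZeroObject H] [HasBinaryBiproducts H]

/-- `K | L = (K ⊗ L) ⊞ (K ⊞ L)`. -/
noncomputable abbrev vbar (K L : H) : H := (K ⊗ L) ⊞ (K ⊞ L)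

/-- `f | g = (f ⊗ g) ⊞ (f ⊞ g)`. -/
noncomputable abbrev vbarMap {K K' L L' : H} (f : K ⟶ K') (g : L ⟶ L') : vbar K L ⟶ vbar K' L' :=
  biprod.map (f ⊗ₘ g) (biprod.map f g)

/-- `f | g` for isomorphisms. -/
noncomputable abbrev vbarIso {K K' L L' : H} (f : K ≅ K') (g : L ≅ L') : vbar K L ≅ vbar K' L' :=
  biprod.mapIso (f ⊗ᵢ g) (biprod.mapIso f g)

/-- Rearrangement of the seven summands in the associator of `|`. -/
noncomputable def rearrange (a b c d e f g : H) :
    (a ⊞ (b ⊞ c)) ⊞ ((d ⊞ (e ⊞ f)) ⊞ g) ≅ (a ⊞ (d ⊞ b)) ⊞ (e ⊞ (c ⊞ (f ⊞ g))) where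
  hom := biprod.lift
    (biprod.lift (biprod.fst ≫ biprod.fst)
      (biprod.lift (biprod.snd ≫ biprod.fst ≫ biprod.fst) (biprod.fst ≫ biprod.snd ≫ biprod.fst)))
    (biprod.lift (biprod.snd ≫ biprod.fst ≫ biprod.snd ≫ biprod.fst)
      (biprod.lift (biprod.fst ≫ biprod.snd ≫ biprod.snd)
        (biprod.lift (biprod.snd ≫ biprod.fst ≫ biprod.snd ≫ biprod.snd)
          (biprod.snd ≫ biprod.snd))))
  inv := biprod.lift
    (biprod.lift (biprod.fst ≫ biprod.fst)
      (biprod.lift (biprod.fst ≫ biprod.snd ≫ biprod.snd) (biprod.snd ≫ biprod.snd ≫ biprod.fst)))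
    (biprod.lift
      (biprod.lift (biprod.fst ≫ biprod.snd ≫ biprod.fst)
        (biprod.lift (biprod.snd ≫ biprod.fst) (biprod.snd ≫ biprod.snd ≫ biprod.snd ≫ biprod.fst)))
      (biprod.snd ≫ biprod.snd ≫ biprod.snd ≫ biprod.snd))
  hom_inv_id := by ext <;> simp
  inv_hom_id := by ext <;> simp

variable [Distributive H]

/-- The left distributor `X ⊗ (Y ⊞ Z) ≅ (X ⊗ Y) ⊞ (X ⊗ Z)`. -/
noncomputable def distL (X Y Z : H) : X ⊗ (Y ⊞ Z) ≅ (X ⊗ Y) ⊞ (X ⊗ Z) :=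
  haveI := Distributive.isIso_distL X Y Z
  asIso (biprod.lift (X ◁ biprod.fst) (X ◁ biprod.snd))

/-- The left annihilator `X ⊗ 0 ≅ 0`. -/
noncomputable def annihilL (X : H) : X ⊗ (0 : H) ≅ 0 :=
  haveI := Distributive.isIso_annihil X
  asIso 0

variable [SymmetricCategory H]

/-- The right distributor `(X ⊞ Y) ⊗ Z ≅ (X ⊗ Z) ⊞ (Y ⊗ Z)`. -/
noncomputable def distR (X Y Z : H) : (X ⊞ Y) ⊗ Z ≅ (X ⊗ Z) ⊞ (Y ⊗ Z) :=
  β_ (X ⊞ Y) Z ≪≫ distL Z X Y ≪≫ biprod.mapIso (β_ Z X) (β_ Z Y)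

theorem distR_hom (X Y Z : H) :
    (distR X Y Z).hom = biprod.lift (biprod.fst ▷ Z) (biprod.snd ▷ Z) := by
  apply biprod.hom_ext <;> simp [distR, distL]

/-- The right annihilator `0 ⊗ X ≅ 0`. -/
noncomputable def annihilR (X : H) : (0 : H) ⊗ X ≅ 0 := β_ 0 X ≪≫ annihilL X

/-- The left unitor of `|`. -/
noncomputable def vbarLeftUnitor (K : H) : vbar 0 K ≅ K :=
  biprod.mapIso (annihilR K) (isoZeroBiprod (isZero_zero H)).symm ≪≫
    (isoZeroBiprod (isZero_zero H)).symm

/-- The right unitor of `|`. -/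
noncomputable def vbarRightUnitor (K : H) : vbar K 0 ≅ K :=
  biprod.mapIso (annihilL K) (isoBiprodZero (isZero_zero H)).symm ≪≫
    (isoZeroBiprod (isZero_zero H)).symm

/-- The associator of `|`. -/
noncomputable def vbarAssoc (K L M : H) : vbar (vbar K L) M ≅ vbar K (vbar L M) :=
  biprod.mapIso
      (distR (K ⊗ L) (K ⊞ L) M ≪≫ biprod.mapIso (α_ K L M) (distR K L M)) (Iso.refl _) ≪≫
    rearrange (K ⊗ (L ⊗ M)) (K ⊗ M) (L ⊗ M) (K ⊗ L) K L M ≪≫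
    biprod.mapIso
      (biprod.mapIso (Iso.refl _) (distL K L M).symm ≪≫ (distL K (L ⊗ M) (L ⊞ M)).symm)
      (Iso.refl _)

/-- The symmetry of `|`. -/
noncomputable def vbarBraiding (K L : H) : vbar K L ≅ vbar L K :=
  biprod.mapIso (β_ K L) (biprod.braiding K L)

/-! ### Interpretation of colours and objects -/

variable (H) in
/-- Interpretation of a colour. -/
@[reducible] noncomputable def semColor : Color → H
  | .zero => 0
  | .one => 𝟙_ H
  | .plus A B => semColor A ⊞ semColor B
  | .tensor A B => semColor A ⊗ semColor B

variable (H) in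
/-- Interpretation of an object: `⟦∅⟧ = 0` and `⟦X ∥ B⟧ = ⟦X⟧ | ⟦B⟧`. -/
@[reducible] noncomputable def semObj : Obj → H
  | .empty => 0
  | .snoc X B => vbar (semObj X) (semColor H B)

variable (H) in
/-- The structural isomorphism attached to a derivation of `A ≈ A'`. -/
noncomputable def semAdapt : {A A' : Color} → Adapt A A' → (semColor H A ≅ semColor H A')
  | _, _, .refl A => Iso.refl (semColor H A)
  | _, _, .symm h => (semAdapt h).symm
  | _, _, .trans h k => semAdapt h ≪≫ semAdapt k
  | _, _, .plusZero A => (isoBiprodZero (X := semColor H A) (isZero_zero H)).symm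
  | _, _, .zeroPlus A => (isoZeroBiprod (Y := semColor H A) (isZero_zero H)).symm
  | _, _, .tensorOne A => ρ_ (semColor H A)
  | _, _, .oneTensor A => λ_ (semColor H A)
  | _, _, .plusAssoc A B C => biprod.associator (semColor H A) (semColor H B) (semColor H C)
  | _, _, .tensorAssoc A B C => α_ (semColor H A) (semColor H B) (semColor H C)
  | _, _, .plusLeft h C => biprod.mapIso (semAdapt h) (Iso.refl (semColor H C))
  | _, _, .plusRight C h => biprod.mapIso (Iso.refl (semColor H C)) (semAdapt h)
  | _, _, .tensorLeft h C => whiskerRightIso (semAdapt h) (semColor H C)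
  | _, _, .tensorRight C h => whiskerLeftIso (semColor H C) (semAdapt h)

variable (H) in
/-- `⟦A ≈ A'⟧`, the structural isomorphism attached to some derivation of `A ≈ A'`; by coherence it
does not depend on the derivation. -/
noncomputable def semApprox {A A' : Color} (h : Approx A A') : semColor H A ≅ semColor H A' :=
  semAdapt H (Classical.choice h)

variable (H) in
/-- The structural isomorphism `⟦A⟧ ≅ 0 | ⟦A⟧` for a single wire. -/
noncomputable def semWire (A : Color) : semObj H (wire A) ≅ semColor H A :=
  vbarLeftUnitor (semColor H A)

variable (H) in
/-- The structural isomorphism `(0 | ⟦A⟧) | ⟦B⟧ ≅ ⟦A⟧ | ⟦B⟧` for two wires. -/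
noncomputable def semWires (A B : Color) :
    semObj H ((wire A).par (wire B)) ≅ vbar (semColor H A) (semColor H B) :=
  vbarIso (semWire H A) (Iso.refl (semColor H B))

variable (H) in
/-- The structural isomorphism `⟦X ∥ Y⟧ ≅ ⟦X⟧ | ⟦Y⟧`. -/
noncomputable def semPar (X : Obj) : (Y : Obj) →
    (semObj H (X.par Y) ≅ vbar (semObj H X) (semObj H Y))
  | .empty => (vbarRightUnitor (semObj H X)).symm
  | .snoc Y B => vbarIso (semPar X Y) (Iso.refl (semColor H B)) ≪≫
      vbarAssoc (semObj H X) (semObj H Y) (semColor H B)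

/-! ### Interpretation of diagrams -/

variable {R : Type u} [CommSemiring R]

/-- The morphism `s · id`. -/
noncomputable def semScalar (scal : ScalarIso R H) (s : R) (K : H) : K ⟶ K :=
  (λ_ K).inv ≫ (scal.toFun s ▷ K) ≫ (λ_ K).hom

/-- Interpretation of a functional diagram `X → Y` as a morphism `⟦X⟧ ⟶ ⟦Y⟧`. -/
noncomputable def sem (scal : ScalarIso R H) :
    {X Y : Obj} → Diag R X Y → (semObj H X ⟶ semObj H Y)
  | _, _, .id X => 𝟙 (semObj H X)
  | _, _, .swap A B =>
      (semWires H A B).hom ≫ (vbarBraiding (semColor H A) (semColor H B)).hom ≫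
        (semWires H B A).inv
  | _, _, .tensor A B => (semWires H A B).hom ≫ biprod.fst ≫ (semWire H (.tensor A B)).inv
  | _, _, .tensorInv A B => (semWire H (.tensor A B)).hom ≫ biprod.inl ≫ (semWires H A B).inv
  | _, _, .plus A B => (semWires H A B).hom ≫ biprod.snd ≫ (semWire H (.plus A B)).inv
  | _, _, .plusInv A B => (semWire H (.plus A B)).hom ≫ biprod.inr ≫ (semWires H A B).inv
  | _, _, .contr A => (semWires H A A).hom ≫ biprod.snd ≫
      biprod.desc (𝟙 (semColor H A)) (𝟙 (semColor H A)) ≫ (semWire H A).inv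
  | _, _, .contrInv A => (semWire H A).hom ≫
      biprod.lift (𝟙 (semColor H A)) (𝟙 (semColor H A)) ≫ biprod.inr ≫ (semWires H A A).inv
  | _, _, .null _ => 0
  | _, _, .nullInv _ => 0
  | _, _, .adapter (A := A) (A' := A') h =>
      (semWire H A).hom ≫ (semApprox H h).hom ≫ (semWire H A').inv
  | _, _, .scalar s A => (semWire H A).hom ≫ semScalar scal s (semColor H A) ≫ (semWire H A).inv
  | _, _, .comp d e => sem scal d ≫ sem scal e
  | _, _, .par (X := X) (Y := Y) (X' := X') (Y' := Y') d e =>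
      (semPar H X X').hom ≫ vbarMap (sem scal d) (sem scal e) ≫ (semPar H Y Y').inv

end Semantics

end TensorPlus

/-! ### Abstract models of the calculus -/

namespace TensorPlus

set_option linter.unusedSectionVars false

open scoped MonObj

universe u v w v' w'

/-! The calculus is shown to have matrices over `R` as normal forms, and the matrix of a diagram can
be read off from its interpretation.

Single wires. Contraction makes each wire a commutative monoid and its mirror a comonoid, so
morphisms out of a wire into a commutative monoid add by convolution. The usual compatibility laws
hold only up to a double plus D = P;P°, the projector keeping the part where exactly one of two
wires is active. D is controlled through the unit colour: by `x_plus` it touches only unit wires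
emitted by its two inputs, so it commutes with every `Unital` morphism (`Unital.D`), and a
contraction absorbs it (`D_Cn`). Consequently the `Nice` morphisms, which are unital and respect
contraction on both sides, are closed under composition, sum and ⊗; ⊕ is a biproduct for them
(`fst_inl_add_snd_inr`), ⊗ is bilinear and scalars are central. The identity of a wire is thus a
finite sum of rank-one terms (`sum_kout_kin`), and a nice morphism is determined by coefficients in
`R`. Distributivity gives the same decomposition in H (`sum_hout_hin`). `Rel` says that a morphism
of the calculus and one of H share their coefficients; each semantic morphism between colours has
exactly one counterpart (`Rel.exists_rel`, `Rel.ext`).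

Several wires. The axiom `mix` makes A ∥ B a retract of the single wire (A ⊗ B) ⊕ (A ⊕ B), the
colour that mimics A | B (`enc_dec`, `dec_T`, `dec_P`). Iterating, each object X is a retract of one
wire of colour `X.code` through `decode X`. A morphism g is simulated by ψ when `decode` intertwines
g with a counterpart of ψ; since `decode` has a section, ψ determines g (`Simulates.ext`). By
induction each diagram is simulated by its own interpretation (`simulates`); parallel composition is
the hard case and rests on the associativity of decoding (`dec_assoc`). Two diagrams with equal
interpretations are then simulated by the same ψ and coincide. Neither soundness nor a coherence
theorem for adapters is needed beforehand. -/

theorem Adapt.approx {A B : Color} (h : Adapt A B) : Approx A B := ⟨h⟩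

/-- A symmetric monoidal category with a dagger and a zero unit object, carrying the generators of
the functional calculus and satisfying its equations. -/
structure Calculus (R : Type u) [CommSemiring R] (C : Type v) [Category.{w} C] [MonoidalCategory C]
    [SymmetricCategory C] [HasZeroMorphisms C] where
  dag : ∀ {X Y : C}, (X ⟶ Y) → (Y ⟶ X)
  dag_dag : ∀ {X Y : C} (f : X ⟶ Y), dag (dag f) = f
  dag_id : ∀ X : C, dag (𝟙 X) = 𝟙 X
  dag_comp : ∀ {X Y Z : C} (f : X ⟶ Y) (g : Y ⟶ Z), dag (f ≫ g) = dag g ≫ dag f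
  dag_tensor : ∀ {X Y X' Y' : C} (f : X ⟶ Y) (g : X' ⟶ Y'), dag (f ⊗ₘ g) = dag f ⊗ₘ dag g
  dag_assoc : ∀ X Y Z : C, dag (α_ X Y Z).hom = (α_ X Y Z).inv
  dag_left : ∀ X : C, dag (λ_ X).hom = (λ_ X).inv
  dag_right : ∀ X : C, dag (ρ_ X).hom = (ρ_ X).inv
  dag_braid : ∀ X Y : C, dag (β_ X Y).hom = (β_ Y X).hom
  isZero_unit : IsZero (𝟙_ C)
  w : Color → C
  T (a b : Color) : w a ⊗ w b ⟶ w (.tensor a b)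
  P (a b : Color) : w a ⊗ w b ⟶ w (.plus a b)
  Cn (a : Color) : w a ⊗ w a ⟶ w a
  M {a b : Color} (h : Approx a b) : w a ⟶ w b
  s (r : R) (a : Color) : w a ⟶ w a
  dag_M {a b : Color} (h : Approx a b) : dag (M h) = M h.symm
  dag_s (r : R) (a : Color) : dag (s r a) = s r a
  tensor_tensor (a b) : dag (T a b) ≫ T a b = 𝟙 _
  plus_plus (a b) : dag (P a b) ≫ P a b = 𝟙 _
  tensor_plus (a b) : dag (T a b) ≫ P a b = 0
  id_zero : 𝟙 (w .zero) = 0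
  swap_contr (a) : (β_ (w a) (w a)).hom ≫ Cn a = Cn a
  n_tensor (a b c) (h : Approx (.tensor (.tensor a b) c) (.tensor a (.tensor b c))) :
    dag (T a b) ▷ w c ≫ (α_ _ _ _).hom ≫ w a ◁ T b c = T _ c ≫ M h ≫ dag (T a _)
  x_plus (a b) (h : Approx a (.tensor a .one)) (k : Approx b (.tensor .one b)) :
    P a b ≫ dag (P a b) = (M h ⊗ₘ M k) ≫ (dag (T a .one) ⊗ₘ dag (T .one b)) ≫ (α_ _ _ _).hom ≫
      w a ◁ ((α_ _ _ _).inv ≫ (Cn .one ≫ dag (Cn .one)) ▷ w b ≫ (α_ _ _ _).hom) ≫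
      (α_ _ _ _).inv ≫ (T a .one ⊗ₘ T .one b) ≫ (M h.symm ⊗ₘ M k.symm)
  plus_contr (a b) (ha : Approx a (.tensor a .one)) (hb : Approx b (.tensor b .one))
      (h : Approx (.tensor (.plus a b) .one) (.plus a b)) :
    P a b = (M ha ⊗ₘ M hb) ≫ (dag (T a .one) ⊗ₘ dag (T b .one)) ≫ tensorμ _ _ _ _ ≫
      (P a b ⊗ₘ Cn .one) ≫ T _ .one ≫ M h
  mix (a b) : (dag (Cn a) ⊗ₘ dag (Cn b)) ≫ tensorμ _ _ _ _ ≫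
      ((T a b ≫ dag (T a b)) ⊗ₘ (P a b ≫ dag (P a b))) ≫ tensorμ _ _ _ _ ≫ (Cn a ⊗ₘ Cn b) = 𝟙 _
  contr_unit (a) : (ρ_ (w a)).inv ≫ w a ◁ 0 ≫ Cn a = 𝟙 _
  contr_tensorInv (a b) : Cn (.tensor a b) ≫ dag (T a b) =
    (dag (T a b) ⊗ₘ dag (T a b)) ≫ tensorμ _ _ _ _ ≫ (Cn a ⊗ₘ Cn b)
  contr_tensor (a b) : Cn a ▷ w b ≫ T a b =
    (w a ⊗ w a) ◁ dag (Cn b) ≫ tensorμ _ _ _ _ ≫ (T a b ⊗ₘ T a b) ≫ Cn _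
  contr_plusInv (a b) : Cn (.plus a b) ≫ dag (P a b) = (P _ _ ≫ dag (P _ _)) ≫
    (dag (P a b) ⊗ₘ dag (P a b)) ≫ tensorμ _ _ _ _ ≫ (Cn a ⊗ₘ Cn b)
  contr_plusPlus (a b) : Cn a ▷ w b ≫ P a b ≫ dag (P a b) =
    (α_ _ _ _).hom ≫ w a ◁ (P a b ≫ dag (P a b)) ≫ w a ◁ (β_ _ _).hom ≫ (α_ _ _ _).inv ≫
      (P a b ≫ dag (P a b)) ▷ w a ≫ (α_ _ _ _).hom ≫ w a ◁ (β_ _ _).hom ≫ (α_ _ _ _).inv ≫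
      Cn a ▷ w b
  contr_contrInv (a) : Cn a ≫ dag (Cn a) = (P a a ≫ dag (P a a)) ≫ (dag (Cn a) ⊗ₘ dag (Cn a)) ≫
    tensorμ _ _ _ _ ≫ (Cn a ⊗ₘ Cn a)
  contr_assoc (a) : Cn a ▷ w a ≫ Cn a = (α_ _ _ _).hom ≫ w a ◁ Cn a ≫ Cn a
  contr_scalar (r a) : (s r a ⊗ₘ s r a) ≫ Cn a = Cn a ≫ s r a
  contr_adapter {a a'} (h : Approx a a') : (M h ⊗ₘ M h) ≫ Cn a' = Cn a ≫ M h
  assoc_tensor (a b c) (h : Approx (.tensor a (.tensor b c)) (.tensor (.tensor a b) c)) :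
    dag (T a (.tensor b c)) ≫ w a ◁ dag (T b c) =
      M h ≫ dag (T (.tensor a b) c) ≫ dag (T a b) ▷ w c ≫ (α_ _ _ _).hom
  assoc_plus (a b c) (h : Approx (.plus a (.plus b c)) (.plus (.plus a b) c)) :
    dag (P a (.plus b c)) ≫ w a ◁ dag (P b c) =
      M h ≫ dag (P (.plus a b) c) ≫ dag (P a b) ▷ w c ≫ (α_ _ _ _).hom
  adapter_tensor {a a' b b'} (h : Approx a a') (k : Approx b b')
      (hk : Approx (.tensor a b) (.tensor a' b')) :
    (M h ⊗ₘ M k) ≫ T a' b' = T a b ≫ M hk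
  adapter_plus {a a' b b'} (h : Approx a a') (k : Approx b b')
      (hk : Approx (.plus a b) (.plus a' b')) :
    (M h ⊗ₘ M k) ≫ P a' b' = P a b ≫ M hk
  unit_tensor (a) (h : Approx (.tensor a .one) a) (k : Approx (.tensor .one a) a) :
    T a .one ≫ M h = (β_ _ _).hom ≫ T .one a ≫ M k
  plus_zero (a) (h : Approx (.plus a .zero) a) : P a .zero ≫ M h = w a ◁ 0 ≫ (ρ_ _).hom
  zero_plus (a) (h : Approx (.plus .zero a) a) : P .zero a ≫ M h = 0 ▷ w a ≫ (λ_ _).hom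
  M_M {a b c} (h : Approx a b) (k : Approx b c) : M h ≫ M k = M (h.trans k)
  M_id (a) (h : Approx a a) : M h = 𝟙 _
  s_one (a) : s 1 a = 𝟙 _
  s_zero (a) : s 0 a = 0
  s_add (r t a) : s (r + t) a = dag (Cn a) ≫ (s r a ⊗ₘ s t a) ≫ Cn a
  s_tensor (r t a b) : (s r a ⊗ₘ s t b) ≫ T a b = T a b ≫ s (r * t) (.tensor a b)
  s_M (r) {a a'} (h : Approx a a') : s r a ≫ M h = M h ≫ s r a'

/-! ### Wires as commutative monoids, and the action of the unit colour -/

namespace Calculus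

variable {R : Type u} [CommSemiring R] {C : Type v} [Category.{w} C] [MonoidalCategory C]
  [SymmetricCategory C] [HasZeroMorphisms C] (K : Calculus R C)

attribute [simp] dag_dag dag_id dag_comp dag_tensor dag_assoc dag_left dag_right dag_braid dag_M
  dag_s

theorem from_unit (K : Calculus R C) {X : C} (f g : 𝟙_ C ⟶ X) : f = g :=
  K.isZero_unit.eq_of_src f g

theorem to_unit (K : Calculus R C) {X : C} (f g : X ⟶ 𝟙_ C) : f = g :=
  K.isZero_unit.eq_of_tgt f g

@[simp] theorem dag_whiskerLeft (X : C) {Y Z : C} (f : Y ⟶ Z) : K.dag (X ◁ f) = X ◁ K.dag f := by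
  rw [← id_tensorHom, dag_tensor, dag_id, id_tensorHom]

@[simp] theorem dag_whiskerRight {Y Z : C} (f : Y ⟶ Z) (X : C) : K.dag (f ▷ X) = K.dag f ▷ X := by
  rw [← tensorHom_id, dag_tensor, dag_id, tensorHom_id]

@[simp] theorem dag_assoc_inv (X Y Z : C) : K.dag (α_ X Y Z).inv = (α_ X Y Z).hom := by
  rw [← K.dag_assoc, dag_dag]

@[simp] theorem dag_left_inv (X : C) : K.dag (λ_ X).inv = (λ_ X).hom := by
  rw [← K.dag_left, dag_dag]

@[simp] theorem dag_right_inv (X : C) : K.dag (ρ_ X).inv = (ρ_ X).hom := by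
  rw [← K.dag_right, dag_dag]

@[simp] theorem dag_zero (X Y : C) : K.dag (0 : X ⟶ Y) = 0 := by
  have : (0 : X ⟶ Y) = (0 : X ⟶ 𝟙_ C) ≫ 0 := by simp
  rw [this, dag_comp, K.to_unit (K.dag (0 : 𝟙_ C ⟶ Y)) 0, zero_comp]

@[simp] theorem dag_tensorμ (X Y Z W : C) : K.dag (tensorμ X Y Z W) = tensorμ X Z Y W := by
  simp [tensorμ]

theorem dag_injective {X Y : C} {f g : X ⟶ Y} (h : K.dag f = K.dag g) : f = g := by
  rw [← K.dag_dag f, h, dag_dag]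

/-- The unit is the null state, written 0 because the monoidal unit is a zero object. Only the right
unit law is an axiom; commutativity supplies the left one. -/
instance (a : Color) : MonObj (K.w a) where
  one := 0
  mul := K.Cn a
  one_mul := by
    have h := K.contr_unit a
    rw [Iso.inv_comp_eq] at h
    rw [← K.swap_contr a, reassoc_of% (BraidedCategory.braiding_naturality_left (0 : 𝟙_ C ⟶ K.w a) (K.w a)), h]
    simp
  mul_one := by
    have h := K.contr_unit a
    rw [Iso.inv_comp_eq] at h
    simpa using h
  mul_assoc := K.contr_assoc a

theorem mul_def (a : Color) : μ[K.w a] = K.Cn a := rfl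

instance (a : Color) : IsCommMonObj (K.w a) where
  mul_comm := K.swap_contr a

theorem isMonHom (K : Calculus R C) {X Y : C} [MonObj X] [MonObj Y] {f : X ⟶ Y}
    (h : μ[X] ≫ f = (f ⊗ₘ f) ≫ μ[Y]) : IsMonHom f :=
  ⟨K.from_unit _ _, h⟩

/-- Two Pluses head to head. -/
def D (a b : Color) : K.w a ⊗ K.w b ⟶ K.w a ⊗ K.w b := K.P a b ≫ K.dag (K.P a b)

/-- The right action of the unit colour. -/
def act (a : Color) : K.w a ⊗ K.w .one ⟶ K.w a := K.T a .one ≫ K.M (Adapt.tensorOne a).approx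

/-- The left action of the unit colour. -/
def lact (a : Color) : K.w .one ⊗ K.w a ⟶ K.w a := K.T .one a ≫ K.M (Adapt.oneTensor a).approx

theorem braid_lact (a : Color) : (β_ _ _).hom ≫ K.lact a = K.act a :=
  (K.unit_tensor a _ _).symm

theorem braid_act (a : Color) : (β_ _ _).hom ≫ K.act a = K.lact a := by
  simp [← braid_lact]

theorem lact_one : K.lact .one = K.act .one := rfl

theorem M_inv {a b : Color} (h : Approx a b) (k : Approx b a) : K.M h ≫ K.M k = 𝟙 _ := by
  rw [M_M, M_id]

theorem M_inv_assoc {a b : Color} (h : Approx a b) (k : Approx b a) {X : C} (f : K.w a ⟶ X) :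
    K.M h ≫ K.M k ≫ f = f := by
  rw [← Category.assoc, M_inv, Category.id_comp]

theorem M_M_assoc {a b c : Color} (h : Approx a b) (k : Approx b c) {X : C} (f : K.w c ⟶ X) :
    K.M h ≫ K.M k ≫ f = K.M (h.trans k) ≫ f := by
  rw [← Category.assoc, M_M]

theorem dag_act_act (a : Color) : K.dag (K.act a) ≫ K.act a = 𝟙 _ := by
  simp only [act, dag_comp, Category.assoc, reassoc_of% (K.tensor_tensor a .one), dag_M, M_inv]

theorem T_assoc (a b c : Color) (h : Approx (.tensor (.tensor a b) c) (.tensor a (.tensor b c))) :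
    K.T a b ▷ K.w c ≫ K.T _ c ≫ K.M h = (α_ _ _ _).hom ≫ K.w a ◁ K.T b c ≫ K.T a _ := by
  have := congrArg K.dag (K.assoc_tensor a b c h.symm)
  simp only [dag_comp, dag_whiskerLeft, dag_whiskerRight, dag_dag, dag_M, dag_assoc,
    Category.assoc] at this
  rw [this]
  simp

theorem M_T_left {a a' b : Color} (h : Approx a a') (hk : Approx (.tensor a b) (.tensor a' b)) :
    K.M h ▷ K.w b ≫ K.T a' b = K.T a b ≫ K.M hk := by
  rw [← K.adapter_tensor h (Adapt.refl b).approx hk, M_id, tensorHom_id]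

theorem M_T_right {a b b' : Color} (h : Approx b b') (hk : Approx (.tensor a b) (.tensor a b')) :
    K.w a ◁ K.M h ≫ K.T a b' = K.T a b ≫ K.M hk := by
  rw [← K.adapter_tensor (Adapt.refl a).approx h hk, M_id, id_tensorHom]

theorem act_assoc (a : Color) :
    K.act a ▷ K.w .one ≫ K.act a = (α_ _ _ _).hom ≫ K.w a ◁ K.act .one ≫ K.act a := by
  have h1 : Approx (.tensor (.tensor a .one) .one) (.tensor a .one) :=
    (Adapt.tensorLeft (.tensorOne a) .one).approx
  have h2 : Approx (.tensor a (.tensor .one .one)) (.tensor a .one) :=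
    (Adapt.tensorRight a (.tensorOne .one)).approx
  have h3 : Approx (.tensor (.tensor a .one) .one) (.tensor a (.tensor .one .one)) :=
    (Adapt.tensorAssoc a .one .one).approx
  simp only [act, comp_whiskerRight, whiskerLeft_comp, Category.assoc,
    reassoc_of% (K.M_T_left _ h1), reassoc_of% (K.M_T_right _ h2), M_M]
  rw [← reassoc_of% (K.T_assoc a .one .one h3), M_M]

/-- This is `n_tensor` with middle colour 𝟙: the projector T;T° is realised by letting `a` emit a
unit wire that `c` absorbs. Whatever commutes with the unit colour can therefore slide past this
projector. -/
theorem T_dag_T_left (a c : Color) : K.dag (K.act a) ▷ K.w c ≫ (α_ _ _ _).hom ≫ K.w a ◁ K.lact c =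
    K.T a c ≫ K.dag (K.T a c) := by
  have h1 : Approx (.tensor a c) (.tensor (.tensor a .one) c) :=
    (Adapt.tensorLeft (.symm (.tensorOne a)) c).approx
  have h2 : Approx (.tensor a (.tensor .one c)) (.tensor a c) :=
    (Adapt.tensorRight a (.oneTensor c)).approx
  have h3 : Approx (.tensor (.tensor a .one) c) (.tensor a (.tensor .one c)) :=
    (Adapt.tensorAssoc a .one c).approx
  have h4 := congrArg K.dag (K.M_T_right (Adapt.symm (.oneTensor c)).approx h2.symm)
  simp only [dag_comp, dag_whiskerLeft, dag_M] at h4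
  simp only [act, lact, comp_whiskerRight, whiskerLeft_comp, Category.assoc, dag_comp, dag_M]
  rw [reassoc_of% (K.n_tensor a .one c h3), h4, reassoc_of% (K.M_T_left _ h1), M_M_assoc,
    M_inv_assoc]

theorem T_dag_T_right (c a : Color) :
    K.w c ◁ K.dag (K.lact a) ≫ (α_ _ _ _).inv ≫ K.act c ▷ K.w a = K.T c a ≫ K.dag (K.T c a) := by
  have := congrArg K.dag (K.T_dag_T_left c a)
  simpa only [dag_comp, dag_whiskerLeft, dag_whiskerRight, dag_dag, dag_assoc, Category.assoc]
    using this

/-- The case c = 𝟙 is a Frobenius law relating the action to its mirror. It is what upgrades the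
single equation `Unital` to equivariance. -/
theorem act_dag_act (a : Color) :
    K.dag (K.act a) ▷ K.w .one ≫ (α_ _ _ _).hom ≫ K.w a ◁ K.act .one =
      K.act a ≫ K.dag (K.act a) := by
  rw [← lact_one, T_dag_T_left]
  simp only [act, dag_comp, Category.assoc, dag_M, M_inv_assoc]

theorem dag_act_T (a b : Color) :
    K.dag (K.act (.tensor a b)) ≫ K.dag (K.T a b) ▷ K.w .one ≫ (α_ _ _ _).hom =
      K.dag (K.T a b) ≫ K.w a ◁ K.dag (K.act b) := by
  have h3 : Approx (.tensor a (.tensor b .one)) (.tensor (.tensor a b) .one) :=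
    (Adapt.symm (.tensorAssoc a b .one)).approx
  have h2 : Approx (.tensor a (.tensor b .one)) (.tensor a b) := (Adapt.tensorRight a (.tensorOne b)).approx
  have h4 := congrArg K.dag (K.M_T_right (Adapt.tensorOne b).approx h2)
  simp only [dag_comp, dag_whiskerLeft, dag_M] at h4
  simp only [act, whiskerLeft_comp, dag_comp, dag_M, Category.assoc]
  rw [reassoc_of% h4, K.assoc_tensor a b .one h3, M_M_assoc]

/-- D sees its inputs only through the unit wires they emit, on which it acts by C;C°. Naturality of
D reduces to equivariance for the unit colour. -/
theorem D_eq (a b : Color) : K.D a b = (K.dag (K.act a) ⊗ₘ K.dag (K.lact b)) ≫ (α_ _ _ _).hom ≫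
      K.w a ◁ ((α_ _ _ _).inv ≫ (K.Cn .one ≫ K.dag (K.Cn .one)) ▷ K.w b ≫ (α_ _ _ _).hom) ≫
      (α_ _ _ _).inv ≫ (K.act a ⊗ₘ K.lact b) := by
  rw [D, K.x_plus a b (Adapt.symm (.tensorOne a)).approx (Adapt.symm (.oneTensor b)).approx]
  simp only [act, lact, dag_comp, dag_M, tensorHom_comp_tensorHom, tensorHom_comp_tensorHom_assoc]

theorem dag_D (a b : Color) : K.dag (K.D a b) = K.D a b := by simp [D]

theorem D_D (a b : Color) : K.D a b ≫ K.D a b = K.D a b := by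
  simp only [D, Category.assoc, reassoc_of% (K.plus_plus a b)]

theorem dag_P_T (a b : Color) : K.dag (K.P a b) ≫ K.T a b = 0 := by
  simpa using congrArg K.dag (K.tensor_plus a b)

theorem D_T (a b : Color) : K.D a b ≫ K.T a b = 0 := by
  rw [D, Category.assoc, dag_P_T, comp_zero]

theorem dag_T_D (a b : Color) : K.dag (K.T a b) ≫ K.D a b = 0 := by
  rw [D, reassoc_of% (K.tensor_plus a b), zero_comp]

end Calculus

namespace Calculus

variable {R : Type u} [CommSemiring R] {C : Type v} [Category.{w} C] [MonoidalCategory C]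
  [SymmetricCategory C] [HasZeroMorphisms C] (K : Calculus R C)

/-! ### Inclusions and projections of parallel wires -/

section

/-- The left inclusion `X ⟶ X ⊗ Y`, null on `Y`. -/
def il (X Y : C) : X ⟶ X ⊗ Y := (ρ_ X).inv ≫ X ◁ 0

/-- The right inclusion `Y ⟶ X ⊗ Y`, null on `X`. -/
def ir (X Y : C) : Y ⟶ X ⊗ Y := (λ_ Y).inv ≫ 0 ▷ Y

/-- The left projection `X ⊗ Y ⟶ X`, null on `Y`. -/
def pl (X Y : C) : X ⊗ Y ⟶ X := X ◁ 0 ≫ (ρ_ X).hom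

/-- The right projection `X ⊗ Y ⟶ Y`, null on `X`. -/
def pr (X Y : C) : X ⊗ Y ⟶ Y := 0 ▷ Y ≫ (λ_ Y).hom

theorem dag_il (X Y : C) : K.dag (il X Y) = pl X Y := by simp [il, pl]

theorem dag_ir (X Y : C) : K.dag (ir X Y) = pr X Y := by simp [ir, pr]

theorem dag_pl (X Y : C) : K.dag (pl X Y) = il X Y := by simp [il, pl]

theorem dag_pr (X Y : C) : K.dag (pr X Y) = ir X Y := by simp [ir, pr]

theorem il_tensor {X Y X' Y' : C} (f : X ⟶ X') (g : Y ⟶ Y') :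
    il X Y ≫ (f ⊗ₘ g) = f ≫ il X' Y' := by
  rw [il, il, Category.assoc, tensorHom_def', ← whiskerLeft_comp_assoc, zero_comp,
    whisker_exchange]
  simp

theorem ir_tensor {X Y X' Y' : C} (f : X ⟶ X') (g : Y ⟶ Y') :
    ir X Y ≫ (f ⊗ₘ g) = g ≫ ir X' Y' := by
  rw [ir, ir, Category.assoc, MonoidalCategory.tensorHom_def, ← comp_whiskerRight_assoc, zero_comp,
    ← whisker_exchange]
  simp

theorem tensor_pl {X Y X' Y' : C} (f : X ⟶ X') (g : Y ⟶ Y') :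
    (f ⊗ₘ g) ≫ pl X' Y' = pl X Y ≫ f := by
  rw [pl, pl, Category.assoc, MonoidalCategory.tensorHom_def, Category.assoc, ← whiskerLeft_comp_assoc, comp_zero,
    ← whisker_exchange_assoc]
  simp

theorem tensor_pr {X Y X' Y' : C} (f : X ⟶ X') (g : Y ⟶ Y') :
    (f ⊗ₘ g) ≫ pr X' Y' = pr X Y ≫ g := by
  rw [pr, pr, Category.assoc, tensorHom_def', Category.assoc, ← comp_whiskerRight_assoc, comp_zero,
    whisker_exchange_assoc]
  simp

theorem il_braid (X Y : C) : il X Y ≫ (β_ X Y).hom = ir Y X := by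
  simp [il, ir]

theorem ir_braid (X Y : C) : ir X Y ≫ (β_ X Y).hom = il Y X := by
  simp [il, ir]

theorem tensor_zero {X Y X' Y' : C} (f : X ⟶ X') :
    (f ⊗ₘ (0 : Y ⟶ Y')) = pl X Y ≫ f ≫ il X' Y' := by
  have : (0 : Y ⟶ Y') = (0 : Y ⟶ 𝟙_ C) ≫ 0 := by simp
  rw [this, tensorHom_def', pl, il]
  simp only [whiskerLeft_comp, Category.assoc]
  rw [whisker_exchange]
  simp

theorem zero_tensor {X Y X' Y' : C} (f : X ⟶ X') :
    ((0 : Y ⟶ Y') ⊗ₘ f) = pr Y X ≫ f ≫ ir Y' X' := by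
  have : (0 : Y ⟶ Y') = (0 : Y ⟶ 𝟙_ C) ≫ 0 := by simp
  rw [this, MonoidalCategory.tensorHom_def, pr, ir]
  simp only [comp_whiskerRight, Category.assoc]
  rw [← whisker_exchange]
  simp

theorem il_pl (K : Calculus R C) (X Y : C) : il X Y ≫ pl X Y = 𝟙 X := by
  rw [il, pl, Category.assoc, ← whiskerLeft_comp_assoc, K.to_unit ((0 : 𝟙_ C ⟶ Y) ≫ 0) (𝟙 _)]
  simp

theorem ir_pr (K : Calculus R C) (X Y : C) : ir X Y ≫ pr X Y = 𝟙 Y := by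
  rw [ir, pr, Category.assoc, ← comp_whiskerRight_assoc, K.to_unit ((0 : 𝟙_ C ⟶ X) ≫ 0) (𝟙 _)]
  simp

theorem zero_of_unit (K : Calculus R C) {X Y : C} (f : X ⟶ 𝟙_ C) (g : 𝟙_ C ⟶ Y) : f ≫ g = 0 := by
  rw [K.to_unit f 0, zero_comp]

theorem il_pr (K : Calculus R C) (X Y : C) : il X Y ≫ pr X Y = 0 := by
  rw [il, pr, Category.assoc, whisker_exchange_assoc, leftUnitor_naturality,
    ← Category.assoc, ← Category.assoc, zero_of_unit K]

theorem ir_pl (K : Calculus R C) (X Y : C) : ir X Y ≫ pl X Y = 0 := by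
  rw [ir, pl, Category.assoc, ← whisker_exchange_assoc, rightUnitor_naturality,
    ← Category.assoc, ← Category.assoc, zero_of_unit K]

theorem il_tensorμ (K : Calculus R C) (X Y Z W : C) :
    il (X ⊗ Y) (Z ⊗ W) ≫ tensorμ X Y Z W = (il X Z ⊗ₘ il Y W) := by
  rw [il, K.from_unit (0 : 𝟙_ C ⟶ Z ⊗ W) ((λ_ _).inv ≫ (0 ⊗ₘ 0)), whiskerLeft_comp, Category.assoc,
    Category.assoc, tensorμ_natural_right]
  have h2 : (ρ_ (X ⊗ Y)).inv ≫ (X ⊗ Y) ◁ (λ_ (𝟙_ C)).inv ≫ tensorμ X Y (𝟙_ C) (𝟙_ C) =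
      ((ρ_ X).inv ⊗ₘ (ρ_ Y).inv) := by
    rw [← cancel_mono ((ρ_ X).hom ⊗ₘ (ρ_ Y).hom), Category.assoc, Category.assoc,
      ← tensor_right_unitality X Y]
    simp
  rw [reassoc_of% h2, tensorHom_comp_tensorHom, il, il]

theorem ir_tensorμ (K : Calculus R C) (X Y Z W : C) :
    ir (X ⊗ Y) (Z ⊗ W) ≫ tensorμ X Y Z W = (ir X Z ⊗ₘ ir Y W) := by
  rw [ir, K.from_unit (0 : 𝟙_ C ⟶ X ⊗ Y) ((λ_ _).inv ≫ (0 ⊗ₘ 0)), comp_whiskerRight, Category.assoc,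
    Category.assoc, tensorμ_natural_left]
  have h2 : (λ_ (Z ⊗ W)).inv ≫ (λ_ (𝟙_ C)).inv ▷ (Z ⊗ W) ≫ tensorμ (𝟙_ C) (𝟙_ C) Z W =
      ((λ_ Z).inv ⊗ₘ (λ_ W).inv) := by
    rw [← cancel_mono ((λ_ Z).hom ⊗ₘ (λ_ W).hom), Category.assoc, Category.assoc,
      ← tensor_left_unitality Z W]
    simp
  rw [reassoc_of% h2, tensorHom_comp_tensorHom, ir, ir]

theorem tensorμ_pl (K : Calculus R C) (X Y Z W : C) : tensorμ X Z Y W ≫ pl (X ⊗ Y) (Z ⊗ W) = (pl X Z ⊗ₘ pl Y W) := by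
  apply K.dag_injective
  simp only [dag_comp, dag_tensorμ, dag_pl, dag_tensor, K.il_tensorμ]

theorem tensorμ_pr (K : Calculus R C) (X Y Z W : C) : tensorμ X Z Y W ≫ pr (X ⊗ Y) (Z ⊗ W) = (pr X Z ⊗ₘ pr Y W) := by
  apply K.dag_injective
  simp only [dag_comp, dag_tensorμ, dag_pr, dag_tensor, K.ir_tensorμ]

theorem il_mul (X : C) [MonObj X] (K : Calculus R C) : il X X ≫ μ[X] = 𝟙 X := by
  rw [il, K.from_unit (0 : 𝟙_ C ⟶ X) η[X], Category.assoc, MonObj.mul_one, Iso.inv_hom_id]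

theorem ir_mul (X : C) [MonObj X] (K : Calculus R C) : ir X X ≫ μ[X] = 𝟙 X := by
  rw [ir, K.from_unit (0 : 𝟙_ C ⟶ X) η[X], Category.assoc, MonObj.one_mul, Iso.inv_hom_id]

theorem isMonHom_zero (K : Calculus R C) (X : C) [MonObj X] : IsMonHom (0 : 𝟙_ C ⟶ X) := by
  apply K.isMonHom
  rw [← cancel_epi (λ_ (𝟙_ C)).inv]
  exact K.from_unit _ _

theorem isMonHom_il (K : Calculus R C) (X Y : C) [MonObj X] [MonObj Y] : IsMonHom (il X Y) := by
  have := K.isMonHom_zero Y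
  unfold il
  infer_instance

theorem isMonHom_ir (K : Calculus R C) (X Y : C) [MonObj X] [MonObj Y] : IsMonHom (ir X Y) := by
  have := K.isMonHom_zero X
  unfold ir
  infer_instance

end

/-! ### Morphisms commuting with the action of the unit colour -/

/-- `f` is equivariant for the (co)action of the unit colour. -/
def Unital {a b : Color} (f : K.w a ⟶ K.w b) : Prop :=
  K.dag (K.act a) ≫ f ▷ K.w .one ≫ K.act b = f

variable {K}
variable {a b c d : Color}

theorem Unital.dag {f : K.w a ⟶ K.w b} (hf : K.Unital f) : K.Unital (K.dag f) := by
  have := congrArg K.dag hf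
  simpa [Unital] using this

/-- Being unital only says that f survives emitting and reabsorbing a unit wire. The Frobenius law
`act_dag_act` trades an incoming unit wire for an emitted one, and associativity of the action lets
the two unit wires merge before f is reached. -/
theorem Unital.act {f : K.w a ⟶ K.w b} (hf : K.Unital f) :
    f ▷ K.w .one ≫ K.act b = K.act a ≫ f := by
  have h : K.act a ≫ f = K.act a ≫ K.dag (K.act a) ≫ f ▷ K.w .one ≫ K.act b := by rw [hf]
  rw [h, ← reassoc_of% (K.act_dag_act a), whisker_exchange_assoc,
    ← associator_naturality_left_assoc, ← K.act_assoc, ← comp_whiskerRight_assoc,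
    ← comp_whiskerRight_assoc, Category.assoc, hf]

theorem Unital.dag_act {f : K.w a ⟶ K.w b} (hf : K.Unital f) :
    K.dag (K.act a) ≫ f ▷ K.w .one = f ≫ K.dag (K.act b) := by
  simpa using congrArg K.dag hf.dag.act

theorem Unital.lact {f : K.w a ⟶ K.w b} (hf : K.Unital f) :
    K.w .one ◁ f ≫ K.lact b = K.lact a ≫ f := by
  rw [← K.braid_act a, ← K.braid_act b, BraidedCategory.braiding_naturality_right_assoc, hf.act,
    Category.assoc]

theorem Unital.dag_lact {f : K.w a ⟶ K.w b} (hf : K.Unital f) :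
    K.dag (K.lact a) ≫ K.w .one ◁ f = f ≫ K.dag (K.lact b) := by
  simpa using congrArg K.dag hf.dag.lact

theorem Unital.comp {f : K.w a ⟶ K.w b} {g : K.w b ⟶ K.w c} (hf : K.Unital f) (hg : K.Unital g) :
    K.Unital (f ≫ g) := by
  rw [Unital, comp_whiskerRight, Category.assoc, hg.act, reassoc_of% hf]

/-- By `T_dag_T_left` the projector T;T° emits a unit wire from the left input and feeds it to the
right one. A unital f can be moved across the emission, so the projector after f may be replaced by
the one before it. -/
theorem Unital.whiskerRight_T {f : K.w a ⟶ K.w b} (hf : K.Unital f) (c : Color) :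
    K.T a c ≫ K.dag (K.T a c) ≫ f ▷ K.w c ≫ K.T b c = f ▷ K.w c ≫ K.T b c := by
  have h : f ▷ K.w c ≫ K.T b c = f ▷ K.w c ≫ K.T b c ≫ K.dag (K.T b c) ≫ K.T b c := by
    rw [K.tensor_tensor, Category.comp_id]
  conv_rhs => rw [h, ← reassoc_of% (K.T_dag_T_left b c), ← comp_whiskerRight_assoc, ← hf.dag_act]
  rw [← reassoc_of% (K.T_dag_T_left a c)]
  simp only [comp_whiskerRight, Category.assoc, associator_naturality_left_assoc]
  rw [whisker_exchange_assoc]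

theorem Unital.whiskerLeft_T {f : K.w a ⟶ K.w b} (hf : K.Unital f) (c : Color) :
    K.T c a ≫ K.dag (K.T c a) ≫ K.w c ◁ f ≫ K.T c b = K.w c ◁ f ≫ K.T c b := by
  have h : K.w c ◁ f ≫ K.T c b = K.w c ◁ f ≫ K.T c b ≫ K.dag (K.T c b) ≫ K.T c b := by
    rw [K.tensor_tensor, Category.comp_id]
  conv_rhs => rw [h, ← reassoc_of% (K.T_dag_T_right c b), ← whiskerLeft_comp_assoc, ← hf.dag_lact]
  rw [← reassoc_of% (K.T_dag_T_right c a)]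
  simp only [whiskerLeft_comp, Category.assoc, associator_inv_naturality_right_assoc]
  rw [whisker_exchange_assoc]

theorem Unital.T {f : K.w a ⟶ K.w b} {g : K.w c ⟶ K.w d} (hf : K.Unital f) (hg : K.Unital g) :
    K.T a c ≫ K.dag (K.T a c) ≫ (f ⊗ₘ g) ≫ K.T b d = (f ⊗ₘ g) ≫ K.T b d := by
  have h : (f ⊗ₘ g) ≫ K.T b d = f ▷ K.w c ≫ K.T b c ≫ K.dag (K.T b c) ≫ K.w b ◁ g ≫ K.T b d := by
    rw [hg.whiskerLeft_T, MonoidalCategory.tensorHom_def, Category.assoc]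
  rw [h, reassoc_of% (hf.whiskerRight_T c)]

theorem Unital.dag_T {f : K.w a ⟶ K.w b} {g : K.w c ⟶ K.w d} (hf : K.Unital f) (hg : K.Unital g) :
    K.dag (K.T a c) ≫ (f ⊗ₘ g) ≫ K.T b d ≫ K.dag (K.T b d) = K.dag (K.T a c) ≫ (f ⊗ₘ g) := by
  simpa using congrArg K.dag (hf.dag.T hg.dag)

/-- Only the interchange law is used: f and g live on the outer wires, e on the two inner ones. -/
theorem whisker_middle {X X' Y Y' U : C} (f : X ⟶ X') (g : Y ⟶ Y') (e : U ⊗ U ⟶ U ⊗ U) :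
    (f ▷ U ⊗ₘ U ◁ g) ≫ (α_ _ _ _).hom ≫ X' ◁ ((α_ _ _ _).inv ≫ e ▷ Y' ≫ (α_ _ _ _).hom) ≫
      (α_ _ _ _).inv =
    (α_ _ _ _).hom ≫ X ◁ ((α_ _ _ _).inv ≫ e ▷ Y ≫ (α_ _ _ _).hom) ≫ (α_ _ _ _).inv ≫
      (f ▷ U ⊗ₘ U ◁ g) := by
  have h1 : (f ▷ U ⊗ₘ U ◁ g) ≫ (α_ _ _ _).hom ≫ X' ◁ (α_ _ _ _).inv =
      (α_ _ _ _).hom ≫ X ◁ (α_ _ _ _).inv ≫ (f ⊗ₘ (U ⊗ U) ◁ g) := by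
    simp [MonoidalCategory.tensorHom_def]
  have h2 : (f ⊗ₘ (U ⊗ U) ◁ g) ≫ X' ◁ (α_ U U Y').hom ≫ (α_ _ _ _).inv =
      X ◁ (α_ _ _ _).hom ≫ (α_ _ _ _).inv ≫ (f ▷ U ⊗ₘ U ◁ g) := by
    simp [MonoidalCategory.tensorHom_def]
  have h3 : (f ⊗ₘ (U ⊗ U) ◁ g) ≫ X' ◁ e ▷ Y' = X ◁ e ▷ Y ≫ (f ⊗ₘ (U ⊗ U) ◁ g) := by
    rw [MonoidalCategory.tensorHom_def]
    simp only [Category.assoc, ← whiskerLeft_comp, whisker_exchange]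
    simp only [whiskerLeft_comp, whisker_exchange_assoc]
  simp only [whiskerLeft_comp, Category.assoc]
  rw [reassoc_of% h1, reassoc_of% h3, h2]

/-- In the form `D_eq`, the operation on the emitted unit wires is untouched by f and g;
equivariance carries f and g through emission and absorption. -/
theorem Unital.D {f : K.w a ⟶ K.w b} {g : K.w c ⟶ K.w d} (hf : K.Unital f) (hg : K.Unital g) :
    (f ⊗ₘ g) ≫ K.D b d = K.D a c ≫ (f ⊗ₘ g) := by
  rw [D_eq, D_eq, tensorHom_comp_tensorHom_assoc, ← hf.dag_act, ← hg.dag_lact,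
    ← tensorHom_comp_tensorHom_assoc]
  generalize K.Cn .one ≫ K.dag (K.Cn .one) = e
  rw [reassoc_of% (whisker_middle f g e), tensorHom_comp_tensorHom, hf.act, hg.lact]
  simp only [Category.assoc, tensorHom_comp_tensorHom]

end Calculus

/-! ### The double plus and the injections and projections of ⊕ -/

namespace Calculus

variable {R : Type u} [CommSemiring R] {C : Type v} [Category.{w} C] [MonoidalCategory C]
  [SymmetricCategory C] [HasZeroMorphisms C] (K : Calculus R C)

theorem tensorμ_braid (X Y Z W : C) : (β_ (X ⊗ Y) (Z ⊗ W)).hom ≫ tensorμ Z W X Y =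
    tensorμ X Y Z W ≫ ((β_ X Z).hom ⊗ₘ (β_ Y W).hom) := by
  simp [tensorμ, SymmetricCategory.braiding_swap_eq_inv_braiding W X, MonoidalCategory.tensorHom_def]

theorem braid_middle (U b : C) : U ◁ (β_ b U).hom ≫ (α_ U U b).inv ≫ (β_ (U ⊗ U) b).hom =
    (α_ _ _ _).inv ≫ (β_ U b).hom ▷ U ≫ (α_ _ _ _).hom := by
  simp [← whiskerLeft_comp_assoc, ← MonoidalCategory.whiskerLeft_comp_assoc]

theorem braid_middle' (U b : C) : (β_ b (U ⊗ U)).hom ≫ (α_ U U b).hom ≫ U ◁ (β_ U b).hom =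
    (α_ _ _ _).inv ≫ (β_ b U).hom ▷ U ≫ (α_ _ _ _).hom := by
  simp [← MonoidalCategory.whiskerLeft_comp]

theorem conj_middle (U b : C) (e : U ⊗ U ⟶ U ⊗ U) :
    U ◁ (β_ b U).hom ≫ (α_ _ _ _).inv ≫ e ▷ b ≫ (α_ _ _ _).hom ≫ U ◁ (β_ U b).hom =
      ((α_ _ _ _).inv ≫ (β_ U b).hom ▷ U ≫ (α_ _ _ _).hom) ≫ b ◁ e ≫
       ((α_ _ _ _).inv ≫ (β_ b U).hom ▷ U ≫ (α_ _ _ _).hom) := by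
  have h1 := braid_middle U b
  have h2 : (α_ U U b).hom ≫ U ◁ (β_ U b).hom =
      (β_ (U ⊗ U) b).hom ≫ (α_ _ _ _).inv ≫ (β_ b U).hom ▷ U ≫ (α_ _ _ _).hom := by
    rw [← braid_middle', SymmetricCategory.symmetry_assoc]
  rw [h2, ← h1]
  simp only [Category.assoc]
  congr 2
  rw [← BraidedCategory.braiding_naturality_left_assoc]

/-- This turns the asymmetric shape of `x_plus`, with unit wires facing each other, into a symmetric
one using only right actions, from which the commutation of D with the braiding is visible. -/
theorem middle_eq_tensorμ (a b U : C) (e : U ⊗ U ⟶ U ⊗ U) :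
    (a ⊗ U) ◁ (β_ b U).hom ≫ (α_ _ _ _).hom ≫
      a ◁ ((α_ _ _ _).inv ≫ e ▷ b ≫ (α_ _ _ _).hom) ≫ (α_ _ _ _).inv ≫ (a ⊗ U) ◁ (β_ U b).hom =
    tensorμ _ _ _ _ ≫ (a ⊗ b) ◁ e ≫ tensorμ _ _ _ _ := by
  have h1 : (a ⊗ U) ◁ (β_ b U).hom ≫ (α_ a U (U ⊗ b)).hom =
    (α_ _ _ _).hom ≫ a ◁ U ◁ (β_ b U).hom := by simp
  have h2 : (α_ a U (U ⊗ b)).inv ≫ (a ⊗ U) ◁ (β_ U b).hom =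
    a ◁ U ◁ (β_ U b).hom ≫ (α_ _ _ _).inv := by simp
  rw [h2, reassoc_of% h1, ← MonoidalCategory.whiskerLeft_comp_assoc, ← MonoidalCategory.whiskerLeft_comp_assoc,
    Category.assoc, Category.assoc, Category.assoc, conj_middle]
  simp [tensorμ]

/-- A null input absorbs the scalar 0. By `s_tensor` scalars on the inputs of T multiply into one
scalar on the output, here 0 · 1 = 0. -/
theorem ir_T (a b : Color) : ir (K.w a) (K.w b) ≫ K.T a b = 0 := by
  have h : (0 : 𝟙_ C ⟶ K.w a) ▷ K.w b = 0 ▷ K.w b ≫ (K.s 0 a ⊗ₘ K.s 1 b) := by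
    rw [s_zero, s_one, tensorHom_id, ← comp_whiskerRight, zero_comp]
  rw [ir, Category.assoc, h, Category.assoc, s_tensor, zero_mul, s_zero, comp_zero, comp_zero,
    comp_zero]

theorem il_T (a b : Color) : il (K.w a) (K.w b) ≫ K.T a b = 0 := by
  have h : K.w a ◁ (0 : 𝟙_ C ⟶ K.w b) = K.w a ◁ 0 ≫ (K.s 1 a ⊗ₘ K.s 0 b) := by
    rw [s_zero, s_one, id_tensorHom, ← whiskerLeft_comp, zero_comp]
  rw [il, Category.assoc, h, Category.assoc, s_tensor, mul_zero, s_zero, comp_zero, comp_zero,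
    comp_zero]

theorem dag_T_pl (a b : Color) : K.dag (K.T a b) ≫ pl _ _ = 0 := by
  simpa [dag_il] using congrArg K.dag (K.il_T a b)

theorem dag_T_pr (a b : Color) : K.dag (K.T a b) ≫ pr _ _ = 0 := by
  simpa [dag_ir] using congrArg K.dag (K.ir_T a b)

theorem dag_Cn_pl (a : Color) : K.dag (K.Cn a) ≫ pl _ _ = 𝟙 _ := by
  simpa [dag_il, mul_def] using congrArg K.dag (il_mul (K.w a) K)

theorem dag_Cn_pr (a : Color) : K.dag (K.Cn a) ≫ pr _ _ = 𝟙 _ := by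
  simpa [dag_ir, mul_def] using congrArg K.dag (ir_mul (K.w a) K)

theorem il_middle (K : Calculus R C) (X Y U V : C) :
    il (X ⊗ U) (V ⊗ Y) ≫ (α_ X U (V ⊗ Y)).hom ≫ X ◁ (α_ U V Y).inv =
      X ◁ (il U V ≫ il (U ⊗ V) Y) := by
  rw [il, K.from_unit (0 : 𝟙_ C ⟶ V ⊗ Y) ((λ_ _).inv ≫ (0 ⊗ₘ 0)), il, il]
  generalize (0 : 𝟙_ C ⟶ V) = z
  generalize (0 : 𝟙_ C ⟶ Y) = z'
  rw [MonoidalCategory.tensorHom_def]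
  monoidal

theorem il_middle' (X Y U V : C) :
    X ◁ il (U ⊗ V) Y ≫ X ◁ (α_ U V Y).hom ≫ (α_ X U (V ⊗ Y)).inv =
      (α_ X U V).inv ≫ (X ⊗ U) ◁ il V Y := by
  rw [il, il]
  monoidal

theorem assoc_pl (X U V : C) : (α_ X U V).inv ≫ pl (X ⊗ U) V = X ◁ pl U V := by
  rw [pl, pl]
  simp

/-- When `b` is null, so is the unit wire it emits, and C;C° on the unit wires reduces to copying
the one emitted by `a`. The copy sent to the null `b` dies by `il_T`, and the other returns to `a`,
undoing the emission. -/
theorem il_D (a b : Color) : il (K.w a) (K.w b) ≫ K.D a b = il _ _ := by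
  have h : il (K.w .one) (K.w b) ≫ K.lact b = 0 := by
    rw [lact, reassoc_of% (K.il_T .one b), zero_comp]
  have h1 : il (K.w .one) (K.w .one) ≫ K.Cn .one = 𝟙 _ := il_mul (K.w .one) K
  have h2 : il (K.w .one) (K.w .one) ≫ il (K.w .one ⊗ K.w .one) (K.w b) ≫
      (K.Cn .one ≫ K.dag (K.Cn .one)) ▷ K.w b = K.dag (K.Cn .one) ≫ il _ _ := by
    rw [← tensorHom_id, il_tensor]
    simp only [Category.assoc, reassoc_of% h1]
  rw [D_eq, ← Category.assoc, il_tensor, Category.assoc, whiskerLeft_comp, whiskerLeft_comp]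
  simp only [Category.assoc]
  rw [reassoc_of% (K.il_middle (K.w a) (K.w b) (K.w .one) (K.w .one)), ← whiskerLeft_comp_assoc,
    Category.assoc, h2, whiskerLeft_comp, Category.assoc,
    reassoc_of% (il_middle' (K.w a) (K.w b) (K.w .one) (K.w .one)), ← id_tensorHom (K.w a ⊗ _),
    tensorHom_comp_tensorHom, h, Category.id_comp, tensor_zero, reassoc_of% assoc_pl,
    ← whiskerLeft_comp_assoc, dag_Cn_pl, whiskerLeft_id, Category.id_comp,
    reassoc_of% (K.dag_act_act a)]

theorem D_eq_tensorμ (a b : Color) : K.D a b = (K.dag (K.act a) ⊗ₘ K.dag (K.act b)) ≫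
    tensorμ _ _ _ _ ≫ (K.w a ⊗ K.w b) ◁ (K.Cn .one ≫ K.dag (K.Cn .one)) ≫ tensorμ _ _ _ _ ≫
      (K.act a ⊗ₘ K.act b) := by
  have h1 : (K.dag (K.act a) ⊗ₘ K.dag (K.lact b)) =
      (K.dag (K.act a) ⊗ₘ K.dag (K.act b)) ≫ (K.w a ⊗ K.w .one) ◁ (β_ _ _).hom := by
    rw [← braid_act, dag_comp, dag_braid, ← id_tensorHom (K.w a ⊗ _), tensorHom_comp_tensorHom,
      Category.comp_id]
  have h2 : (K.act a ⊗ₘ K.lact b) =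
      (K.w a ⊗ K.w .one) ◁ (β_ _ _).hom ≫ (K.act a ⊗ₘ K.act b) := by
    rw [← braid_act, ← id_tensorHom (K.w a ⊗ _), tensorHom_comp_tensorHom, Category.id_comp]
  rw [D_eq, h1, h2, Category.assoc, reassoc_of% middle_eq_tensorμ]

/-- In the symmetric form the braiding permutes the two columns of `tensorμ`, and the remaining swap
of unit wires is absorbed on either side by the commutativity of C. -/
theorem braid_D (a b : Color) : (β_ _ _).hom ≫ K.D b a = K.D a b ≫ (β_ _ _).hom := by
  have h1 : (β_ _ _).hom ≫ K.Cn .one ≫ K.dag (K.Cn .one) = K.Cn .one ≫ K.dag (K.Cn .one) := by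
    rw [reassoc_of% (K.swap_contr .one)]
  have h2 : (K.Cn .one ≫ K.dag (K.Cn .one)) ≫ (β_ _ _).hom = K.Cn .one ≫ K.dag (K.Cn .one) := by
    simpa using congrArg K.dag h1
  have h3 : ((β_ (K.w a) (K.w b)).hom ⊗ₘ (β_ _ _).hom) ≫
      (K.w b ⊗ K.w a) ◁ (K.Cn .one ≫ K.dag (K.Cn .one)) =
      (K.w a ⊗ K.w b) ◁ (K.Cn .one ≫ K.dag (K.Cn .one)) ≫
        ((β_ (K.w a) (K.w b)).hom ⊗ₘ (β_ _ _).hom) := by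
    rw [← id_tensorHom, ← id_tensorHom, tensorHom_comp_tensorHom, tensorHom_comp_tensorHom, h1, h2]
    simp
  rw [D_eq_tensorμ, D_eq_tensorμ, ← BraidedCategory.braiding_naturality_assoc,
    reassoc_of% tensorμ_braid, reassoc_of% h3]
  simp only [Category.assoc]
  rw [BraidedCategory.braiding_naturality]
  have h4 := congrArg K.dag (tensorμ_braid (K.w b) (K.w .one) (K.w a) (K.w .one))
  simp only [dag_comp, dag_tensorμ, dag_braid, dag_tensor] at h4
  rw [← reassoc_of% h4]

theorem ir_D (a b : Color) : ir (K.w a) (K.w b) ≫ K.D a b = ir _ _ := by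
  rw [← cancel_mono (β_ _ _).hom, Category.assoc, ← braid_D, reassoc_of% (ir_braid (K.w a)), il_D,
    ir_braid]

theorem D_pl (a b : Color) : K.D a b ≫ pl _ _ = pl _ _ := by
  simpa [dag_il, dag_D] using congrArg K.dag (K.il_D a b)

theorem D_pr (a b : Color) : K.D a b ≫ pr _ _ = pr _ _ := by
  simpa [dag_ir, dag_D] using congrArg K.dag (K.ir_D a b)

/-- The left injection of `⊕`. -/
def inl (a b : Color) : K.w a ⟶ K.w (.plus a b) := il _ _ ≫ K.P a b

/-- The right injection of `⊕`. -/
def inr (a b : Color) : K.w b ⟶ K.w (.plus a b) := ir _ _ ≫ K.P a b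

/-- The left projection of `⊕`. -/
def fst (a b : Color) : K.w (.plus a b) ⟶ K.w a := K.dag (K.P a b) ≫ pl _ _

/-- The right projection of `⊕`. -/
def snd (a b : Color) : K.w (.plus a b) ⟶ K.w b := K.dag (K.P a b) ≫ pr _ _

theorem dag_inl (a b : Color) : K.dag (K.inl a b) = K.fst a b := by simp [inl, fst, dag_il]
theorem dag_inr (a b : Color) : K.dag (K.inr a b) = K.snd a b := by simp [inr, snd, dag_ir]
theorem dag_fst (a b : Color) : K.dag (K.fst a b) = K.inl a b := by simp [inl, fst, dag_pl]
theorem dag_snd (a b : Color) : K.dag (K.snd a b) = K.inr a b := by simp [inr, snd, dag_pr]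

theorem inl_dag_P (a b : Color) : K.inl a b ≫ K.dag (K.P a b) = il _ _ := by
  rw [inl, Category.assoc]; exact K.il_D a b

theorem inr_dag_P (a b : Color) : K.inr a b ≫ K.dag (K.P a b) = ir _ _ := by
  rw [inr, Category.assoc]; exact K.ir_D a b

theorem P_fst (a b : Color) : K.P a b ≫ K.fst a b = pl _ _ := by
  rw [fst, ← Category.assoc]; exact K.D_pl a b

theorem P_snd (a b : Color) : K.P a b ≫ K.snd a b = pr _ _ := by
  rw [snd, ← Category.assoc]; exact K.D_pr a b

theorem inl_fst (a b : Color) : K.inl a b ≫ K.fst a b = 𝟙 _ := by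
  rw [inl, Category.assoc, P_fst, K.il_pl]

theorem inl_snd (a b : Color) : K.inl a b ≫ K.snd a b = 0 := by
  rw [inl, Category.assoc, P_snd, K.il_pr]

theorem inr_fst (a b : Color) : K.inr a b ≫ K.fst a b = 0 := by
  rw [inr, Category.assoc, P_fst, K.ir_pl]

theorem inr_snd (a b : Color) : K.inr a b ≫ K.snd a b = 𝟙 _ := by
  rw [inr, Category.assoc, P_snd, K.ir_pr]

theorem P_eq (a b : Color) : K.P a b = (K.dag (K.act a) ⊗ₘ K.dag (K.act b)) ≫
    tensorμ _ _ _ _ ≫ (K.P a b ⊗ₘ K.Cn .one) ≫ K.act _ := by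
  conv_lhs => rw [K.plus_contr a b (Adapt.symm (.tensorOne a)).approx
    (Adapt.symm (.tensorOne b)).approx (Adapt.tensorOne _).approx]
  simp only [act, dag_comp, dag_M, tensorHom_comp_tensorHom_assoc]

/-- This is where `plus_contr` enters. With the right input null, the contraction of the two emitted
unit wires has a null argument and becomes the identity, which leaves exactly the emission and
absorption on the left input. -/
theorem unital_inl (a b : Color) : K.Unital (K.inl a b) := by
  rw [Unital]
  conv_rhs => rw [inl, P_eq]
  rw [← Category.assoc (il _ _), il_tensor, Category.assoc, reassoc_of% (K.il_tensorμ),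
    tensorHom_comp_tensorHom_assoc, ← mul_def K .one, il_mul _ K, tensorHom_id]
  rfl

theorem unital_inr (a b : Color) : K.Unital (K.inr a b) := by
  rw [Unital]
  conv_rhs => rw [inr, P_eq]
  rw [← Category.assoc (ir _ _), ir_tensor, Category.assoc, reassoc_of% (K.ir_tensorμ),
    tensorHom_comp_tensorHom_assoc, ← mul_def K .one, ir_mul _ K, tensorHom_id]
  rfl

theorem unital_fst (a b : Color) : K.Unital (K.fst a b) := by
  rw [← dag_inl]; exact (K.unital_inl a b).dag

theorem unital_snd (a b : Color) : K.Unital (K.snd a b) := by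
  rw [← dag_inr]; exact (K.unital_inr a b).dag

theorem unital_id (a : Color) : K.Unital (𝟙 (K.w a)) := by
  rw [Unital, id_whiskerRight, Category.id_comp, dag_act_act]

theorem act_zero {a : Color} (X : C) :  (0 : X ⟶ K.w a) ▷ K.w .one ≫ K.act a = 0 := by
  have h : (0 : X ⟶ K.w a) = (0 : X ⟶ 𝟙_ C) ≫ 0 := by simp
  have := K.ir_T a .one
  rw [ir, Category.assoc, Iso.inv_comp_eq, comp_zero] at this
  rw [h, comp_whiskerRight, act, Category.assoc, reassoc_of% this, zero_comp, comp_zero]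

theorem unital_zero (a b : Color) : K.Unital (0 : K.w a ⟶ K.w b) := by
  rw [Unital, act_zero, comp_zero]

theorem unital_M {a b : Color} (h : Approx a b) : K.Unital (K.M h) := by
  have h1 : Approx (.tensor a .one) (.tensor b .one) := h.map fun k => .tensorLeft k _
  simp only [Unital, act, dag_comp, dag_M, Category.assoc, reassoc_of% (K.M_T_left h h1),
    reassoc_of% (K.tensor_tensor a .one), M_M]

/-- A scalar on `a` next to the scalar 1 on the unit colour passes through T unchanged, and scalars
commute with adapters. -/
theorem unital_s (r : R) (a : Color) : K.Unital (K.s r a) := by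
  have h := K.s_tensor r 1 a .one
  rw [mul_one, s_one, tensorHom_id] at h
  simp only [Unital, act, dag_comp, dag_M, Category.assoc, reassoc_of% h,
    reassoc_of% (K.tensor_tensor a .one), K.s_M, M_inv_assoc]

/-- The functorial action of `⊗` on morphisms between single wires. -/
def tens {a b c d : Color} (f : K.w a ⟶ K.w b) (g : K.w c ⟶ K.w d) :
    K.w (.tensor a c) ⟶ K.w (.tensor b d) := K.dag (K.T a c) ≫ (f ⊗ₘ g) ≫ K.T b d

variable {K}
variable {a b c d : Color}

/-- By `dag_act_T` the unit wire emitted by a tensor is the one emitted by its right factor; that is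
why only g has to be unital. -/
theorem Unital.tens {f : K.w a ⟶ K.w b} {g : K.w c ⟶ K.w d} (hg : K.Unital g) :
    K.Unital (K.tens f g) := by
  have h1 := K.dag_act_T a c
  have h2 : K.T b d ▷ K.w .one ≫ K.act _ = (α_ _ _ _).hom ≫ K.w b ◁ K.act d ≫ K.T b d := by
    have := congrArg K.dag (K.dag_act_T b d)
    simp only [dag_comp, dag_dag, dag_whiskerLeft, dag_whiskerRight, dag_assoc,
      Category.assoc] at this
    rw [← this, Iso.hom_inv_id_assoc]
  rw [Unital, Calculus.tens, comp_whiskerRight, comp_whiskerRight, Category.assoc, Category.assoc,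
    h2, MonoidalCategory.tensorHom_def]
  simp only [comp_whiskerRight, Category.assoc]
  rw [associator_naturality_middle_assoc, associator_naturality_left_assoc, reassoc_of% h1,
    ← whiskerLeft_comp_assoc (K.w b), whisker_exchange_assoc, ← whiskerLeft_comp_assoc, hg]

end Calculus

/-! ### Convolution sums and morphisms compatible with contraction -/

namespace Calculus

variable {R : Type u} [CommSemiring R] {C : Type v} [Category.{w} C] [MonoidalCategory C]
  [SymmetricCategory C] [HasZeroMorphisms C] (K : Calculus R C)

theorem mul_tensor (K : Calculus R C) (a b : Color) : μ[K.w a ⊗ K.w b] = tensorμ _ _ _ _ ≫ (K.Cn a ⊗ₘ K.Cn b) :=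
  rfl

/-- Discarding one of the two outputs in `contr_contrInv` turns each copy into the identity, and
what remains is a contraction preceded by D. -/
theorem D_Cn (a : Color) : K.D a a ≫ K.Cn a = K.Cn a := by
  have h := congrArg (· ≫ pl _ _) (K.contr_contrInv a)
  simp only [Category.assoc, dag_Cn_pl, Category.comp_id, tensor_pl,
    reassoc_of% (K.tensorμ_pl), tensorHom_comp_tensorHom_assoc] at h
  rw [id_tensorHom_id, Category.id_comp] at h
  rw [D, Category.assoc, ← h]

theorem dag_Cn_D (a : Color) : K.dag (K.Cn a) ≫ K.D a a = K.dag (K.Cn a) := by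
  simpa [dag_D] using congrArg K.dag (K.D_Cn a)

theorem mono_dag_P {X : C} {a b : Color} {f g : X ⟶ K.w (.plus a b)}
    (h : f ≫ K.dag (K.P a b) = g ≫ K.dag (K.P a b)) : f = g := by
  have := congrArg (· ≫ K.P a b) h
  simpa only [Category.assoc, plus_plus, Category.comp_id] using this

theorem mono_dag_T {X : C} {a b : Color} {f g : X ⟶ K.w (.tensor a b)}
    (h : f ≫ K.dag (K.T a b) = g ≫ K.dag (K.T a b)) : f = g := by
  have := congrArg (· ≫ K.T a b) h
  simpa only [Category.assoc, tensor_tensor, Category.comp_id] using this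

theorem Cn_dag_T (a b : Color) : K.Cn (.tensor a b) ≫ K.dag (K.T a b) =
    (K.dag (K.T a b) ⊗ₘ K.dag (K.T a b)) ≫ μ[K.w a ⊗ K.w b] := K.contr_tensorInv a b

theorem Cn_dag_P (a b : Color) : K.Cn (.plus a b) ≫ K.dag (K.P a b) =
    K.D _ _ ≫ (K.dag (K.P a b) ⊗ₘ K.dag (K.P a b)) ≫ μ[K.w a ⊗ K.w b] := K.contr_plusInv a b

/-- Two parallel values are the product of each of them taken alone, the other being null. This lets
maps into X ⊗ Y be split as sums over the two wires. -/
theorem il_ir_mul (K : Calculus R C) (X Y : C) [MonObj X] [MonObj Y] :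
    (il X Y ⊗ₘ ir X Y) ≫ μ[X ⊗ Y] = 𝟙 (X ⊗ Y) := by
  have h : (il X Y ⊗ₘ ir X Y) ≫ tensorμ X Y X Y = (il X X ⊗ₘ ir Y Y) := by
    rw [il, ir, il, ir, ← tensorHom_comp_tensorHom, ← id_tensorHom, ← tensorHom_id, Category.assoc,
      tensorμ_natural, ← id_tensorHom, ← tensorHom_id, ← tensorHom_comp_tensorHom]
    rw [tensorμ, braiding_tensorUnit_left]
    monoidal
  rw [MonObj.tensorObj.mul_def, reassoc_of% h, tensorHom_comp_tensorHom, il_mul _ K, ir_mul _ K,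
    id_tensorHom_id]

theorem dag_Cn_assoc (v : Color) : K.dag (K.Cn v) ≫ K.dag (K.Cn v) ▷ K.w v =
    K.dag (K.Cn v) ≫ K.w v ◁ K.dag (K.Cn v) ≫ (α_ _ _ _).inv := by
  simpa using congrArg K.dag (K.contr_assoc v)

theorem dag_Cn_braid (v : Color) : K.dag (K.Cn v) ≫ (β_ _ _).hom = K.dag (K.Cn v) := by
  simpa using congrArg K.dag (K.swap_contr v)

/-- The sum of two morphisms from a wire to a monoid. -/
instance (v : Color) (X : C) [MonObj X] : Add (K.w v ⟶ X) :=
  ⟨fun f g => K.dag (K.Cn v) ≫ (f ⊗ₘ g) ≫ μ[X]⟩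

theorem add_def {v : Color} {X : C} [MonObj X] (f g : K.w v ⟶ X) :
    f + g = K.dag (K.Cn v) ≫ (f ⊗ₘ g) ≫ μ[X] := rfl

/-- The convolution monoid of a cocommutative comonoid and a commutative monoid, with neutral
element the zero morphism. The target may be any tensor of wires, whereas the source must be a
single wire. -/
instance (v : Color) (X : C) [MonObj X] [IsCommMonObj X] : AddCommMonoid (K.w v ⟶ X) where
  zero := 0
  nsmul := nsmulRec
  add_assoc f g h := by
    have h1 : (K.dag (K.Cn v) ≫ (f ⊗ₘ g) ≫ μ[X] ⊗ₘ h) =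
        K.dag (K.Cn v) ▷ _ ≫ ((f ⊗ₘ g) ⊗ₘ h) ≫ μ[X] ▷ X := by
      simp only [← tensorHom_id, tensorHom_comp_tensorHom, Category.id_comp, Category.comp_id]
    have h2 : (f ⊗ₘ K.dag (K.Cn v) ≫ (g ⊗ₘ h) ≫ μ[X]) =
        _ ◁ K.dag (K.Cn v) ≫ (f ⊗ₘ (g ⊗ₘ h)) ≫ X ◁ μ[X] := by
      simp only [← id_tensorHom, tensorHom_comp_tensorHom, Category.id_comp, Category.comp_id]
    rw [add_def, add_def, add_def, add_def, h1, h2]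
    simp only [Category.assoc]
    rw [reassoc_of% (K.dag_Cn_assoc v), MonObj.mul_assoc, associator_naturality_assoc,
      Iso.inv_hom_id_assoc]
  zero_add f := by
    rw [add_def]
    rw [zero_tensor, Category.assoc, Category.assoc, reassoc_of% (K.dag_Cn_pr v), ir_mul _ K,
      Category.comp_id]
  add_zero f := by
    rw [add_def]
    rw [tensor_zero, Category.assoc, Category.assoc, reassoc_of% (K.dag_Cn_pl v), il_mul _ K,
      Category.comp_id]
  add_comm f g := by
    rw [add_def, ← IsCommMonObj.mul_comm X, BraidedCategory.braiding_naturality_assoc,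
      reassoc_of% (K.dag_Cn_braid v), ← add_def]

theorem s_add' (r t : R) (a : Color) : K.s (r + t) a = K.s r a + K.s t a := K.s_add r t a

section

variable {K} {v v' : Color} {X Y : C} [MonObj X] [MonObj Y]

theorem add_comp (f g : K.w v ⟶ X) (h : X ⟶ Y) [IsMonHom h] : (f + g) ≫ h = f ≫ h + g ≫ h := by
  rw [add_def, add_def, Category.assoc, Category.assoc, IsMonHom.mul_hom,
    tensorHom_comp_tensorHom_assoc]

theorem comp_add (h : K.w v ⟶ K.w v') (f g : K.w v' ⟶ X)
    (hh : h ≫ K.dag (K.Cn v') = K.dag (K.Cn v) ≫ (h ⊗ₘ h)) : h ≫ (f + g) = h ≫ f + h ≫ g := by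
  rw [add_def, add_def, reassoc_of% hh, tensorHom_comp_tensorHom_assoc]

theorem dag_add {v v' : Color} (f g : K.w v ⟶ K.w v') : K.dag (f + g) = K.dag f + K.dag g := by
  simp only [add_def, dag_comp, dag_dag, dag_tensor, mul_def, Category.assoc]

end

instance isMonHom_dag_T (a b : Color) : IsMonHom (K.dag (K.T a b)) := K.isMonHom (K.Cn_dag_T a b)

instance isMonHom_M {a b : Color} (h : Approx a b) : IsMonHom (K.M h) :=
  K.isMonHom (K.contr_adapter h).symm

instance isMonHom_s (r : R) (a : Color) : IsMonHom (K.s r a) :=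
  K.isMonHom (K.contr_scalar r a).symm

theorem act_Cn (a : Color) : K.Cn a ▷ K.w .one ≫ K.act a =
    (K.w a ⊗ K.w a) ◁ K.dag (K.Cn .one) ≫ tensorμ _ _ _ _ ≫ (K.act a ⊗ₘ K.act a) ≫ K.Cn a := by
  rw [act, reassoc_of% (K.contr_tensor a .one), ← K.contr_adapter, tensorHom_comp_tensorHom_assoc]

/-- By `act_Cn`, contraction commutes with the action once the unit wire is copied. Inserting f and
g between a copy and a contraction leaves C;C° on the unit wires, which is a D by `D_eq_tensorμ`,
and the final contraction absorbs it. -/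
theorem Unital.add {K : Calculus R C} {a b : Color} {f g : K.w a ⟶ K.w b} (hf : K.Unital f) (hg : K.Unital g) :
    K.Unital (f + g) := by
  have h1 : K.dag (K.act a) ≫ K.dag (K.Cn a) ▷ K.w .one = K.dag (K.Cn a) ≫
      (K.dag (K.act a) ⊗ₘ K.dag (K.act a)) ≫ tensorμ _ _ _ _ ≫ (K.w a ⊗ K.w a) ◁ K.Cn .one := by
    simpa using congrArg K.dag (K.act_Cn a)
  have h2 : (K.w a ⊗ K.w a) ◁ K.Cn .one ≫ (f ⊗ₘ g) ▷ K.w .one =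
      (f ⊗ₘ g) ▷ (K.w .one ⊗ K.w .one) ≫ (K.w b ⊗ K.w b) ◁ K.Cn .one := whisker_exchange _ _
  rw [Unital, add_def, mul_def, comp_whiskerRight, comp_whiskerRight, Category.assoc, Category.assoc,
    reassoc_of% h1, act_Cn, reassoc_of% h2, ← tensorHom_id, ← id_tensorHom_id (K.w .one) (K.w .one)]
  rw [← tensorμ_natural_assoc, tensorHom_id, tensorHom_id, tensorHom_comp_tensorHom_assoc,
    hf.dag_act, hg.dag_act, ← tensorHom_comp_tensorHom_assoc, ← whiskerLeft_comp_assoc,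
    ← reassoc_of% (K.D_eq_tensorμ b b), D_Cn]

/-- Unital morphisms that are compatible with the contractions on both sides. -/
class Nice {a b : Color} (f : K.w a ⟶ K.w b) : Prop where
  unital : K.Unital f
  isMonHom : IsMonHom f
  dag_isMonHom : IsMonHom (K.dag f)

attribute [instance] Nice.isMonHom Nice.dag_isMonHom

section

variable {K} {a b c d : Color}

instance Nice.dag (f : K.w a ⟶ K.w b) [hf : K.Nice f] : K.Nice (K.dag f) :=
  ⟨hf.unital.dag, hf.dag_isMonHom, by rw [dag_dag]; infer_instance⟩

instance Nice.id : K.Nice (𝟙 (K.w a)) :=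
  ⟨K.unital_id a, inferInstance, by rw [dag_id]; infer_instance⟩

instance isMonHom_zero_wire : IsMonHom (0 : K.w a ⟶ K.w b) := by
  apply K.isMonHom
  simp only [comp_zero, zero_tensor, zero_comp]

instance Nice.zero : K.Nice (0 : K.w a ⟶ K.w b) :=
  ⟨K.unital_zero a b, inferInstance, by rw [dag_zero]; infer_instance⟩

instance Nice.M (h : Approx a b) : K.Nice (K.M h) :=
  ⟨K.unital_M h, inferInstance, by rw [dag_M]; infer_instance⟩

instance Nice.s (r : R) : K.Nice (K.s r a) :=
  ⟨K.unital_s r a, inferInstance, by rw [dag_s]; infer_instance⟩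

instance Nice.comp (f : K.w a ⟶ K.w b) (g : K.w b ⟶ K.w c) [hf : K.Nice f] [hg : K.Nice g] :
    K.Nice (f ≫ g) :=
  ⟨hf.unital.comp hg.unital, inferInstance, by rw [dag_comp]; infer_instance⟩

/-- Respecting contraction after mirroring is respecting copies; this is the hypothesis under which
precomposition distributes over sums. -/
theorem dag_colinear (f : K.w a ⟶ K.w b) [IsMonHom (K.dag f)] :
    f ≫ K.dag (K.Cn b) = K.dag (K.Cn a) ≫ (f ⊗ₘ f) := by
  simpa [mul_def] using congrArg K.dag (IsMonHom.mul_hom (K.dag f))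

/-- P° respects contraction only up to a D on the two ⊕-wires. Since `inl` is unital, this D slides
back to the source, where `D_Cn` removes it; equality is tested after the split monomorphism P°. -/
instance isMonHom_inl : IsMonHom (K.inl a b) := by
  have := K.isMonHom_il (K.w a) (K.w b)
  have h := IsMonHom.mul_hom (il (K.w a) (K.w b))
  apply K.isMonHom
  apply K.mono_dag_P
  rw [Category.assoc, Category.assoc, mul_def, mul_def, Cn_dag_P,
    reassoc_of% ((K.unital_inl a b).D (K.unital_inl a b)), tensorHom_comp_tensorHom_assoc,
    inl_dag_P, ← h, mul_def, reassoc_of% (K.D_Cn a)]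

instance isMonHom_inr : IsMonHom (K.inr a b) := by
  have := K.isMonHom_ir (K.w a) (K.w b)
  have h := IsMonHom.mul_hom (ir (K.w a) (K.w b))
  apply K.isMonHom
  apply K.mono_dag_P
  rw [Category.assoc, Category.assoc, mul_def, mul_def, Cn_dag_P,
    reassoc_of% ((K.unital_inr a b).D (K.unital_inr a b)), tensorHom_comp_tensorHom_assoc,
    inr_dag_P, ← h, mul_def, reassoc_of% (K.D_Cn b)]

/-- The same D as for `inl`, now slid forward through the two projections into the contraction of
the target. -/
instance isMonHom_fst : IsMonHom (K.fst a b) := by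
  apply K.isMonHom
  rw [mul_def, fst, reassoc_of% (K.Cn_dag_P a b), mul_tensor, Category.assoc, tensor_pl,
    reassoc_of% K.tensorμ_pl, tensorHom_comp_tensorHom_assoc, ← fst,
    ← reassoc_of% ((K.unital_fst a b).D (K.unital_fst a b)), D_Cn, mul_def]

instance isMonHom_snd : IsMonHom (K.snd a b) := by
  apply K.isMonHom
  rw [mul_def, snd, reassoc_of% (K.Cn_dag_P a b), mul_tensor, Category.assoc, tensor_pr,
    reassoc_of% K.tensorμ_pr, tensorHom_comp_tensorHom_assoc, ← snd,
    ← reassoc_of% ((K.unital_snd a b).D (K.unital_snd a b)), D_Cn, mul_def]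

instance Nice.inl : K.Nice (K.inl a b) :=
  ⟨K.unital_inl a b, inferInstance, by rw [dag_inl]; infer_instance⟩

instance Nice.inr : K.Nice (K.inr a b) :=
  ⟨K.unital_inr a b, inferInstance, by rw [dag_inr]; infer_instance⟩

instance Nice.fst : K.Nice (K.fst a b) :=
  ⟨K.unital_fst a b, inferInstance, by rw [dag_fst]; infer_instance⟩

instance Nice.snd : K.Nice (K.snd a b) :=
  ⟨K.unital_snd a b, inferInstance, by rw [dag_snd]; infer_instance⟩

theorem dag_tens (f : K.w a ⟶ K.w b) (g : K.w c ⟶ K.w d) :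
    K.dag (K.tens f g) = K.tens (K.dag f) (K.dag g) := by
  simp [Calculus.tens]

theorem tens_dag_T {f : K.w a ⟶ K.w b} {g : K.w c ⟶ K.w d} (hf : K.Unital f) (hg : K.Unital g) :
    K.tens f g ≫ K.dag (K.T b d) = K.dag (K.T a c) ≫ (f ⊗ₘ g) := by
  rw [Calculus.tens, Category.assoc, Category.assoc, hf.dag_T hg]

theorem isMonHom_tens (f : K.w a ⟶ K.w b) (g : K.w c ⟶ K.w d) [hf : K.Nice f] [hg : K.Nice g] :
    IsMonHom (K.tens f g) := by
  apply K.isMonHom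
  apply K.mono_dag_T
  rw [Category.assoc, Category.assoc, mul_def, mul_def, Cn_dag_T, tens_dag_T hf.unital hg.unital,
    tensorHom_comp_tensorHom_assoc, tens_dag_T hf.unital hg.unital, reassoc_of% (K.Cn_dag_T a c),
    IsMonHom.mul_hom (f ⊗ₘ g), tensorHom_comp_tensorHom_assoc]

instance Nice.tens (f : K.w a ⟶ K.w b) (g : K.w c ⟶ K.w d) [hf : K.Nice f] [hg : K.Nice g] :
    K.Nice (K.tens f g) :=
  ⟨hg.unital.tens, isMonHom_tens f g, by rw [dag_tens]; exact isMonHom_tens _ _⟩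

/-- C and C° satisfy the bialgebra law only up to D. The contraction of the target can emit a D,
which travels back past the unital f + g and matches the one produced by `contr_contrInv`; the rest
is the commutative rearrangement of four factors. -/
theorem isMonHom_add (f g : K.w a ⟶ K.w b) [hf : K.Nice f] [hg : K.Nice g] :
    IsMonHom (f + g) := by
  apply K.isMonHom
  have hD := (hf.unital.add hg.unital).D (hf.unital.add hg.unital)
  rw [mul_def, mul_def, ← K.D_Cn b, reassoc_of% hD, add_def, reassoc_of% (K.contr_contrInv a),
    ← mul_def K a, tensorHom_comp_tensorHom_assoc, IsMonHom.mul_hom f, IsMonHom.mul_hom g,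
    ← tensorHom_comp_tensorHom, ← tensorHom_comp_tensorHom, ← tensorHom_comp_tensorHom,
    ← mul_def K b, Category.assoc, Category.assoc, Category.assoc, ← tensorμ_natural_assoc,
    MonObj.mul_mul_mul_comm]
  simp only [D, tensorHom_comp_tensorHom_assoc, Category.assoc]

instance Nice.add (f g : K.w a ⟶ K.w b) [hf : K.Nice f] [hg : K.Nice g] :
    K.Nice (f + g) :=
  ⟨hf.unital.add hg.unital, isMonHom_add f g, by rw [dag_add]; exact isMonHom_add _ _⟩

end

theorem inl_inr_Cn (a b : Color) : (K.inl a b ⊗ₘ K.inr a b) ≫ K.Cn _ = K.P a b := by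
  apply K.mono_dag_P
  rw [Category.assoc, Cn_dag_P, reassoc_of% ((K.unital_inl a b).D (K.unital_inr a b)),
    tensorHom_comp_tensorHom_assoc, inl_dag_P, inr_dag_P, il_ir_mul K, Category.comp_id]
  rfl

theorem dag_Cn_fst_snd (a b : Color) :
    K.dag (K.Cn _) ≫ (K.fst a b ⊗ₘ K.snd a b) = K.dag (K.P a b) := by
  simpa [dag_inl, dag_inr] using congrArg K.dag (K.inl_inr_Cn a b)

/-- Together with the equations for `inl` and `inr` followed by `fst` and `snd`, this makes ⊕ a
biproduct for convolution sums: the copy followed by both projections is P°, both injections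
followed by contraction is P, and P°;P is the identity. -/
theorem fst_inl_add_snd_inr (a b : Color) : K.fst a b ≫ K.inl a b + K.snd a b ≫ K.inr a b = 𝟙 _ := by
  rw [add_def, ← tensorHom_comp_tensorHom, Category.assoc, mul_def, inl_inr_Cn,
    reassoc_of% (K.dag_Cn_fst_snd a b), plus_plus]

instance isMonHom_Cn (a : Color) : IsMonHom (K.Cn a) := by
  apply K.isMonHom
  rw [mul_tensor, ← mul_def K, Category.assoc, MonObj.mul_mul_mul_comm]

instance isMonHom_P (a b : Color) : IsMonHom (K.P a b) := by
  rw [← inl_inr_Cn]; infer_instance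

end Calculus

namespace Calculus

variable {R : Type u} [CommSemiring R] {C : Type v} [Category.{w} C] [MonoidalCategory C]
  [SymmetricCategory C] [HasZeroMorphisms C] (K : Calculus R C)

/-! ### Additivity of the tensor -/

theorem dag_T_Cn (a b : Color) : K.dag (K.T a b) ≫ K.dag (K.Cn a) ▷ K.w b =
    K.dag (K.Cn _) ≫ (K.dag (K.T a b) ⊗ₘ K.dag (K.T a b)) ≫ tensorμ _ _ _ _ ≫
      (K.w a ⊗ K.w a) ◁ K.Cn b := by
  simpa using congrArg K.dag (K.contr_tensor a b)

section

variable {K} {a b : Color} {X Y : C} [MonObj X] [MonObj Y]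

/-- The axiom `contr_tensor` is distributivity: copying the left factor duplicates the whole tensor
and recombines its right factors with a contraction, which h respects by hypothesis. -/
theorem dag_T_add_left (f g : K.w a ⟶ X) (h : K.w b ⟶ Y) [IsMonHom h] :
    K.dag (K.T a b) ≫ ((f + g) ⊗ₘ h) =
      K.dag (K.T a b) ≫ (f ⊗ₘ h) + K.dag (K.T a b) ≫ (g ⊗ₘ h) := by
  have h1 : ((f + g) ⊗ₘ h) = K.dag (K.Cn a) ▷ K.w b ≫ ((f ⊗ₘ g) ≫ μ[X] ⊗ₘ h) := by
    rw [add_def, ← tensorHom_id, tensorHom_comp_tensorHom, Category.id_comp]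
  rw [h1, reassoc_of% (K.dag_T_Cn a b), ← id_tensorHom, tensorHom_comp_tensorHom, Category.id_comp,
    ← mul_def K b, IsMonHom.mul_hom h, ← tensorHom_comp_tensorHom, ← tensorμ_natural_assoc,
    tensorHom_comp_tensorHom_assoc, add_def, MonObj.tensorObj.mul_def]

end

theorem braid_Tdag_T (a b : Color) : K.T a b ≫ K.dag (K.T a b) ≫ (β_ _ _).hom =
    K.w a ◁ K.dag (K.act b) ≫ (α_ _ _ _).inv ≫ (β_ _ _).hom ▷ K.w .one ≫ (α_ _ _ _).hom ≫
      K.w b ◁ K.act a := by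
  rw [← reassoc_of% (K.T_dag_T_right a b), BraidedCategory.braiding_naturality_left,
    ← braid_act, dag_comp, dag_braid]
  simp only [BraidedCategory.braiding_tensor_left_hom, MonoidalCategory.whiskerLeft_comp,
    Category.assoc, Iso.inv_hom_id_assoc]
  rw [← MonoidalCategory.whiskerLeft_comp_assoc (K.w a) (β_ _ _).hom (β_ _ _).hom,
    SymmetricCategory.symmetry]
  simp

/-- The projector T;T° emits a unit wire from one input and absorbs it in the other, and which of
the two emits is immaterial. This makes T° intertwine `sw` with the braiding. -/
theorem braid_T_dag_T (a b : Color) : (β_ _ _).hom ≫ K.T b a ≫ K.dag (K.T b a) =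
    K.T a b ≫ K.dag (K.T a b) ≫ (β_ _ _).hom := by
  rw [braid_Tdag_T, ← K.T_dag_T_left b a,
    ← BraidedCategory.braiding_naturality_right_assoc, ← K.braid_lact a]
  simp

/-- The symmetry of `⊗` on wires. -/
def sw (a b : Color) : K.w (.tensor a b) ⟶ K.w (.tensor b a) :=
  K.dag (K.T a b) ≫ (β_ _ _).hom ≫ K.T b a

theorem dag_sw (a b : Color) : K.dag (K.sw a b) = K.sw b a := by simp [sw]

theorem sw_dag_T (a b : Color) : K.sw a b ≫ K.dag (K.T b a) = K.dag (K.T a b) ≫ (β_ _ _).hom := by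
  rw [sw, Category.assoc, Category.assoc, braid_T_dag_T, reassoc_of% (K.tensor_tensor a b)]

theorem T_sw (a b : Color) : K.T a b ≫ K.sw a b = (β_ _ _).hom ≫ K.T b a := by
  simpa [dag_sw] using congrArg K.dag (K.sw_dag_T b a)

theorem act_T (a b : Color) : K.T a b ▷ K.w .one ≫ K.act _ =
    (α_ _ _ _).hom ≫ K.w a ◁ K.act b ≫ K.T a b := by
  have := congrArg K.dag (K.dag_act_T a b)
  simp only [dag_comp, dag_dag, dag_whiskerLeft, dag_whiskerRight, dag_assoc,
    Category.assoc] at this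
  rw [← this, Iso.hom_inv_id_assoc]

theorem unital_sw (a b : Color) : K.Unital (K.sw a b) := by
  have h : K.dag (K.act (.tensor a b)) ≫ K.dag (K.T a b) ▷ K.w .one =
      K.dag (K.T a b) ≫ K.w a ◁ K.dag (K.act b) ≫ (α_ _ _ _).inv := by
    rw [← reassoc_of% (K.dag_act_T a b), Iso.hom_inv_id, Category.comp_id]
  simp only [Unital, sw, comp_whiskerRight, Category.assoc, act_T, reassoc_of% h]
  rw [← reassoc_of% (K.braid_Tdag_T a b), reassoc_of% (K.tensor_tensor a b)]

theorem isMonHom_braid (K : Calculus R C) (X Y : C) [MonObj X] [MonObj Y] :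
    IsMonHom (β_ X Y).hom := by
  apply K.isMonHom
  rw [MonObj.tensorObj.mul_def, MonObj.tensorObj.mul_def]
  have := congrArg K.dag (tensorμ_braid Y Y X X)
  simp only [dag_comp, dag_tensorμ, dag_braid, dag_tensor] at this
  rw [← reassoc_of% this, Category.assoc, BraidedCategory.braiding_naturality]

theorem isMonHom_sw (a b : Color) : IsMonHom (K.sw a b) := by
  have := K.isMonHom_braid (K.w a) (K.w b)
  apply K.isMonHom
  apply K.mono_dag_T
  rw [Category.assoc, Category.assoc, mul_def, mul_def, Cn_dag_T, sw_dag_T,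
    tensorHom_comp_tensorHom_assoc, sw_dag_T, reassoc_of% (K.Cn_dag_T a b),
    IsMonHom.mul_hom (β_ _ _).hom, tensorHom_comp_tensorHom_assoc]

instance Nice.sw (a b : Color) : K.Nice (K.sw a b) :=
  ⟨K.unital_sw a b, K.isMonHom_sw a b, by rw [dag_sw]; exact K.isMonHom_sw b a⟩

section

variable {K} {a b c d e z : Color} {X Y : C} [MonObj X] [MonObj Y]

theorem nice_comp_add (h : K.w z ⟶ K.w a) [K.Nice h] (f g : K.w a ⟶ X) :
    h ≫ (f + g) = h ≫ f + h ≫ g := comp_add h f g (dag_colinear h)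

/-- Obtained from the left version by conjugating with the symmetry `sw`, which is nice and
therefore distributes over sums. -/
theorem dag_T_add_right (h : K.w a ⟶ X) (f g : K.w b ⟶ Y) [IsMonHom h] :
    K.dag (K.T a b) ≫ (h ⊗ₘ (f + g)) =
      K.dag (K.T a b) ≫ (h ⊗ₘ f) + K.dag (K.T a b) ≫ (h ⊗ₘ g) := by
  have := K.isMonHom_braid Y X
  have key (k : K.w b ⟶ Y) : K.dag (K.T a b) ≫ (h ⊗ₘ k) =
      K.sw a b ≫ (K.dag (K.T b a) ≫ (k ⊗ₘ h)) ≫ (β_ _ _).hom := by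
    rw [Category.assoc, reassoc_of% (K.sw_dag_T a b), BraidedCategory.braiding_naturality]
    simp
  rw [key, key, key, dag_T_add_left, add_comp, nice_comp_add]

theorem dag_T_zero_left (h : K.w b ⟶ Y) : K.dag (K.T a b) ≫ ((0 : K.w a ⟶ X) ⊗ₘ h) = 0 := by
  rw [zero_tensor, reassoc_of% (K.dag_T_pr a b), zero_comp]

theorem dag_T_zero_right (h : K.w a ⟶ X) : K.dag (K.T a b) ≫ (h ⊗ₘ (0 : K.w b ⟶ Y)) = 0 := by
  rw [tensor_zero, reassoc_of% (K.dag_T_pl a b), zero_comp]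

theorem tens_comp (f : K.w a ⟶ K.w b) (g : K.w c ⟶ K.w d) (f' : K.w b ⟶ K.w e)
    (g' : K.w d ⟶ K.w z) [hf : K.Nice f] [hg : K.Nice g] :
    K.tens (f ≫ f') (g ≫ g') = K.tens f g ≫ K.tens f' g' := by
  rw [tens, ← tensorHom_comp_tensorHom_assoc, ← reassoc_of% (tens_dag_T hf.unital hg.unital)]
  rfl

theorem tens_id : K.tens (𝟙 (K.w a)) (𝟙 (K.w b)) = 𝟙 _ := by
  rw [tens, id_tensorHom_id, Category.id_comp, tensor_tensor]

theorem tens_zero_left (g : K.w c ⟶ K.w d) : K.tens (0 : K.w a ⟶ K.w b) g = 0 := by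
  rw [tens, ← Category.assoc, dag_T_zero_left, zero_comp]

theorem tens_zero_right (g : K.w c ⟶ K.w d) : K.tens g (0 : K.w a ⟶ K.w b) = 0 := by
  rw [tens, ← Category.assoc, dag_T_zero_right, zero_comp]

theorem tens_add_left (f f' : K.w a ⟶ K.w b) (g : K.w c ⟶ K.w d) [hf : K.Nice f] [hf' : K.Nice f']
    [hg : K.Nice g] : K.tens (f + f') g = K.tens f g + K.tens f' g := by
  apply K.mono_dag_T
  rw [add_comp, tens_dag_T (hf.unital.add hf'.unital) hg.unital, tens_dag_T hf.unital hg.unital,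
    tens_dag_T hf'.unital hg.unital, dag_T_add_left]

theorem tens_add_right (f f' : K.w a ⟶ K.w b) (g : K.w c ⟶ K.w d) [hf : K.Nice f]
    [hf' : K.Nice f'] [hg : K.Nice g] : K.tens g (f + f') = K.tens g f + K.tens g f' := by
  apply K.mono_dag_T
  rw [add_comp, tens_dag_T hg.unital (hf.unital.add hf'.unital), tens_dag_T hg.unital hf.unital,
    tens_dag_T hg.unital hf'.unital, dag_T_add_right]

theorem tens_sw (f : K.w a ⟶ K.w b) (g : K.w c ⟶ K.w d) :
    K.tens f g ≫ K.sw b d = K.sw a c ≫ K.tens g f := by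
  rw [tens, tens, reassoc_of% (K.sw_dag_T a c), Category.assoc, Category.assoc, T_sw,
    BraidedCategory.braiding_naturality_assoc]

end

end Calculus

namespace Calculus

variable {R : Type u} [CommSemiring R] {C : Type v} [Category.{w} C] [MonoidalCategory C]
  [SymmetricCategory C] [HasZeroMorphisms C] (K : Calculus R C)

/-! ### Sliding and exclusivity -/

/-- Double plus contraction, seen from the mirror. -/
theorem D_dag_Cn (a b : Color) : K.D a b ≫ K.dag (K.Cn a) ▷ K.w b =
    K.dag (K.Cn a) ▷ K.w b ≫ (α_ _ _ _).hom ≫ K.w a ◁ (β_ _ _).hom ≫ (α_ _ _ _).inv ≫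
      K.D a b ▷ K.w a ≫ (α_ _ _ _).hom ≫ K.w a ◁ ((β_ _ _).hom ≫ K.D a b) ≫ (α_ _ _ _).inv := by
  have := congrArg K.dag (K.contr_plusPlus a b)
  simpa [D] using this

theorem middle_assoc {a b U z : C} (E : U ⊗ (U ⊗ z) ⟶ U ⊗ (U ⊗ z)) :
    (α_ a b U).inv ▷ (U ⊗ z) ≫ (α_ (a ⊗ b) U (U ⊗ z)).hom ≫ (a ⊗ b) ◁ E ≫ (α_ _ _ _).inv ≫
      (α_ a b U).hom ▷ (U ⊗ z) =
    (α_ a (b ⊗ U) (U ⊗ z)).hom ≫ a ◁ ((α_ b U (U ⊗ z)).hom ≫ b ◁ E ≫ (α_ _ _ _).inv) ≫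
      (α_ _ _ _).inv := by
  monoidal

/-- `h` is equivariant for the unit colour acting on the right factor of its target. -/
def RightUnital {a b v : Color} (h : K.w v ⟶ K.w a ⊗ K.w b) : Prop :=
  K.dag (K.act v) ≫ h ▷ K.w .one = h ≫ K.w a ◁ K.dag (K.act b) ≫ (α_ _ _ _).inv

variable {K} {a b v z z' : Color}

/-- The Frobenius argument of `Unital.act`, with the action carried by the right factor of the
target. -/
theorem RightUnital.act {h : K.w v ⟶ K.w a ⊗ K.w b} (hh : K.RightUnital h) :
    h ▷ K.w .one ≫ (α_ _ _ _).hom ≫ K.w a ◁ K.act b = K.act v ≫ h := by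
  have e1 : K.dag (K.act v) ≫ h ▷ K.w .one ≫ (α_ _ _ _).hom ≫ K.w a ◁ K.act b = h := by
    rw [reassoc_of% hh, Iso.inv_hom_id_assoc, ← MonoidalCategory.whiskerLeft_comp, dag_act_act]
    simp
  have e2 : K.act v ≫ h = K.act v ≫ K.dag (K.act v) ≫ h ▷ K.w .one ≫ (α_ _ _ _).hom ≫
      K.w a ◁ K.act b := by rw [e1]
  conv_lhs => rw [← e1]
  rw [e2, ← reassoc_of% (K.act_dag_act v), whisker_exchange_assoc]
  have e3 : (α_ _ _ _).hom ≫ (K.w a ⊗ K.w b) ◁ K.act .one ≫ (α_ _ _ _).hom ≫ K.w a ◁ K.act b =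
      ((α_ _ _ _).hom ≫ K.w a ◁ K.act b) ▷ K.w .one ≫ (α_ _ _ _).hom ≫ K.w a ◁ K.act b := by
    have := congrArg (K.w a ◁ ·) (K.act_assoc b)
    simp only [MonoidalCategory.whiskerLeft_comp] at this
    simp [this]
  rw [← associator_naturality_left_assoc, e3]
  simp only [comp_whiskerRight, Category.assoc]

/-- The unit wire that D takes from `v` is, after h, the one emitted by the right factor. So D
passes through h and becomes a D between that factor and the target of f. -/
theorem RightUnital.D {h : K.w v ⟶ K.w a ⊗ K.w b} (hh : K.RightUnital h) {f : K.w z ⟶ K.w z'}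
    (hf : K.Unital f) :
    K.D v z ≫ (h ⊗ₘ f) = (h ⊗ₘ f) ≫ (α_ _ _ _).hom ≫ K.w a ◁ K.D b z' ≫ (α_ _ _ _).inv := by
  have h2 := whisker_middle h f (K.Cn .one ≫ K.dag (K.Cn .one))
  rw [D_eq, D_eq]
  simp only [Category.assoc]
  rw [tensorHom_comp_tensorHom, ← hh.act, ← hf.lact, ← tensorHom_comp_tensorHom,
    ← reassoc_of% h2, tensorHom_comp_tensorHom_assoc, hh, hf.dag_lact]
  have h3 : (h ≫ K.w a ◁ K.dag (K.act b) ≫ (α_ _ _ _).inv ⊗ₘ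
      f ≫ K.dag (K.lact z')) = (h ⊗ₘ f) ≫ (α_ _ _ _).hom ≫
        K.w a ◁ (K.dag (K.act b) ⊗ₘ K.dag (K.lact z')) ≫ (α_ _ _ _).inv ≫
          (α_ _ _ _).inv ▷ _ := by
    rw [← tensorHom_comp_tensorHom]
    simp only [MonoidalCategory.tensorHom_def]
    monoidal
  have h4 : ((α_ (K.w a) (K.w b) (K.w .one)).hom ≫ K.w a ◁ K.act b ⊗ₘ K.lact z') =
      (α_ _ _ _).hom ▷ _ ≫ (α_ _ _ _).hom ≫ K.w a ◁ (K.act b ⊗ₘ K.lact z') ≫ (α_ _ _ _).inv := by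
    simp [MonoidalCategory.tensorHom_def]
  rw [h3, h4]
  simp only [Category.assoc]
  rw [reassoc_of% middle_assoc]
  simp

theorem braid_whiskerLeft_tensorμ (a b : C) :
    a ◁ ((α_ b b a).inv ≫ (β_ (b ⊗ b) a).hom) ≫ (α_ _ _ _).inv ≫ tensorμ a a b b =
      (α_ a b (b ⊗ a)).inv ≫ (a ⊗ b) ◁ (β_ b a).hom := by
  simp only [tensorμ, BraidedCategory.braiding_tensor_left_hom, MonoidalCategory.whiskerLeft_comp,
    Category.assoc, Iso.inv_hom_id_assoc]
  have h : a ◁ (β_ b a).hom ▷ b ≫ a ◁ (β_ a b).hom ▷ b = 𝟙 _ := by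
    rw [← MonoidalCategory.whiskerLeft_comp, ← comp_whiskerRight, SymmetricCategory.symmetry]
    simp
  simp [reassoc_of% h]

theorem assoc_pl_pl (K : Calculus R C) (X Y Z : C) :
    (α_ X Y Z).hom ≫ pl X (Y ⊗ Z) = pl (X ⊗ Y) Z ≫ pl X Y := by
  rw [pl, K.to_unit (0 : Y ⊗ Z ⟶ 𝟙_ C) ((0 ⊗ₘ 0) ≫ (λ_ _).hom), pl, pl,
    MonoidalCategory.tensorHom_def']
  generalize (0 : Y ⟶ 𝟙_ C) = y
  generalize (0 : Z ⟶ 𝟙_ C) = z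
  monoidal

theorem whiskerLeft_pl {X Y Y' : C} (f : Y ⟶ Y') : X ◁ f ≫ pl X Y' = pl X Y := by
  rw [← id_tensorHom, tensor_pl, Category.comp_id]

theorem whiskerRight_pl {X X' Y : C} (f : X ⟶ X') : f ▷ Y ≫ pl X' Y = pl X Y ≫ f := by
  rw [← tensorHom_id, tensor_pl]

/-- This is exclusivity. Distributing T over the contraction gives two terms sharing copies of `b`.
The mirror of `contr_plusPlus` passes D through the copying of `b`, so the second term meets a D
directly before T and vanishes by `D_T`; in the surviving term the extra value is merely discarded.
-/
theorem D_swap_Cn_T (K : Calculus R C) (a b : Color) :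
    K.w a ◁ (K.D b a ≫ (β_ _ _).hom) ≫ (α_ _ _ _).inv ≫ K.Cn a ▷ K.w b ≫ K.T a b =
      K.w a ◁ pl _ _ ≫ K.T a b := by
  have h1 : K.w a ◁ (K.D b a ≫ (β_ _ _).hom) ≫ (α_ _ _ _).inv ≫
      (K.w a ⊗ K.w a) ◁ K.dag (K.Cn b) =
      K.w a ◁ (K.D b a ≫ K.dag (K.Cn b) ▷ K.w a ≫ (β_ _ _).hom) ≫ (α_ _ _ _).inv := by
    rw [BraidedCategory.braiding_naturality_left]
    simp
  have h2 : (K.D b a ≫ (β_ _ _).hom) ≫ K.T a b = 0 := by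
    rw [← K.braid_D b a, Category.assoc, D_T, comp_zero]
  have h3 := braid_whiskerLeft_tensorμ (K.w a) (K.w b)
  rw [K.contr_tensor, reassoc_of% h1, reassoc_of% (K.D_dag_Cn b a)]
  simp only [MonoidalCategory.whiskerLeft_comp, Category.assoc] at h3 ⊢
  rw [reassoc_of% h3, associator_inv_naturality_right_assoc,
    ← MonoidalCategory.whiskerLeft_comp_assoc (K.w a ⊗ K.w b), ← id_tensorHom (K.w a ⊗ K.w b),
    tensorHom_comp_tensorHom_assoc, h2, Category.id_comp, tensor_zero, Category.assoc,
    Category.assoc, ← mul_def K (.tensor a b), il_mul _ K,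
    Category.comp_id, reassoc_of% assoc_pl]
  simp only [← MonoidalCategory.whiskerLeft_comp_assoc]
  congr 2
  rw [whiskerLeft_pl, K.assoc_pl_pl, reassoc_of% (whiskerRight_pl (K.D b a)), D_pl, ← K.assoc_pl_pl,
    Iso.inv_hom_id_assoc, whiskerLeft_pl, K.assoc_pl_pl, reassoc_of% (whiskerRight_pl (K.dag (K.Cn b))),
    dag_Cn_pl, Category.comp_id]

theorem il_mul_left (K : Calculus R C) (X Y : C) [MonObj X] [MonObj Y] :
    (X ⊗ Y) ◁ il X Y ≫ μ[X ⊗ Y] = (α_ _ _ _).hom ≫ X ◁ (β_ _ _).hom ≫ (α_ _ _ _).inv ≫ μ[X] ▷ Y := by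
  have h : Y ◁ (0 : 𝟙_ C ⟶ Y) ≫ μ[Y] = (ρ_ Y).hom := by
    rw [K.from_unit (0 : 𝟙_ C ⟶ Y) η[Y], MonObj.mul_one]
  rw [il, ← id_tensorHom X, MonoidalCategory.whiskerLeft_comp, MonObj.tensorObj.mul_def,
    Category.assoc, tensorμ_natural_right_assoc, tensorHom_comp_tensorHom, h, whiskerLeft_id,
    Category.id_comp, tensorμ, MonoidalCategory.tensorHom_def]
  monoidal

/-- A value parallel to the right factor does not contribute to the left factor of a tensor. -/
theorem add_il_T {h : K.w v ⟶ K.w a ⊗ K.w b} (hh : K.RightUnital h) {f : K.w v ⟶ K.w a}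
    (hf : K.Unital f) : (h + f ≫ il _ _) ≫ K.T a b = h ≫ K.T a b := by
  have h1 : (h ⊗ₘ f ≫ il (K.w a) (K.w b)) = (h ⊗ₘ f) ≫ (_ ⊗ _) ◁ il _ _ := by
    rw [← id_tensorHom, tensorHom_comp_tensorHom, Category.comp_id]
  have h2 := K.D_swap_Cn_T a b
  simp only [MonoidalCategory.whiskerLeft_comp, Category.assoc] at h2
  have h3 : (α_ _ _ _).hom ≫ K.w a ◁ pl (K.w b) (K.w a) = pl _ _ := by
    rw [← assoc_pl, Iso.hom_inv_id_assoc]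
  -- Copying `v` creates a D for free (`dag_Cn_D`). Since h is right unital and f is unital, it
  -- lands between the right factor of h and the added value, which is the configuration of
  -- `D_swap_Cn_T`.
  rw [add_def, h1, Category.assoc, Category.assoc, Category.assoc, ← dag_Cn_D, Category.assoc,
    reassoc_of% (il_mul_left K), reassoc_of% (hh.D hf), Iso.inv_hom_id_assoc, mul_def, h2,
    reassoc_of% h3, reassoc_of% tensor_pl, reassoc_of% (K.dag_Cn_pl v)]

theorem ir_whiskerRight (X Y Z : C) :
    ir X Y ▷ Z = ir X (Y ⊗ Z) ≫ (α_ _ _ _).inv := by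
  rw [ir, ir]
  monoidal

theorem rightUnital_dag_T (a b : Color) : K.RightUnital (K.dag (K.T a b)) := by
  rw [RightUnital, ← reassoc_of% (K.dag_act_T a b), Iso.hom_inv_id, Category.comp_id]

theorem RightUnital.comp {h : K.w v ⟶ K.w a ⊗ K.w b} (hh : K.RightUnital h) {f : K.w z ⟶ K.w v}
    (hf : K.Unital f) : K.RightUnital (f ≫ h) := by
  rw [RightUnital, comp_whiskerRight, reassoc_of% hf.dag_act, hh, Category.assoc]

theorem rightUnital_ir (K : Calculus R C) (a b : Color) : K.RightUnital (ir (K.w a) (K.w b)) := by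
  rw [RightUnital, ir_whiskerRight, ← id_tensorHom, reassoc_of% ir_tensor]

/-- Emitting a unit wire is an adapter followed by T°, and both distribute over convolution sums. -/
theorem RightUnital.add {h k : K.w v ⟶ K.w a ⊗ K.w b} (hh : K.RightUnital h)
    (hk : K.RightUnital k) : K.RightUnital (h + k) := by
  have h1 : IsMonHom (K.dag (K.act b)) := by
    rw [Calculus.act, dag_comp, dag_M]; infer_instance
  have h2 : IsMonHom (α_ (K.w a) (K.w b) (K.w .one)).inv := inferInstance
  have h3 : K.dag (K.act v) = K.M (Adapt.symm (.tensorOne v)).approx ≫ K.dag (K.T v .one) := by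
    rw [Calculus.act, dag_comp, dag_M]
  rw [RightUnital, add_comp]
  rw [RightUnital] at hh hk
  rw [← hh, ← hk, h3]
  simp only [Category.assoc, ← tensorHom_id]
  rw [dag_T_add_left, nice_comp_add]

/-- A value parallel to the left factor does not contribute to the right factor of a tensor. -/
theorem add_ir_T {h : K.w v ⟶ K.w a ⊗ K.w b} (hh : K.RightUnital (h ≫ (β_ _ _).hom))
    {f : K.w v ⟶ K.w b} (hf : K.Unital f) : (h + f ≫ ir _ _) ≫ K.T a b = h ≫ K.T a b := by
  have := K.isMonHom_braid (K.w a) (K.w b)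
  have h1 : K.T a b = (β_ _ _).hom ≫ K.T b a ≫ K.sw b a := by simp [T_sw]
  have h2 := add_il_T hh hf
  rw [← ir_braid, ← Category.assoc f, ← add_comp] at h2
  simp only [Category.assoc] at h2
  rw [h1, reassoc_of% h2]

end Calculus

namespace Calculus

variable {R : Type u} [CommSemiring R] {C : Type v} [Category.{w} C] [MonoidalCategory C]
  [SymmetricCategory C] [HasZeroMorphisms C] (K : Calculus R C)

theorem ir_mul_right (K : Calculus R C) (X Y : C) [MonObj X] [MonObj Y] :
    (X ⊗ Y) ◁ ir X Y ≫ μ[X ⊗ Y] = (α_ _ _ _).hom ≫ X ◁ μ[Y] := by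
  have h : X ◁ (0 : 𝟙_ C ⟶ X) ≫ μ[X] = (ρ_ X).hom := by
    rw [K.from_unit (0 : 𝟙_ C ⟶ X) η[X], MonObj.mul_one]
  rw [ir, ← tensorHom_id _ Y, MonoidalCategory.whiskerLeft_comp, MonObj.tensorObj.mul_def,
    Category.assoc, tensorμ_natural_right_assoc, tensorHom_comp_tensorHom, h, whiskerLeft_id,
    Category.id_comp, tensorμ, braiding_tensorUnit_right, MonoidalCategory.tensorHom_def]
  monoidal

theorem sw_sw (a b : Color) : K.sw a b ≫ K.sw b a = 𝟙 _ := by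
  conv_lhs => arg 1; rw [sw]
  rw [Category.assoc, Category.assoc, T_sw, SymmetricCategory.symmetry_assoc, tensor_tensor]

/-! ### Absorption of double pluses -/

/-- The product of `f` and `g` absorbs a double plus. -/
def Absorbs {x y : Color} {X : C} [MonObj X] (f : K.w x ⟶ X) (g : K.w y ⟶ X) : Prop :=
  K.D x y ≫ (f ⊗ₘ g) ≫ μ[X] = (f ⊗ₘ g) ≫ μ[X]

section

variable {K} {x y x' y' : Color} {X Y : C} [MonObj X] [MonObj Y]

theorem Absorbs.symm [IsCommMonObj X] {f : K.w x ⟶ X} {g : K.w y ⟶ X} (h : K.Absorbs f g) :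
    K.Absorbs g f := by
  have e : (g ⊗ₘ f) ≫ μ[X] = (β_ _ _).hom ≫ (f ⊗ₘ g) ≫ μ[X] := by
    rw [← BraidedCategory.braiding_naturality_assoc, IsCommMonObj.mul_comm]
  rw [Absorbs, e, ← reassoc_of% (K.braid_D y x), h]

theorem Absorbs.comp {f : K.w x ⟶ X} {g : K.w y ⟶ X} (h : K.Absorbs f g) (k : X ⟶ Y)
    [IsMonHom k] : K.Absorbs (f ≫ k) (g ≫ k) := by
  rw [Absorbs, ← tensorHom_comp_tensorHom_assoc, ← IsMonHom.mul_hom, reassoc_of% h]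

theorem Absorbs.precomp {f : K.w x ⟶ X} {g : K.w y ⟶ X} (h : K.Absorbs f g) {p : K.w x' ⟶ K.w x}
    {q : K.w y' ⟶ K.w y} (hp : K.Unital p) (hq : K.Unital q) : K.Absorbs (p ≫ f) (q ≫ g) := by
  rw [Absorbs, ← tensorHom_comp_tensorHom_assoc, ← reassoc_of% (hp.D hq), h]

theorem add_tensor (f g : K.w x ⟶ X) (h : Y ⟶ X) : ((f + g) ⊗ₘ h) ≫ μ[X] =
    K.dag (K.Cn x) ▷ Y ≫ (α_ _ _ _).hom ≫ (f ⊗ₘ (g ⊗ₘ h) ≫ μ[X]) ≫ μ[X] := by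
  have e1 : ((f + g) ⊗ₘ h) = K.dag (K.Cn x) ▷ Y ≫ ((f ⊗ₘ g) ⊗ₘ h) ≫ μ[X] ▷ X := by
    rw [add_def, ← tensorHom_id, ← tensorHom_id, tensorHom_comp_tensorHom, tensorHom_comp_tensorHom,
      Category.id_comp, Category.comp_id]
  have e2 : (f ⊗ₘ (g ⊗ₘ h) ≫ μ[X]) = (f ⊗ₘ (g ⊗ₘ h)) ≫ X ◁ μ[X] := by
    rw [← id_tensorHom, tensorHom_comp_tensorHom, Category.comp_id]
  rw [e1, e2, Category.assoc, Category.assoc, Category.assoc, MonObj.mul_assoc,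
    associator_naturality_assoc]

theorem mul_mul_tensor {A B Z : C} (f : A ⟶ X) (g : B ⟶ X) (h : Z ⟶ X) :
    ((f ⊗ₘ g) ≫ μ[X] ⊗ₘ h) ≫ μ[X] = (α_ _ _ _).hom ≫ (f ⊗ₘ (g ⊗ₘ h) ≫ μ[X]) ≫ μ[X] := by
  have e1 : ((f ⊗ₘ g) ≫ μ[X] ⊗ₘ h) = ((f ⊗ₘ g) ⊗ₘ h) ≫ μ[X] ▷ X := by
    rw [← tensorHom_id, tensorHom_comp_tensorHom, Category.comp_id]
  have e2 : (f ⊗ₘ (g ⊗ₘ h) ≫ μ[X]) = (f ⊗ₘ (g ⊗ₘ h)) ≫ X ◁ μ[X] := by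
    rw [← id_tensorHom, tensorHom_comp_tensorHom, Category.comp_id]
  rw [e1, e2, Category.assoc, Category.assoc, MonObj.mul_assoc, associator_naturality_assoc]

/-- The mirror of `contr_plusPlus` replaces a D before a copy by two copies of D, one for each
branch; f and g absorb them in turn. -/
theorem Absorbs.add [IsCommMonObj X] {f g : K.w y ⟶ X} {t : K.w x ⟶ X} (hf : K.Absorbs f t)
    (hg : K.Absorbs g t) : K.Absorbs (f + g) t := by
  have e1 : K.w y ◁ ((β_ _ _).hom ≫ K.D y x) ≫ (f ⊗ₘ (g ⊗ₘ t) ≫ μ[X]) =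
      (f ⊗ₘ (t ⊗ₘ g) ≫ μ[X]) := by
    rw [← id_tensorHom, tensorHom_comp_tensorHom, Category.id_comp, Category.assoc, hg,
      ← BraidedCategory.braiding_naturality_assoc, IsCommMonObj.mul_comm]
  have e2 : K.w y ◁ (β_ _ _).hom ≫ (f ⊗ₘ (t ⊗ₘ g) ≫ μ[X]) = (f ⊗ₘ (g ⊗ₘ t) ≫ μ[X]) := by
    rw [← id_tensorHom, tensorHom_comp_tensorHom, Category.id_comp,
      ← BraidedCategory.braiding_naturality_assoc, IsCommMonObj.mul_comm]
  have e3 : K.D y x ▷ K.w y ≫ ((f ⊗ₘ t) ≫ μ[X] ⊗ₘ g) = ((f ⊗ₘ t) ≫ μ[X] ⊗ₘ g) := by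
    rw [← tensorHom_id, tensorHom_comp_tensorHom, Category.id_comp, hf]
  rw [Absorbs, add_tensor, reassoc_of% (K.D_dag_Cn y x), Iso.inv_hom_id_assoc, reassoc_of% e1,
    ← mul_mul_tensor f t g, reassoc_of% e3, mul_mul_tensor, Iso.inv_hom_id_assoc, reassoc_of% e2]

/-- T° is right unital, so D moves onto the two right wires, where the product with `ir` is a
contraction and `D_Cn` applies. -/
theorem absorbs_dag_T_ir (a b : Color) : K.Absorbs (K.dag (K.T a b)) (ir _ _) := by
  have h := (K.rightUnital_dag_T a b).D (K.unital_id b)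
  rw [Absorbs, MonoidalCategory.tensorHom_def, Category.assoc, ir_mul_right K, ← tensorHom_id,
    reassoc_of% h, Iso.inv_hom_id_assoc, ← MonoidalCategory.whiskerLeft_comp, mul_def, D_Cn]

theorem absorbs_dag_T_il (a b : Color) : K.Absorbs (K.dag (K.T a b)) (il _ _) := by
  have := K.isMonHom_braid (K.w b) (K.w a)
  have h := ((absorbs_dag_T_ir (K := K) b a).comp (β_ _ _).hom).precomp (K.unital_sw a b)
    (K.unital_id a)
  rwa [ir_braid, Category.id_comp, ← sw_dag_T, reassoc_of% (K.sw_sw a b)] at h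

theorem dag_P_comp {a b : Color} {f : K.w a ⟶ X} {g : K.w b ⟶ Y} :
    K.dag (K.P a b) ≫ (f ⊗ₘ g) = K.fst a b ≫ f ≫ il X Y + K.snd a b ≫ g ≫ ir X Y := by
  rw [add_def, ← tensorHom_comp_tensorHom, ← tensorHom_comp_tensorHom, Category.assoc,
    Category.assoc, il_ir_mul K, reassoc_of% (K.dag_Cn_fst_snd a b), Category.comp_id]

theorem dag_P_eq (a b : Color) : K.dag (K.P a b) = K.fst a b ≫ il _ _ + K.snd a b ≫ ir _ _ := by
  have := dag_P_comp (K := K) (f := 𝟙 (K.w a)) (g := 𝟙 (K.w b))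
  simpa using this

/-- P° is the sum of its parts on the left and on the right wire, so absorption can be checked on
each part. -/
theorem absorbs_dag_T_dag_P (a b : Color) : K.Absorbs (K.dag (K.T a b)) (K.dag (K.P a b)) := by
  rw [dag_P_eq]
  apply Absorbs.symm
  apply Absorbs.add
  · simpa using ((absorbs_dag_T_il a b).precomp (K.unital_id _) (K.unital_fst a b)).symm
  · simpa using ((absorbs_dag_T_ir a b).precomp (K.unital_id _) (K.unital_snd a b)).symm

end

/-! ### Two wires as a single wire -/

/-- The colour that represents two parallel wires. -/
abbrev _root_.TensorPlus.Color.bar (a b : Color) : Color := .plus (.tensor a b) (.plus a b)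

/-- The decoding of a wire into two parallel wires. -/
def dec (a b : Color) : K.w (.bar a b) ⟶ K.w a ⊗ K.w b :=
  K.fst _ _ ≫ K.dag (K.T a b) + K.snd _ _ ≫ K.dag (K.P a b)

/-- The encoding of two parallel wires by a wire. -/
def enc (a b : Color) : K.w a ⊗ K.w b ⟶ K.w (.bar a b) := K.dag (K.dec a b)

theorem dec_eq (a b : Color) :
    K.dec a b = K.dag (K.P _ _) ≫ (K.dag (K.T a b) ⊗ₘ K.dag (K.P a b)) ≫ μ[_] := by
  rw [dec, add_def, ← tensorHom_comp_tensorHom, Category.assoc, reassoc_of% K.dag_Cn_fst_snd]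

/-- Encoding then decoding projects on the ⊗-part and on the ⊕-part and contracts the results, with
a D between the two parts. T° and P° absorb that D, and what remains is the left side of `mix`. So
the two-wire object is a retract of a single wire. -/
theorem enc_dec (a b : Color) : K.enc a b ≫ K.dec a b = 𝟙 _ := by
  have h : K.D _ _ ≫ (K.dag (K.T a b) ⊗ₘ K.dag (K.P a b)) ≫ μ[_] =
      (K.dag (K.T a b) ⊗ₘ K.dag (K.P a b)) ≫ μ[_] := absorbs_dag_T_dag_P a b
  rw [D, Category.assoc] at h
  rw [enc, dec_eq, dag_comp, dag_comp, Category.assoc, Category.assoc, dag_dag, h]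
  simp only [dag_tensor, dag_dag, mul_tensor, dag_comp, dag_tensorμ, Category.assoc,
    tensorHom_comp_tensorHom_assoc]
  exact K.mix a b

theorem nice_comp_dec {z a b : Color} (f : K.w z ⟶ K.w (.bar a b)) [K.Nice f] :
    f ≫ K.dec a b = f ≫ K.fst _ _ ≫ K.dag (K.T a b) + f ≫ K.snd _ _ ≫ K.dag (K.P a b) := by
  rw [dec, nice_comp_add]

theorem inl_dec (a b : Color) : K.inl _ _ ≫ K.dec a b = K.dag (K.T a b) := by
  rw [nice_comp_dec, reassoc_of% K.inl_fst, reassoc_of% K.inl_snd, zero_comp, add_zero]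

theorem inr_dec (a b : Color) : K.inr _ _ ≫ K.dec a b = K.dag (K.P a b) := by
  rw [nice_comp_dec, reassoc_of% K.inr_fst, reassoc_of% K.inr_snd, zero_comp, zero_add]

theorem dec_P (a b : Color) : K.dec a b ≫ K.P a b = K.snd _ _ := by
  rw [dec, add_comp, Category.assoc, Category.assoc, tensor_plus, plus_plus, comp_zero, zero_add,
    Category.comp_id]

theorem dec_eq_add (a b : Color) : K.dec a b =
    (K.fst _ _ ≫ K.dag (K.T a b) + (K.snd _ _ ≫ K.fst a b) ≫ il _ _) +
      (K.snd _ _ ≫ K.snd a b) ≫ ir _ _ := by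
  rw [dec, dag_P_eq, nice_comp_add, add_assoc, Category.assoc, Category.assoc]

theorem rightUnital_add_ir (a b z : Color) (f : K.w z ⟶ K.w (.tensor a b)) (g : K.w z ⟶ K.w b)
    (hf : K.Unital f) (hg : K.Unital g) :
    K.RightUnital (f ≫ K.dag (K.T a b) + g ≫ ir _ _) :=
  ((rightUnital_dag_T a b).comp hf).add ((rightUnital_ir K a b).comp hg)

theorem rightUnital_add_il (a b z : Color) (f : K.w z ⟶ K.w (.tensor a b)) (g : K.w z ⟶ K.w a)
    (hf : K.Unital f) (hg : K.Unital g) :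
    K.RightUnital ((f ≫ K.dag (K.T a b) + g ≫ il _ _) ≫ (β_ _ _).hom) := by
  have := K.isMonHom_braid (K.w a) (K.w b)
  rw [add_comp, Category.assoc, Category.assoc, il_braid, ← sw_dag_T, ← Category.assoc]
  exact K.rightUnital_add_ir _ _ _ _ _ (hf.comp (K.unital_sw a b)) hg

/-- A decoded pair is its ⊗-part plus one stray value on each wire. T ignores these strays, which
are dropped one at a time by `add_ir_T` and `add_il_T`. -/
theorem dec_T (a b : Color) : K.dec a b ≫ K.T a b = K.fst _ _ := by
  have h1 := K.unital_fst (.tensor a b) (.plus a b)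
  have h2 := (K.unital_snd (.tensor a b) (.plus a b)).comp (K.unital_fst a b)
  have h3 := (K.unital_snd (.tensor a b) (.plus a b)).comp (K.unital_snd a b)
  rw [dec_eq_add, add_ir_T (K.rightUnital_add_il _ _ _ _ _ h1 h2) h3,
    add_il_T ((rightUnital_dag_T a b).comp h1) h2, Category.assoc, tensor_tensor, Category.comp_id]

end Calculus

namespace Calculus

variable {R : Type u} [CommSemiring R] {C : Type v} [Category.{w} C] [MonoidalCategory C]
  [SymmetricCategory C] [HasZeroMorphisms C] (K : Calculus R C)

/-! ### Morphisms that are additive on exclusive pairs -/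

theorem D_dag_Cn_right (x y : Color) : K.D x y ≫ K.w x ◁ K.dag (K.Cn y) =
    (β_ _ _).hom ≫ K.dag (K.Cn y) ▷ K.w x ≫ (α_ _ _ _).hom ≫ K.w y ◁ (β_ _ _).hom ≫ (α_ _ _ _).inv ≫
      K.D y x ▷ K.w y ≫ (α_ _ _ _).hom ≫ K.w y ◁ ((β_ _ _).hom ≫ K.D y x) ≫ (α_ _ _ _).inv ≫
        (β_ _ _).hom := by
  have h : K.w x ◁ K.dag (K.Cn y) = (β_ _ _).hom ≫ K.dag (K.Cn y) ▷ K.w x ≫ (β_ _ _).hom := by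
    rw [BraidedCategory.braiding_naturality_left, SymmetricCategory.symmetry_assoc]
  rw [h, ← reassoc_of% (K.braid_D x y), reassoc_of% (K.D_dag_Cn y x)]

/-- If two values are exclusive before being copied, their second copies are exclusive too. -/
theorem D_dag_Cn_Cn_D (v : Color) :
    K.D v v ≫ (K.dag (K.Cn v) ⊗ₘ K.dag (K.Cn v)) ≫ tensorμ _ _ _ _ ≫ (K.w v ⊗ K.w v) ◁ K.D v v =
      K.D v v ≫ (K.dag (K.Cn v) ⊗ₘ K.dag (K.Cn v)) ≫ tensorμ _ _ _ _ := by
  have h3 := braid_whiskerLeft_tensorμ (K.w v) (K.w v)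
  have h4 : (K.w v ⊗ K.w v) ◁ (K.D v v ≫ (β_ _ _).hom) ≫ (K.w v ⊗ K.w v) ◁ K.D v v =
      (K.w v ⊗ K.w v) ◁ (K.D v v ≫ (β_ _ _).hom) := by
    rw [← MonoidalCategory.whiskerLeft_comp, Category.assoc, braid_D, reassoc_of% (K.D_D v v)]
  -- The prefix g is irrelevant. It suffices that the composite ends with D and a braiding on the
  -- last two wires, because D commutes with the braiding and is idempotent.
  have key : ∃ g, K.D v v ≫ (K.dag (K.Cn v) ⊗ₘ K.dag (K.Cn v)) ≫ tensorμ _ _ _ _ =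
      g ≫ (K.w v ⊗ K.w v) ◁ (K.D v v ≫ (β_ _ _).hom) := by
    rw [MonoidalCategory.tensorHom_def, Category.assoc, reassoc_of% (K.D_dag_Cn v v),
      ← associator_inv_naturality_right_assoc, ← MonoidalCategory.whiskerLeft_comp_assoc (K.w v),
      Category.assoc, D_dag_Cn_right]
    simp only [MonoidalCategory.whiskerLeft_comp, Category.assoc] at h3 ⊢
    rw [h3, associator_inv_naturality_right_assoc]
    simp only [← Category.assoc]
    exact ⟨_, rfl⟩
  obtain ⟨g, hg⟩ := key
  have e := congrArg (· ≫ (K.w v ⊗ K.w v) ◁ K.D v v) hg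
  simp only [Category.assoc] at e
  rw [e, h4, hg]

/-- `g` preserves the contraction of exclusive pairs. -/
def AlmostHom {v : Color} {X : C} [MonObj X] (g : K.w v ⟶ X) : Prop :=
  K.Cn v ≫ g = K.D v v ≫ (g ⊗ₘ g) ≫ μ[X]

theorem almostHom_dag_P (a b : Color) : K.AlmostHom (K.dag (K.P a b)) := K.Cn_dag_P a b

section

variable {K} {a b c d x y z v : Color} {X Y : C} [MonObj X] [MonObj Y]

theorem AlmostHom.precomp {g : K.w v ⟶ X} (hg : K.AlmostHom g) (f : K.w z ⟶ K.w v) [hf : K.Nice f] :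
    K.AlmostHom (f ≫ g) := by
  rw [AlmostHom, ← mul_def, IsMonHom.mul_hom_assoc, mul_def, hg,
    reassoc_of% (hf.unital.D hf.unital), tensorHom_comp_tensorHom_assoc]

/-- `dec` is the sum of a homomorphism and an almost homomorphism. Expanding copy after contraction
on the encoding wire produces a D in front; by `D_dag_Cn_Cn_D` it already supplies the D that the
second summand asks for. -/
theorem almostHom_dec (a b : Color) : K.AlmostHom (K.dec a b) := by
  have h1 : K.Cn _ ≫ K.fst (.tensor a b) (.plus a b) ≫ K.dag (K.T a b) =
      (K.fst _ _ ≫ K.dag (K.T a b) ⊗ₘ K.fst _ _ ≫ K.dag (K.T a b)) ≫ μ[_] := by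
    rw [← mul_def, IsMonHom.mul_hom (K.fst _ _ ≫ K.dag (K.T a b))]
  have h2 : K.Cn _ ≫ K.snd (.tensor a b) (.plus a b) ≫ K.dag (K.P a b) = _ :=
    (K.almostHom_dag_P a b).precomp (K.snd _ _)
  have h3 : ((K.Cn _ ≫ K.fst (.tensor a b) (.plus a b) ≫ K.dag (K.T a b)) ⊗ₘ
      (K.Cn _ ≫ K.snd (.tensor a b) (.plus a b) ≫ K.dag (K.P a b))) =
      (_ ⊗ _) ◁ K.D _ _ ≫
      ((K.fst _ _ ≫ K.dag (K.T a b) ⊗ₘ K.fst _ _ ≫ K.dag (K.T a b)) ⊗ₘ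
        (K.snd _ _ ≫ K.dag (K.P a b) ⊗ₘ K.snd _ _ ≫ K.dag (K.P a b))) ≫ (μ[_] ⊗ₘ μ[_]) := by
    rw [h1, h2, ← id_tensorHom, tensorHom_comp_tensorHom, tensorHom_comp_tensorHom,
      Category.id_comp]
  have h4 := K.contr_contrInv (.bar a b)
  rw [← D] at h4
  rw [AlmostHom]
  conv_lhs => rw [dec, add_def, reassoc_of% h4, tensorHom_comp_tensorHom_assoc, h3]
  simp only [Category.assoc]
  rw [reassoc_of% (K.D_dag_Cn_Cn_D (.bar a b)), ← tensorμ_natural_assoc,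
    MonObj.mul_mul_mul_comm, tensorHom_comp_tensorHom_assoc, tensorHom_comp_tensorHom_assoc]
  simp only [dec, add_def, Category.assoc]

/-- An almost homomorphism distributes only over exclusive pairs. The pair here is exclusive because
both values come from copies of `z`: the D hidden in the copy is carried by `RightUnital.D` to the
wire on which g acts. -/
theorem RightUnital.add_ir_whiskerLeft {h : K.w z ⟶ K.w c ⊗ K.w v} (hh : K.RightUnital h)
    {f : K.w z ⟶ K.w v} (hf : K.Unital f) {g : K.w v ⟶ X} (hg : K.AlmostHom g) :
    (h + f ≫ ir _ _) ≫ K.w c ◁ g = h ≫ K.w c ◁ g + f ≫ g ≫ ir _ _ := by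
  have e1 : K.dag (K.Cn z) ≫ (h ⊗ₘ f) ≫ (α_ _ _ _).hom ≫ K.w c ◁ K.D v v =
      K.dag (K.Cn z) ≫ (h ⊗ₘ f) ≫ (α_ _ _ _).hom := by
    have := congrArg (K.dag (K.Cn z) ≫ · ≫ (α_ _ _ _).hom) (hh.D hf)
    simp only [Category.assoc, Iso.inv_hom_id, Category.comp_id, reassoc_of% (K.dag_Cn_D z)] at this
    exact this.symm
  have e2 {Z : C} [MonObj Z] (p : K.w z ⟶ K.w c ⊗ Z) (q : K.w z ⟶ Z) : p + q ≫ ir _ _ =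
      K.dag (K.Cn z) ≫ (p ⊗ₘ q) ≫ (α_ _ _ _).hom ≫ K.w c ◁ μ[Z] := by
    rw [← ir_mul_right K, ← id_tensorHom, tensorHom_comp_tensorHom_assoc, Category.comp_id, add_def]
  rw [← Category.assoc f g, e2, e2, Category.assoc, Category.assoc, Category.assoc,
    ← MonoidalCategory.whiskerLeft_comp, mul_def, hg, MonoidalCategory.whiskerLeft_comp,
    reassoc_of% e1, ← tensorHom_comp_tensorHom_assoc]
  congr 2
  simp [MonoidalCategory.tensorHom_def]

theorem RightUnital.add_il_whiskerRight {h : K.w z ⟶ K.w v ⊗ K.w c}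
    (hh : K.RightUnital (h ≫ (β_ _ _).hom)) {f : K.w z ⟶ K.w v} (hf : K.Unital f) {g : K.w v ⟶ X}
    (hg : K.AlmostHom g) :
    (h + f ≫ il _ _) ≫ g ▷ K.w c = h ≫ g ▷ K.w c + f ≫ g ≫ il _ _ := by
  have := K.isMonHom_braid (K.w v) (K.w c)
  have := K.isMonHom_braid (K.w c) X
  have e := congrArg (· ≫ (β_ _ _).hom) (hh.add_ir_whiskerLeft hf hg)
  simp only [add_comp, Category.assoc, ir_braid] at e
  rw [← il_braid, ← Category.assoc f, ← add_comp, Category.assoc,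
    ← BraidedCategory.braiding_naturality_left_assoc, SymmetricCategory.symmetry,
    Category.comp_id] at e
  simpa using e

/-- Nothing is required of g: the added value lies on the other wire, so the sum is a contraction
there and g commutes with it by interchange. -/
theorem add_ir_whiskerRight (h : K.w z ⟶ K.w v ⊗ K.w c) (f : K.w z ⟶ K.w c) (g : K.w v ⟶ X) :
    (h + f ≫ ir _ _) ≫ g ▷ K.w c = h ≫ g ▷ K.w c + f ≫ ir _ _ := by
  have e2 {Z : C} [MonObj Z] (p : K.w z ⟶ Z ⊗ K.w c) (q : K.w z ⟶ K.w c) : p + q ≫ ir _ _ =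
      K.dag (K.Cn z) ≫ (p ⊗ₘ q) ≫ (α_ _ _ _).hom ≫ Z ◁ μ[_] := by
    rw [← ir_mul_right K, ← id_tensorHom, tensorHom_comp_tensorHom_assoc, Category.comp_id, add_def]
  have e3 : (h ≫ g ▷ K.w c ⊗ₘ f) = (h ⊗ₘ f) ≫ g ▷ K.w c ▷ K.w c := by
    rw [← tensorHom_id (g ▷ _), tensorHom_comp_tensorHom, Category.comp_id]
  rw [e2, e2, e3]
  simp only [Category.assoc, whisker_exchange, associator_naturality_left_assoc]

theorem add_il_whiskerLeft (h : K.w z ⟶ K.w c ⊗ K.w v) (f : K.w z ⟶ K.w c) (g : K.w v ⟶ X) :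
    (h + f ≫ il _ _) ≫ K.w c ◁ g = h ≫ K.w c ◁ g + f ≫ il _ _ := by
  have := K.isMonHom_braid (K.w c) (K.w v)
  have := K.isMonHom_braid X (K.w c)
  have e := congrArg (· ≫ (β_ _ _).hom) (add_ir_whiskerRight (h ≫ (β_ _ _).hom) f g)
  simp only [add_comp, Category.assoc, ir_braid] at e
  rw [← il_braid, ← Category.assoc f, ← add_comp, Category.assoc,
    ← BraidedCategory.braiding_naturality_right_assoc, SymmetricCategory.symmetry,
    Category.comp_id] at e
  simpa using e

end

end Calculus

/-! ### Functoriality of ⊕ and of the encoding of pairs -/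

namespace Calculus

variable {R : Type u} [CommSemiring R] {C : Type v} [Category.{w} C] [MonoidalCategory C]
  [SymmetricCategory C] [HasZeroMorphisms C] (K : Calculus R C)

section

variable {K} {a b c d : Color}

/-- The functorial action of `⊕` on morphisms between single wires. -/
def plusMap (f : K.w a ⟶ K.w b) (g : K.w c ⟶ K.w d) : K.w (.plus a c) ⟶ K.w (.plus b d) :=
  K.fst a c ≫ f ≫ K.inl b d + K.snd a c ≫ g ≫ K.inr b d

instance (f : K.w a ⟶ K.w b) (g : K.w c ⟶ K.w d) [K.Nice f] [K.Nice g] : K.Nice (plusMap f g) := by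
  unfold plusMap; infer_instance

theorem plusMap_fst (f : K.w a ⟶ K.w b) (g : K.w c ⟶ K.w d) :
    plusMap f g ≫ K.fst b d = K.fst a c ≫ f := by
  rw [plusMap, add_comp, Category.assoc, Category.assoc, Category.assoc, Category.assoc, inl_fst,
    inr_fst, comp_zero, comp_zero, add_zero, Category.comp_id]

theorem plusMap_snd (f : K.w a ⟶ K.w b) (g : K.w c ⟶ K.w d) :
    plusMap f g ≫ K.snd b d = K.snd a c ≫ g := by
  rw [plusMap, add_comp, Category.assoc, Category.assoc, Category.assoc, Category.assoc, inl_snd,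
    inr_snd, comp_zero, comp_zero, zero_add, Category.comp_id]

theorem plusMap_dag_P (f : K.w a ⟶ K.w b) (g : K.w c ⟶ K.w d) [K.Nice f] [K.Nice g] :
    plusMap f g ≫ K.dag (K.P b d) = K.dag (K.P a c) ≫ (f ⊗ₘ g) := by
  rw [dag_P_comp, dag_P_eq, nice_comp_add, reassoc_of% (plusMap_fst f g),
    reassoc_of% (plusMap_snd f g)]

/-- Two parallel morphisms between single wires, encoded. -/
def barMap (f : K.w a ⟶ K.w b) (g : K.w c ⟶ K.w d) : K.w (.bar a c) ⟶ K.w (.bar b d) :=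
  plusMap (K.tens f g) (plusMap f g)

instance (f : K.w a ⟶ K.w b) (g : K.w c ⟶ K.w d) [K.Nice f] [K.Nice g] : K.Nice (barMap f g) := by
  unfold barMap; infer_instance

/-- Naturality of decoding: parallel composition becomes a morphism between single wires, where it
can be handled through coefficients. -/
theorem barMap_dec (f : K.w a ⟶ K.w b) (g : K.w c ⟶ K.w d) [hf : K.Nice f] [hg : K.Nice g] :
    barMap f g ≫ K.dec b d = K.dec a c ≫ (f ⊗ₘ g) := by
  rw [nice_comp_dec, barMap, reassoc_of% (plusMap_fst (K.tens f g) _),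
    reassoc_of% (plusMap_snd (K.tens f g) _), plusMap_dag_P, tens_dag_T hf.unital hg.unital, dec,
    add_comp, Category.assoc, Category.assoc]

variable (K) in
/-- The symmetry of `⊕`. -/
def plusSwap (a b : Color) : K.w (.plus a b) ⟶ K.w (.plus b a) :=
  K.fst a b ≫ K.inr b a + K.snd a b ≫ K.inl b a

instance : K.Nice (K.plusSwap a b) := by
  unfold plusSwap; infer_instance

theorem plusSwap_fst : K.plusSwap a b ≫ K.fst b a = K.snd a b := by
  rw [plusSwap, add_comp, Category.assoc, Category.assoc, inl_fst,
    inr_fst, comp_zero, zero_add, Category.comp_id]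

theorem plusSwap_snd : K.plusSwap a b ≫ K.snd b a = K.fst a b := by
  rw [plusSwap, add_comp, Category.assoc, Category.assoc, inl_snd,
    inr_snd, comp_zero, add_zero, Category.comp_id]

theorem plusSwap_dag_P : K.plusSwap a b ≫ K.dag (K.P b a) = K.dag (K.P a b) ≫ (β_ _ _).hom := by
  have := K.isMonHom_braid (K.w a) (K.w b)
  rw [dag_P_eq, dag_P_eq, nice_comp_add, reassoc_of% plusSwap_fst, reassoc_of% plusSwap_snd,
    add_comp, Category.assoc, Category.assoc, il_braid, ir_braid, add_comm]

theorem barSwap_dec : plusMap (K.sw a b) (K.plusSwap a b) ≫ K.dec b a =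
    K.dec a b ≫ (β_ _ _).hom := by
  have := K.isMonHom_braid (K.w a) (K.w b)
  rw [nice_comp_dec, reassoc_of% (plusMap_fst (K.sw a b) _), reassoc_of% (plusMap_snd (K.sw a b) _),
    plusSwap_dag_P, sw_dag_T, dec, add_comp, Category.assoc, Category.assoc]

end

/-! ### Associativity of decoding -/

section

variable (X Y Z : C)

theorem il_whiskerRight_assoc : il X Y ▷ Z ≫ (α_ _ _ _).hom = X ◁ ir Y Z := by
  rw [il, ir]
  generalize (0 : 𝟙_ C ⟶ Y) = y
  monoidal

theorem ir_whiskerRight_assoc : ir X Y ▷ Z ≫ (α_ _ _ _).hom = ir X (Y ⊗ Z) := by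
  rw [ir_whiskerRight, Category.assoc, Iso.inv_hom_id, Category.comp_id]

theorem il_assoc : il (X ⊗ Y) Z ≫ (α_ _ _ _).hom = X ◁ il Y Z := by
  rw [il, il]
  generalize (0 : 𝟙_ C ⟶ Z) = y
  monoidal

theorem il_whiskerLeft {X Y Y' : C} (f : Y ⟶ Y') : il X Y ≫ X ◁ f = il X Y' := by
  rw [← id_tensorHom, il_tensor, Category.id_comp]

theorem ir_whiskerLeft {X Y Y' : C} (f : Y ⟶ Y') : ir X Y ≫ X ◁ f = f ≫ ir X Y' := by
  rw [← id_tensorHom, ir_tensor]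

theorem ir_assoc (K : Calculus R C) (X Y Z : C) : ir (X ⊗ Y) Z ≫ (α_ _ _ _).hom = ir Y Z ≫ ir X (Y ⊗ Z) := by
  rw [ir, K.from_unit (0 : 𝟙_ C ⟶ X ⊗ Y) ((λ_ _).inv ≫ (0 ⊗ₘ 0)), ir, ir,
    MonoidalCategory.tensorHom_def']
  generalize (0 : 𝟙_ C ⟶ X) = y
  generalize (0 : 𝟙_ C ⟶ Y) = z
  monoidal

end

theorem dec_expand (a b : Color) : K.dec a b = K.fst _ _ ≫ K.dag (K.T a b) +
    (K.snd _ _ ≫ K.fst a b) ≫ il _ _ + (K.snd _ _ ≫ K.snd a b) ≫ ir _ _ := K.dec_eq_add a b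

section

variable {K} {a b c d : Color} {X : C} [MonObj X]

theorem dag_T_comp_right (f : K.w b ⟶ K.w c) [hf : K.Nice f] (g : K.w c ⟶ X) :
    K.dag (K.T a b) ≫ K.w a ◁ (f ≫ g) =
      K.tens (𝟙 _) f ≫ K.dag (K.T a c) ≫ K.w a ◁ g := by
  rw [reassoc_of% (tens_dag_T (K.unital_id a) hf.unital), id_tensorHom,
    MonoidalCategory.whiskerLeft_comp]

theorem dag_T_comp_left (f : K.w b ⟶ K.w c) [hf : K.Nice f] (g : K.w c ⟶ X) :
    K.dag (K.T b a) ≫ (f ≫ g) ▷ K.w a =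
      K.tens f (𝟙 _) ≫ K.dag (K.T c a) ≫ g ▷ K.w a := by
  rw [reassoc_of% (tens_dag_T hf.unital (K.unital_id a)), tensorHom_id, comp_whiskerRight]

theorem dag_T_dec_right (a b c : Color) : K.dag (K.T a (.bar b c)) ≫ K.w a ◁ K.dec b c =
    K.tens (𝟙 _) (K.fst _ _) ≫ K.dag (K.T _ _) ≫ K.w a ◁ K.dag (K.T b c) +
      K.tens (𝟙 _) (K.snd _ _ ≫ K.fst _ _) ≫ K.dag (K.T _ _) ≫ K.w a ◁ il _ _ +
      K.tens (𝟙 _) (K.snd _ _ ≫ K.snd _ _) ≫ K.dag (K.T _ _) ≫ K.w a ◁ ir _ _ := by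
  rw [← dag_T_comp_right, ← dag_T_comp_right, ← dag_T_comp_right, ← id_tensorHom, ← id_tensorHom,
    ← id_tensorHom, ← id_tensorHom, ← dag_T_add_right, ← dag_T_add_right, dec_expand]

theorem dag_T_dec_left (a b c : Color) : K.dag (K.T (.bar a b) c) ≫ K.dec a b ▷ K.w c =
    K.tens (K.fst _ _) (𝟙 _) ≫ K.dag (K.T _ _) ≫ K.dag (K.T a b) ▷ K.w c +
      K.tens (K.snd _ _ ≫ K.fst _ _) (𝟙 _) ≫ K.dag (K.T _ _) ≫ il _ _ ▷ K.w c +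
      K.tens (K.snd _ _ ≫ K.snd _ _) (𝟙 _) ≫ K.dag (K.T _ _) ≫ ir _ _ ▷ K.w c := by
  rw [← dag_T_comp_left, ← dag_T_comp_left, ← dag_T_comp_left, ← tensorHom_id, ← tensorHom_id,
    ← tensorHom_id, ← tensorHom_id, ← dag_T_add_left, ← dag_T_add_left, dec_expand]

/-- The inner decoding is not a homomorphism, so it cannot simply be distributed over the three
summands of the outer one. The summand on the left wire splits off unconditionally, and the one on
the right wire splits off by exclusivity, `dec` being an almost homomorphism. -/
theorem dec_whiskerLeft_dec (a b c : Color) :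
    K.dec a (.bar b c) ≫ K.w a ◁ K.dec b c =
      K.fst _ _ ≫ K.dag (K.T a (.bar b c)) ≫ K.w a ◁ K.dec b c +
      (K.snd _ _ ≫ K.snd _ _) ≫ K.dec b c ≫ ir _ _ + (K.snd _ _ ≫ K.fst _ _) ≫ il _ _ := by
  have h1 := K.unital_fst (.tensor a (.bar b c)) (.plus a (.bar b c))
  have h2 : K.Unital (K.snd (.tensor a (.bar b c)) (.plus a (.bar b c)) ≫ K.snd _ _) :=
    (K.unital_snd _ _).comp (K.unital_snd _ _)
  rw [K.dec_expand a (.bar b c), add_right_comm, add_il_whiskerLeft,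
    ((rightUnital_dag_T _ _).comp h1).add_ir_whiskerLeft h2 (almostHom_dec b c), Category.assoc]

theorem dec_whiskerRight_dec (a b c : Color) :
    K.dec (.bar a b) c ≫ K.dec a b ▷ K.w c =
      K.fst _ _ ≫ K.dag (K.T (.bar a b) c) ≫ K.dec a b ▷ K.w c +
      (K.snd _ _ ≫ K.fst _ _) ≫ K.dec a b ≫ il _ _ + (K.snd _ _ ≫ K.snd _ _) ≫ ir _ _ := by
  have h1 := K.unital_fst (.tensor (.bar a b) c) (.plus (.bar a b) c)
  have h2 : K.Unital (K.snd (.tensor (.bar a b) c) (.plus (.bar a b) c) ≫ K.fst _ _) :=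
    (K.unital_snd _ _).comp (K.unital_fst _ _)
  have h3 : K.RightUnital ((K.fst (.tensor (.bar a b) c) (.plus (.bar a b) c) ≫
      K.dag (K.T (.bar a b) c)) ≫ (β_ _ _).hom) := by
    rw [Category.assoc, ← sw_dag_T, ← Category.assoc]
    exact (rightUnital_dag_T _ _).comp (h1.comp (K.unital_sw _ _))
  rw [K.dec_expand (.bar a b) c, add_ir_whiskerRight,
    h3.add_il_whiskerRight h2 (almostHom_dec a b), Category.assoc]

/-- The two ways of decoding a wire into three parallel wires agree, up to any reindexing `κ` of
the seven summands. -/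
theorem dec_assoc (a b c : Color) (κ : K.w (.bar (.bar a b) c) ⟶ K.w (.bar a (.bar b c)))
    [K.Nice κ]
    (h1 : κ ≫ K.fst _ _ ≫ K.tens (𝟙 (K.w a)) (K.fst _ (.plus b c)) =
      K.fst _ _ ≫ K.tens (K.fst _ (.plus a b)) (𝟙 (K.w c)) ≫ K.M (Adapt.tensorAssoc a b c).approx)
    (h2 : κ ≫ K.fst _ _ ≫ K.tens (𝟙 (K.w a)) (K.snd (.tensor b c) _ ≫ K.fst b c) =
      K.snd _ _ ≫ K.fst _ _ ≫ K.fst _ (.plus a b))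
    (h3 : κ ≫ K.fst _ _ ≫ K.tens (𝟙 (K.w a)) (K.snd (.tensor b c) _ ≫ K.snd b c) =
      K.fst _ _ ≫ K.tens (K.snd (.tensor a b) _ ≫ K.fst a b) (𝟙 (K.w c)))
    (h4 : κ ≫ K.snd _ _ ≫ K.snd _ _ ≫ K.fst _ (.plus b c) =
      K.fst _ _ ≫ K.tens (K.snd (.tensor a b) _ ≫ K.snd a b) (𝟙 (K.w c)))
    (h5 : κ ≫ K.snd _ _ ≫ K.snd _ _ ≫ K.snd (.tensor b c) _ ≫ K.fst b c =
      K.snd _ _ ≫ K.fst _ c ≫ K.snd (.tensor a b) _ ≫ K.snd a b)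
    (h6 : κ ≫ K.snd _ _ ≫ K.snd _ _ ≫ K.snd (.tensor b c) _ ≫ K.snd b c =
      K.snd _ _ ≫ K.snd _ c)
    (h7 : κ ≫ K.snd _ _ ≫ K.fst a _ =
      K.snd _ _ ≫ K.fst _ c ≫ K.snd (.tensor a b) _ ≫ K.fst a b) :
    K.dec (.bar a b) c ≫ K.dec a b ▷ K.w c ≫ (α_ _ _ _).hom =
      κ ≫ K.dec a (.bar b c) ≫ K.w a ◁ K.dec b c := by
  have := K.isMonHom_il (K.w a ⊗ K.w b) (K.w c)
  have := K.isMonHom_ir (K.w a) (K.w b ⊗ K.w c)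
  rw [← Category.assoc, dec_whiskerRight_dec, dec_whiskerLeft_dec, dag_T_dec_left,
    dag_T_dec_right, dec_expand, dec_expand]
  have e := K.assoc_tensor a b c (Adapt.symm (.tensorAssoc a b c)).approx
  -- Each side becomes a sum of seven terms, one for every nonempty choice of active wires among a,
  -- b, c. The hypotheses identify them pairwise, up to the order of summation.
  simp only [add_comp, nice_comp_add, Category.assoc, il_whiskerRight_assoc, ir_whiskerRight_assoc,
    il_assoc, ir_assoc K, il_whiskerLeft, ir_whiskerLeft, reassoc_of% h1, reassoc_of% h2, reassoc_of% h3, reassoc_of% h4,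
    reassoc_of% h5, reassoc_of% h6, reassoc_of% h7, e, M_inv_assoc]
  abel

end

end Calculus

namespace Calculus

variable {R : Type u} [CommSemiring R] {C : Type v} [Category.{w} C] [MonoidalCategory C]
  [SymmetricCategory C] [HasZeroMorphisms C] (K : Calculus R C)

/-! ### Scalars and adapters on single wires -/

section

variable {K} {a b c d a' b' : Color}

/-- A scalar on a wire can be moved onto a unit wire acting on it. A unital f lets that unit wire
pass from its source to its target, and the scalar goes along. -/
theorem Unital.s_comp {f : K.w a ⟶ K.w b} (hf : K.Unital f) (r : R) :
    K.s r a ≫ f = f ≫ K.s r b := by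
  have h1 (c : Color) : K.s r c ▷ K.w .one ≫ K.act c = K.act c ≫ K.s r c := (K.unital_s r c).act
  have h2 (c : Color) : K.w c ◁ K.s r .one ≫ K.act c = K.act c ≫ K.s r c := by
    have := K.s_tensor 1 r c .one
    rw [s_one, id_tensorHom, one_mul] at this
    rw [Calculus.act, reassoc_of% this, s_M, Category.assoc]
  have h3 := (K.unital_s r a).comp hf
  rw [Unital, comp_whiskerRight, Category.assoc, hf.act, reassoc_of% (h1 a), ← reassoc_of% (h2 a),
    ← hf.act, whisker_exchange_assoc, h2, reassoc_of% hf] at h3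
  exact h3.symm

/-- Placed on the two factors of a ⊗ 𝟙, the scalars act one after the other on the whole tensor,
while `s_tensor` evaluates them jointly to r · t. The adapter to `a` transports the equation. -/
theorem s_s (r t : R) : K.s r a ≫ K.s t a = K.s (r * t) a := by
  have h1 := K.s_tensor r t a .one
  have h2 := K.s_tensor r 1 a .one
  have h3 := K.s_tensor 1 t a .one
  rw [s_one, tensorHom_id, mul_one] at h2
  rw [s_one, id_tensorHom, one_mul] at h3
  rw [MonoidalCategory.tensorHom_def, Category.assoc, h3, reassoc_of% h2] at h1
  have h4 := congrArg (K.dag (K.act a) ≫ · ≫ K.M (Adapt.tensorOne a).approx) h1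
  simp only [Category.assoc, s_M] at h4
  rw [reassoc_of% (K.s_M r)] at h4
  simpa only [act, dag_comp, Category.assoc, reassoc_of% (K.tensor_tensor a .one), dag_M,
    M_inv_assoc] using h4

theorem s_sum {J : Type*} (I : Finset J) (r : J → R) : K.s (∑ i ∈ I, r i) a = ∑ i ∈ I, K.s (r i) a := by
  classical
  induction I using Finset.induction with
  | empty => exact K.s_zero a
  | insert i I hi ih => rw [Finset.sum_insert hi, Finset.sum_insert hi, s_add', ih]

instance Nice.sum {J : Type*} (I : Finset J) (f : J → (K.w a ⟶ K.w b)) [∀ i, K.Nice (f i)] :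
    K.Nice (∑ i ∈ I, f i) := by
  classical
  induction I using Finset.induction with
  | empty => exact Nice.zero
  | insert i I hi ih => rw [Finset.sum_insert hi]; infer_instance

theorem nice_comp_sum {J : Type*} (I : Finset J) (h : K.w c ⟶ K.w a) [K.Nice h]
    (f : J → (K.w a ⟶ K.w b)) : h ≫ ∑ i ∈ I, f i = ∑ i ∈ I, h ≫ f i := by
  classical
  induction I using Finset.induction with
  | empty => exact comp_zero
  | insert i I hi ih => rw [Finset.sum_insert hi, Finset.sum_insert hi, nice_comp_add, ih]

theorem sum_comp_nice {J : Type*} (I : Finset J) (f : J → (K.w a ⟶ K.w b)) (h : K.w b ⟶ K.w c)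
    [K.Nice h] : (∑ i ∈ I, f i) ≫ h = ∑ i ∈ I, f i ≫ h := by
  classical
  induction I using Finset.induction with
  | empty => exact zero_comp
  | insert i I hi ih => rw [Finset.sum_insert hi, Finset.sum_insert hi, add_comp, ih]

theorem tens_sum_left {J : Type*} (I : Finset J) (f : J → (K.w a ⟶ K.w b)) [∀ i, K.Nice (f i)]
    (g : K.w c ⟶ K.w d) [K.Nice g] : K.tens (∑ i ∈ I, f i) g = ∑ i ∈ I, K.tens (f i) g := by
  classical
  induction I using Finset.induction with
  | empty => exact tens_zero_left g
  | insert i I hi ih => rw [Finset.sum_insert hi, Finset.sum_insert hi, tens_add_left, ih]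

theorem tens_sum_right {J : Type*} (I : Finset J) (f : J → (K.w a ⟶ K.w b)) [∀ i, K.Nice (f i)]
    (g : K.w c ⟶ K.w d) [K.Nice g] : K.tens g (∑ i ∈ I, f i) = ∑ i ∈ I, K.tens g (f i) := by
  classical
  induction I using Finset.induction with
  | empty => exact tens_zero_right g
  | insert i I hi ih => rw [Finset.sum_insert hi, Finset.sum_insert hi, tens_add_right, ih]

theorem tens_M_M (h : Approx a a') (k : Approx b b')
    (hk : Approx (.tensor a b) (.tensor a' b')) : K.tens (K.M h) (K.M k) = K.M hk := by
  rw [tens, K.adapter_tensor h k hk, reassoc_of% (K.tensor_tensor a b)]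

theorem tens_s_s (r t : R) : K.tens (K.s r a) (K.s t b) = K.s (r * t) _ := by
  rw [tens, s_tensor, reassoc_of% (K.tensor_tensor a b)]

theorem M_plusZero (h : Approx (.plus a .zero) a) : K.M h = K.fst a .zero := by
  have := K.plus_zero a h
  rw [fst, pl, ← this, reassoc_of% (K.plus_plus a .zero)]

theorem M_zeroPlus (h : Approx (.plus .zero a) a) : K.M h = K.snd .zero a := by
  have := K.zero_plus a h
  rw [snd, pr, ← this, reassoc_of% (K.plus_plus .zero a)]

theorem Unital.tensorOne {f : K.w a ⟶ K.w b} (hf : K.Unital f) (h : Approx (.tensor a .one) a)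
    (k : Approx (.tensor b .one) b) : K.tens f (𝟙 _) ≫ K.M k = K.M h ≫ f := by
  have := hf.act
  rw [Calculus.act, Calculus.act, Category.assoc] at this
  rw [Calculus.tens, tensorHom_id, Category.assoc, Category.assoc, this,
    reassoc_of% (K.tensor_tensor a .one)]

theorem Unital.oneTensor {f : K.w a ⟶ K.w b} (hf : K.Unital f) (h : Approx (.tensor .one a) a)
    (k : Approx (.tensor .one b) b) : K.tens (𝟙 _) f ≫ K.M k = K.M h ≫ f := by
  have := hf.lact
  rw [Calculus.lact, Calculus.lact, Category.assoc] at this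
  rw [Calculus.tens, id_tensorHom, Category.assoc, Category.assoc, this,
    reassoc_of% (K.tensor_tensor .one a)]

theorem M_dag_T (h : Approx (.tensor (.tensor a b) c) (.tensor a (.tensor b c))) :
    K.M h ≫ K.dag (K.T a (.tensor b c)) ≫ K.w a ◁ K.dag (K.T b c) =
      K.dag (K.T (.tensor a b) c) ≫ K.dag (K.T a b) ▷ K.w c ≫ (α_ _ _ _).hom := by
  rw [K.assoc_tensor a b c h.symm, M_inv_assoc]

theorem tens_tens_M {a b c a' b' c' : Color} (f : K.w a ⟶ K.w a') (g : K.w b ⟶ K.w b')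
    (k : K.w c ⟶ K.w c') [K.Nice f] [K.Nice g] [K.Nice k]
    (h : Approx (.tensor (.tensor a b) c) (.tensor a (.tensor b c)))
    (h' : Approx (.tensor (.tensor a' b') c') (.tensor a' (.tensor b' c'))) :
    K.tens (K.tens f g) k ≫ K.M h' = K.M h ≫ K.tens f (K.tens g k) := by
  have e1 : (K.tens f g ⊗ₘ k) = K.dag (K.T a b) ▷ K.w c ≫ ((f ⊗ₘ g) ⊗ₘ k) ≫ K.T a' b' ▷ K.w c' := by
    simp only [← tensorHom_id, tensorHom_comp_tensorHom, Category.id_comp, Category.comp_id, tens]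
  have e2 : (f ⊗ₘ K.tens g k) = K.w a ◁ K.dag (K.T b c) ≫ (f ⊗ₘ (g ⊗ₘ k)) ≫ K.w a' ◁ K.T b' c' := by
    simp only [← id_tensorHom, tensorHom_comp_tensorHom, Category.id_comp, Category.comp_id, tens]
  have d1 : K.tens (K.tens f g) k = K.dag (K.T _ c) ≫ (K.tens f g ⊗ₘ k) ≫ K.T _ c' := rfl
  have d2 : K.tens f (K.tens g k) = K.dag (K.T a _) ≫ (f ⊗ₘ K.tens g k) ≫ K.T a' _ := rfl
  rw [d1, d2, e1, e2]
  simp only [Category.assoc]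
  rw [reassoc_of% (K.M_dag_T h), K.T_assoc a' b' c' h', associator_naturality_assoc]

theorem M_plus_fst (h : Approx a a') (k : Approx b b') (hk : Approx (.plus a b) (.plus a' b')) :
    K.M hk ≫ K.fst a' b' = K.fst a b ≫ K.M h := by
  have e : K.M hk ≫ K.dag (K.P a' b') = K.dag (K.P a b) ≫ (K.M h ⊗ₘ K.M k) := by
    simpa using congrArg K.dag (K.adapter_plus h.symm k.symm hk.symm).symm
  rw [fst, reassoc_of% e, tensor_pl, fst, Category.assoc]

theorem M_plus_snd (h : Approx a a') (k : Approx b b') (hk : Approx (.plus a b) (.plus a' b')) :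
    K.M hk ≫ K.snd a' b' = K.snd a b ≫ K.M k := by
  have e : K.M hk ≫ K.dag (K.P a' b') = K.dag (K.P a b) ≫ (K.M h ⊗ₘ K.M k) := by
    simpa using congrArg K.dag (K.adapter_plus h.symm k.symm hk.symm).symm
  rw [snd, reassoc_of% e, tensor_pr, snd, Category.assoc]

theorem whiskerRight_pr {X X' Y : C} (f : X ⟶ X') : f ▷ Y ≫ pr X' Y = pr X Y := by
  rw [← tensorHom_id, tensor_pr, Category.comp_id]

theorem whiskerLeft_pr {X Y Y' : C} (f : Y ⟶ Y') : X ◁ f ≫ pr X Y' = pr X Y ≫ f := by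
  rw [← id_tensorHom, tensor_pr]

theorem assoc_pr (K : Calculus R C) (X Y Z : C) :
    (α_ X Y Z).hom ≫ pr X (Y ⊗ Z) = pr X Y ▷ Z := by
  have := congrArg K.dag (ir_whiskerRight_assoc X Y Z)
  simp only [dag_comp, dag_ir, dag_whiskerRight, dag_assoc] at this
  rw [← this, Iso.hom_inv_id_assoc]

theorem assoc_pr_pr (K : Calculus R C) (X Y Z : C) :
    (α_ X Y Z).hom ≫ pr X (Y ⊗ Z) ≫ pr Y Z = pr (X ⊗ Y) Z := by
  have := congrArg K.dag (K.ir_assoc X Y Z)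
  simp only [dag_comp, dag_ir, dag_assoc] at this
  rw [← this, Iso.hom_inv_id_assoc]

theorem M_plusAssoc_inv (h : Approx (.plus a (.plus b c)) (.plus (.plus a b) c)) :
    K.M h ≫ K.fst _ c ≫ K.fst a b = K.fst _ _ ∧ K.M h ≫ K.fst _ c ≫ K.snd a b = K.snd _ _ ≫ K.fst _ _ ∧
      K.M h ≫ K.snd _ c = K.snd _ _ ≫ K.snd _ _ := by
  have e := K.assoc_plus a b c h
  refine ⟨?_, ?_, ?_⟩
  · have := congrArg (· ≫ pl _ _) e
    simp only [Category.assoc, whiskerLeft_pl, K.assoc_pl_pl, reassoc_of% (whiskerRight_pl (X := K.w (.plus a b)) (Y := K.w c))] at this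
    simpa [fst] using this.symm
  · have := congrArg (· ≫ pr _ _ ≫ pl _ _) e
    simp only [Category.assoc, reassoc_of% (whiskerLeft_pr (X := K.w a) (Y := K.w (.plus b c))),
      reassoc_of% K.assoc_pr, whiskerRight_pl, reassoc_of% (whiskerRight_pl (X := K.w (.plus a b)) (Y := K.w c))] at this
    simpa [fst, snd] using this.symm
  · have := congrArg (· ≫ pr _ _ ≫ pr _ _) e
    simp only [Category.assoc, reassoc_of% (whiskerLeft_pr (X := K.w a) (Y := K.w (.plus b c))),
      K.assoc_pr_pr, whiskerRight_pr] at this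
    simpa [snd] using this.symm

end

end Calculus

/-! ### Matrix coefficients in the semantic category -/

/-- Indices of the canonical basis attached to a colour. -/
@[reducible] def Color.Ix : Color → Type
  | .zero => Empty
  | .one => Unit
  | .plus A B => A.Ix ⊕ B.Ix
  | .tensor A B => A.Ix × B.Ix

/-- The canonical basis of a colour is finite. -/
@[reducible] def Color.fintypeIx : (A : Color) → Fintype A.Ix
  | .zero => inferInstanceAs (Fintype Empty)
  | .one => inferInstanceAs (Fintype Unit)
  | .plus A B =>
    haveI := A.fintypeIx
    haveI := B.fintypeIx
    inferInstanceAs (Fintype (A.Ix ⊕ B.Ix))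
  | .tensor A B =>
    haveI := A.fintypeIx
    haveI := B.fintypeIx
    inferInstanceAs (Fintype (A.Ix × B.Ix))

instance (A : Color) : Fintype A.Ix := A.fintypeIx

section

open scoped ZeroObject

attribute [local instance] SemiadditiveOfBinaryBiproducts.addCommMonoidHomOfHasBinaryBiproducts

variable {H : Type v} [Category.{w} H] [MonoidalCategory H] [SymmetricCategory H]
  [HasZeroMorphisms H] [HasZeroObject H] [HasBinaryBiproducts H] [Distributive H]

theorem lift_desc_eq_add {X Y : H} (f g : X ⟶ Y) :
    biprod.lift f g ≫ biprod.desc (𝟙 Y) (𝟙 Y) = f + g :=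
  (SemiadditiveOfBinaryBiproducts.add_eq_left_addition f g).symm

theorem hom_comp_add {X Y Z : H} (f : X ⟶ Y) (g h : Y ⟶ Z) : f ≫ (g + h) = f ≫ g + f ≫ h :=
  SemiadditiveOfBinaryBiproducts.comp_add f g h

theorem hom_add_comp {X Y Z : H} (f g : X ⟶ Y) (h : Y ⟶ Z) : (f + g) ≫ h = f ≫ h + g ≫ h :=
  SemiadditiveOfBinaryBiproducts.add_comp f g h

theorem hom_comp_sum {J : Type*} (I : Finset J) {X Y Z : H} (f : X ⟶ Y) (g : J → (Y ⟶ Z)) :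
    f ≫ ∑ i ∈ I, g i = ∑ i ∈ I, f ≫ g i :=
  map_sum ({ toFun := (f ≫ ·), map_zero' := comp_zero, map_add' := hom_comp_add f } :
    (Y ⟶ Z) →+ (X ⟶ Z)) g I

theorem hom_sum_comp {J : Type*} (I : Finset J) {X Y Z : H} (f : J → (X ⟶ Y)) (g : Y ⟶ Z) :
    (∑ i ∈ I, f i) ≫ g = ∑ i ∈ I, f i ≫ g :=
  map_sum ({ toFun := (· ≫ g), map_zero' := zero_comp, map_add' := fun x y => hom_add_comp x y g } :
    (X ⟶ Y) →+ (X ⟶ Z)) f I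

theorem whiskerLeft_hom_zero (X Y Z : H) : X ◁ (0 : Y ⟶ Z) = 0 := by
  have h : (0 : Y ⟶ Z) = (0 : Y ⟶ (0 : H)) ≫ 0 := by simp
  rw [h, MonoidalCategory.whiskerLeft_comp,
    ((isZero_zero H).of_iso (annihilL X)).eq_of_tgt (X ◁ (0 : Y ⟶ (0 : H))) 0, zero_comp]

theorem inl_distL_inv (X Y Z : H) : biprod.inl ≫ (distL X Y Z).inv = X ◁ biprod.inl := by
  rw [Iso.comp_inv_eq]
  apply biprod.hom_ext <;>
    simp [distL, ← MonoidalCategory.whiskerLeft_comp, whiskerLeft_hom_zero]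

theorem inr_distL_inv (X Y Z : H) : biprod.inr ≫ (distL X Y Z).inv = X ◁ biprod.inr := by
  rw [Iso.comp_inv_eq]
  apply biprod.hom_ext <;>
    simp [distL, ← MonoidalCategory.whiskerLeft_comp, whiskerLeft_hom_zero]

/-- A sum is a pairing followed by a codiagonal, and the distributor carries both through X ⊗ –. -/
theorem whiskerLeft_hom_add (X : H) {Y Z : H} (f g : Y ⟶ Z) : X ◁ (f + g) = X ◁ f + X ◁ g := by
  have h1 : X ◁ biprod.lift f g = biprod.lift (X ◁ f) (X ◁ g) ≫ (distL X Z Z).inv := by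
    rw [Iso.eq_comp_inv]
    apply biprod.hom_ext <;> simp [distL, ← MonoidalCategory.whiskerLeft_comp]
  have h2 : (distL X Z Z).inv ≫ X ◁ biprod.desc (𝟙 Z) (𝟙 Z) = biprod.desc (𝟙 _) (𝟙 _) := by
    apply biprod.hom_ext'
    · rw [reassoc_of% inl_distL_inv X Z Z, ← MonoidalCategory.whiskerLeft_comp]; simp
    · rw [reassoc_of% inr_distL_inv X Z Z, ← MonoidalCategory.whiskerLeft_comp]; simp
  rw [← lift_desc_eq_add, ← lift_desc_eq_add, MonoidalCategory.whiskerLeft_comp, h1,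
    Category.assoc, h2]

theorem whiskerLeft_hom_sum {J : Type*} (I : Finset J) (X : H) {Y Z : H} (f : J → (Y ⟶ Z)) :
    X ◁ (∑ i ∈ I, f i) = ∑ i ∈ I, X ◁ f i :=
  map_sum ({ toFun := (X ◁ ·), map_zero' := whiskerLeft_hom_zero X Y Z,
             map_add' := whiskerLeft_hom_add X } : (Y ⟶ Z) →+ (X ⊗ Y ⟶ X ⊗ Z)) f I

theorem whiskerRight_hom_sum {J : Type*} (I : Finset J) (X : H) {Y Z : H} (f : J → (Y ⟶ Z)) :
    (∑ i ∈ I, f i) ▷ X = ∑ i ∈ I, f i ▷ X := by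
  rw [← cancel_mono (β_ _ _).hom, BraidedCategory.braiding_naturality_left, whiskerLeft_hom_sum,
    hom_comp_sum, hom_sum_comp]
  exact Finset.sum_congr rfl fun i _ => (BraidedCategory.braiding_naturality_left _ _).symm

variable (H) in
/-- The basis elements of the interpretation of a colour. -/
noncomputable def hin : {A : Color} → A.Ix → (𝟙_ H ⟶ semColor H A)
  | .zero, i => i.elim
  | .one, _ => 𝟙 _
  | .plus _ _, .inl i => hin i ≫ biprod.inl
  | .plus _ _, .inr i => hin i ≫ biprod.inr
  | .tensor _ _, (i, j) => (λ_ _).inv ≫ (hin i ⊗ₘ hin j)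

variable (H) in
/-- The coordinates on the interpretation of a colour. -/
noncomputable def hout : {A : Color} → A.Ix → (semColor H A ⟶ 𝟙_ H)
  | .zero, i => i.elim
  | .one, _ => 𝟙 _
  | .plus _ _, .inl i => biprod.fst ≫ hout i
  | .plus _ _, .inr i => biprod.snd ≫ hout i
  | .tensor _ _, (i, j) => (hout i ⊗ₘ hout j) ≫ (λ_ _).hom

theorem hin_tensor {A B : Color} (i : A.Ix) (j : B.Ix) : hin H (A := .tensor A B) (i, j) =
    (λ_ _).inv ≫ (hin H i ⊗ₘ hin H j) := rfl

theorem hout_tensor {A B : Color} (i : A.Ix) (j : B.Ix) : hout H (A := .tensor A B) (i, j) =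
    (hout H i ⊗ₘ hout H j) ≫ (λ_ _).hom := rfl

/-- By distributivity every interpreted colour is a finite biproduct of copies of the tensor unit;
this is the corresponding resolution of the identity. -/
theorem sum_hout_hin : (A : Color) → ∑ i : A.Ix, hout H i ≫ hin H i = 𝟙 (semColor H A)
  | .zero => (isZero_zero H).eq_of_src _ _
  | .one => by
    rw [Finset.univ_unique, Finset.sum_singleton]
    exact Category.comp_id _
  | .plus A B => by
    rw [Fintype.sum_sum_type]
    have e1 (i : A.Ix) : hout H (A := .plus A B) (.inl i) ≫ hin H (A := .plus A B) (.inl i) =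
        biprod.fst ≫ (hout H i ≫ hin H i) ≫ biprod.inl := by simp [hin, hout]
    have e2 (i : B.Ix) : hout H (A := .plus A B) (.inr i) ≫ hin H (A := .plus A B) (.inr i) =
        biprod.snd ≫ (hout H i ≫ hin H i) ≫ biprod.inr := by simp [hin, hout]
    simp only [e1, e2, ← hom_comp_sum, ← hom_sum_comp, sum_hout_hin A, sum_hout_hin B]
    apply biprod.hom_ext' <;> simp [hom_comp_add]
  | .tensor A B => by
    rw [Fintype.sum_prod_type]
    have e (i : A.Ix) (j : B.Ix) :
        hout H (A := .tensor A B) (i, j) ≫ hin H (A := .tensor A B) (i, j) =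
          (hout H i ≫ hin H i) ▷ _ ≫ _ ◁ (hout H j ≫ hin H j) := by
      simp [← MonoidalCategory.tensorHom_def, hin, hout, -comp_whiskerRight,
        -MonoidalCategory.whiskerLeft_comp]
    simp only [e, ← hom_comp_sum, ← whiskerLeft_hom_sum, ← hom_sum_comp, ← whiskerRight_hom_sum,
      sum_hout_hin A, sum_hout_hin B]
    simp

/-- `f + g` with respect to the biproducts, on endomorphisms of the unit. -/
theorem ScalarIso.map_add' {R : Type u} [CommSemiring R] (scal : ScalarIso R H) (s t : R) :
    scal.toFun (s + t) = scal.toFun s + scal.toFun t := by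
  rw [scal.map_add, ← lift_desc_eq_add, ← Category.assoc]
  congr 1
  apply biprod.hom_ext <;> simp

namespace ScalarIso

variable {R : Type u} [CommSemiring R] (scal : ScalarIso R H)

/-- The scalar of an endomorphism of the unit. -/
noncomputable def coeff (φ : 𝟙_ H ⟶ 𝟙_ H) : R := (_root_.Equiv.ofBijective _ scal.bijective).symm φ

theorem toFun_coeff (φ : 𝟙_ H ⟶ 𝟙_ H) : scal.toFun (scal.coeff φ) = φ :=
  (_root_.Equiv.ofBijective _ scal.bijective).apply_symm_apply φ

theorem coeff_eq {φ : 𝟙_ H ⟶ 𝟙_ H} {r : R} (h : φ = scal.toFun r) : scal.coeff φ = r :=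
  scal.bijective.1 ((scal.toFun_coeff φ).trans h)

theorem coeff_zero : scal.coeff 0 = 0 := scal.coeff_eq scal.map_zero.symm

theorem coeff_id : scal.coeff (𝟙 _) = 1 := scal.coeff_eq scal.map_one.symm

theorem coeff_add (φ ψ : 𝟙_ H ⟶ 𝟙_ H) : scal.coeff (φ + ψ) = scal.coeff φ + scal.coeff ψ :=
  scal.coeff_eq (by rw [map_add', toFun_coeff, toFun_coeff])

theorem coeff_comp (φ ψ : 𝟙_ H ⟶ 𝟙_ H) : scal.coeff (φ ≫ ψ) = scal.coeff φ * scal.coeff ψ :=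
  -- `ScalarIso.map_mul` reverses the diagrammatic order, so commutativity of `R` is used.
  scal.coeff_eq (by rw [mul_comm, map_mul, toFun_coeff, toFun_coeff])

theorem coeff_sum {J : Type*} (I : Finset J) (φ : J → (𝟙_ H ⟶ 𝟙_ H)) :
    scal.coeff (∑ i ∈ I, φ i) = ∑ i ∈ I, scal.coeff (φ i) :=
  map_sum ({ toFun := scal.coeff, map_zero' := scal.coeff_zero, map_add' := scal.coeff_add } :
    (𝟙_ H ⟶ 𝟙_ H) →+ R) φ I

/-- On the tensor unit, ⊗ of endomorphisms is composition up to the unitors, which coincide there.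
-/
theorem coeff_tensor (φ ψ : 𝟙_ H ⟶ 𝟙_ H) :
    scal.coeff ((λ_ _).inv ≫ (φ ⊗ₘ ψ) ≫ (λ_ _).hom) = scal.coeff φ * scal.coeff ψ := by
  rw [← coeff_comp]
  congr 1
  rw [MonoidalCategory.tensorHom_def]
  simp [unitors_equal, unitors_inv_equal]

theorem comp_semScalar {X Y : H} (f : X ⟶ Y) (r : R) :
    f ≫ semScalar scal r Y = semScalar scal r X ≫ f := by
  simp only [semScalar, Category.assoc, ← leftUnitor_naturality, leftUnitor_inv_naturality_assoc,
    whisker_exchange_assoc]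

theorem semScalar_unit (r : R) : semScalar scal r (𝟙_ H) = scal.toFun r := by
  simp [semScalar, unitors_equal, unitors_inv_equal]

end ScalarIso

end

namespace Calculus

attribute [local instance] SemiadditiveOfBinaryBiproducts.addCommMonoidHomOfHasBinaryBiproducts

variable {R : Type u} [CommSemiring R] {C : Type v} [Category.{w} C] [MonoidalCategory C]
  [SymmetricCategory C] [HasZeroMorphisms C] (K : Calculus R C)
  {H : Type v'} [Category.{w'} H] [MonoidalCategory H] [SymmetricCategory H]
  [HasZeroMorphisms H] [HasZeroObject H] [HasBinaryBiproducts H] [Distributive H]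
  (scal : ScalarIso R H)

/-! ### Matrix coefficients in the calculus -/

/-- The basis elements of a wire. -/
def kin : {A : Color} → A.Ix → (K.w .one ⟶ K.w A)
  | .zero, i => i.elim
  | .one, _ => 𝟙 _
  | .plus _ _, .inl i => kin i ≫ K.inl _ _
  | .plus _ _, .inr i => kin i ≫ K.inr _ _
  | .tensor _ _, (i, j) => K.M (Adapt.oneTensor .one).approx.symm ≫ K.tens (kin i) (kin j)

/-- The coordinates on a wire. -/
def kout : {A : Color} → A.Ix → (K.w A ⟶ K.w .one)
  | .zero, i => i.elim
  | .one, _ => 𝟙 _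
  | .plus _ _, .inl i => K.fst _ _ ≫ kout i
  | .plus _ _, .inr i => K.snd _ _ ≫ kout i
  | .tensor _ _, (i, j) => K.tens (kout i) (kout j) ≫ K.M (Adapt.oneTensor .one).approx

theorem kin_tensor {a b : Color} (i : a.Ix) (j : b.Ix) : K.kin (A := .tensor a b) (i, j) =
    K.M (Adapt.oneTensor .one).approx.symm ≫ K.tens (K.kin i) (K.kin j) := rfl

theorem kout_tensor {a b : Color} (i : a.Ix) (j : b.Ix) : K.kout (A := .tensor a b) (i, j) =
    K.tens (K.kout i) (K.kout j) ≫ K.M (Adapt.oneTensor .one).approx := rfl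

instance nice_kin : {A : Color} → (i : A.Ix) → K.Nice (K.kin i)
  | .zero, i => i.elim
  | .one, _ => Nice.id
  | .plus _ _, .inl i => haveI := nice_kin i; Nice.comp _ _
  | .plus _ _, .inr i => haveI := nice_kin i; Nice.comp _ _
  | .tensor _ _, (i, j) => haveI := nice_kin i; haveI := nice_kin j; Nice.comp _ _

instance nice_kout : {A : Color} → (i : A.Ix) → K.Nice (K.kout i)
  | .zero, i => i.elim
  | .one, _ => Nice.id
  | .plus _ _, .inl i => haveI := nice_kout i; Nice.comp _ _
  | .plus _ _, .inr i => haveI := nice_kout i; Nice.comp _ _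
  | .tensor _ _, (i, j) => haveI := nice_kout i; haveI := nice_kout j; Nice.comp _ _

/-- The counterpart of `sum_hout_hin` inside the calculus. The base case is the axiom `id_zero`; the
others are the biproduct identity and the bilinearity of `tens`. -/
theorem sum_kout_kin : (A : Color) → ∑ i : A.Ix, K.kout i ≫ K.kin i = 𝟙 (K.w A)
  | .zero => K.id_zero.symm
  | .one => by
    rw [Finset.univ_unique, Finset.sum_singleton]
    exact Category.comp_id _
  | .plus A B => by
    rw [Fintype.sum_sum_type]
    have e1 (i : A.Ix) : K.kout (A := .plus A B) (.inl i) ≫ K.kin (A := .plus A B) (.inl i) =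
        K.fst _ _ ≫ (K.kout i ≫ K.kin i) ≫ K.inl _ _ := by simp [kin, kout]
    have e2 (i : B.Ix) : K.kout (A := .plus A B) (.inr i) ≫ K.kin (A := .plus A B) (.inr i) =
        K.snd _ _ ≫ (K.kout i ≫ K.kin i) ≫ K.inr _ _ := by simp [kin, kout]
    simp only [e1, e2, ← nice_comp_sum, ← sum_comp_nice, sum_kout_kin A, sum_kout_kin B]
    rw [Category.id_comp, Category.id_comp, fst_inl_add_snd_inr]
  | .tensor A B => by
    rw [Fintype.sum_prod_type]
    have e (i : A.Ix) (j : B.Ix) :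
        K.kout (A := .tensor A B) (i, j) ≫ K.kin (A := .tensor A B) (i, j) =
          K.tens (K.kout i ≫ K.kin i) (K.kout j ≫ K.kin j) := by
      rw [kout, kin, Category.assoc, M_M_assoc, M_id, Category.id_comp, tens_comp]
    simp only [e, ← tens_sum_left, ← tens_sum_right, sum_kout_kin A, sum_kout_kin B]
    exact tens_id

/-- `f` has the same matrix coefficients as `φ`. -/
structure Rel {a b : Color} (f : K.w a ⟶ K.w b) (φ : semColor H a ⟶ semColor H b) : Prop where
  nice : K.Nice f
  coeff_eq : ∀ i j, K.kin i ≫ f ≫ K.kout j = K.s (scal.coeff (hin H i ≫ φ ≫ hout H j)) .one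

variable {K scal} {a b c d : Color}

/-- Both sides obey the same recursion on colours: zero across different summands, a product of
coefficients on tensors, and 1 at the unit colour. -/
theorem kin_kout : {a : Color} → (i j : a.Ix) →
    K.kin i ≫ K.kout j = K.s (scal.coeff (hin H i ≫ hout H j)) .one
  | .zero, i, _ => i.elim
  | .one, _, _ => by
    have : hin H (A := .one) () ≫ hout H (A := .one) () = 𝟙 (𝟙_ H) := Category.comp_id _
    rw [this, scal.coeff_id, s_one]
    exact Category.comp_id _
  | .plus a b, .inl i, .inl j => by
    simpa [kin, kout, hin, hout, reassoc_of% K.inl_fst] using kin_kout i j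
  | .plus a b, .inr i, .inr j => by
    simpa [kin, kout, hin, hout, reassoc_of% K.inr_snd] using kin_kout i j
  | .plus a b, .inl i, .inr j => by
    simp [kin, kout, hin, hout, reassoc_of% K.inl_snd, scal.coeff_zero, s_zero]
  | .plus a b, .inr i, .inl j => by
    simp [kin, kout, hin, hout, reassoc_of% K.inr_fst, scal.coeff_zero, s_zero]
  | .tensor a b, (i, i'), (j, j') => by
    have e : hin H (A := .tensor a b) (i, i') ≫ hout H (A := .tensor a b) (j, j') =
        (λ_ _).inv ≫ ((hin H i ≫ hout H j) ⊗ₘ (hin H i' ≫ hout H j')) ≫ (λ_ _).hom := by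
      simp [hin, hout]
    rw [e, scal.coeff_tensor, kin, kout, Category.assoc, ← reassoc_of% (tens_comp (K := K)),
      kin_kout i j, kin_kout i' j', tens_s_s, s_M, M_inv_assoc]

theorem comp_eq_sum (f : K.w a ⟶ K.w b) (g : K.w b ⟶ K.w c) [K.Nice f] [K.Nice g] :
    f ≫ g = ∑ k : b.Ix, f ≫ K.kout k ≫ K.kin k ≫ g := by
  simp only [← nice_comp_sum, ← sum_comp_nice, ← Category.assoc (K.kout _), sum_kout_kin,
    Category.id_comp]

theorem hom_comp_eq_sum (φ : semColor H a ⟶ semColor H b) (ψ : semColor H b ⟶ semColor H c) :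
    φ ≫ ψ = ∑ k : b.Ix, φ ≫ hout H k ≫ hin H k ≫ ψ := by
  simp only [← hom_comp_sum, ← hom_sum_comp, ← Category.assoc (hout H _), sum_hout_hin,
    Category.id_comp]

namespace Rel

/-- Inserting the resolution of the identity on both sides writes a nice morphism in terms of its
coefficients alone. This is completeness for diagrams between single wires. -/
theorem ext {f g : K.w a ⟶ K.w b} {φ : semColor H a ⟶ semColor H b} (hf : K.Rel scal f φ)
    (hg : K.Rel scal g φ) : f = g := by
  have := hf.nice
  have := hg.nice
  have e (f : K.w a ⟶ K.w b) (hf : K.Nice f) :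
      f = ∑ i : a.Ix, ∑ j : b.Ix, K.kout i ≫ (K.kin i ≫ f ≫ K.kout j) ≫ K.kin j := by
    simp only [← nice_comp_sum, Category.assoc, sum_kout_kin, Category.comp_id]
    simp only [← Category.assoc (K.kout _), ← sum_comp_nice, sum_kout_kin, Category.id_comp]
  rw [e f hf.nice, e g hg.nice]
  simp only [hf.coeff_eq, hg.coeff_eq]

theorem id : K.Rel scal (𝟙 (K.w a)) (𝟙 (semColor H a)) :=
  ⟨inferInstance, fun i j => by rw [Category.id_comp, Category.id_comp, kin_kout (scal := scal)]⟩

/-- Matrix multiplication: the same resolution of the identity is inserted between the two factors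
in the calculus and in H. -/
theorem comp {f : K.w a ⟶ K.w b} {φ : semColor H a ⟶ semColor H b} {g : K.w b ⟶ K.w c}
    {ψ : semColor H b ⟶ semColor H c} (hf : K.Rel scal f φ) (hg : K.Rel scal g ψ) :
    K.Rel scal (f ≫ g) (φ ≫ ψ) := by
  have := hf.nice
  have := hg.nice
  refine ⟨inferInstance, fun i j => ?_⟩
  rw [comp_eq_sum f g, hom_comp_eq_sum φ ψ, sum_comp_nice, nice_comp_sum, hom_sum_comp,
    hom_comp_sum, scal.coeff_sum, s_sum]
  refine Finset.sum_congr rfl fun k _ => ?_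
  have e1 : K.kin i ≫ (f ≫ K.kout k ≫ K.kin k ≫ g) ≫ K.kout j =
      (K.kin i ≫ f ≫ K.kout k) ≫ K.kin k ≫ g ≫ K.kout j := by simp
  have e2 : hin H i ≫ (φ ≫ hout H k ≫ hin H k ≫ ψ) ≫ hout H j =
      (hin H i ≫ φ ≫ hout H k) ≫ hin H k ≫ ψ ≫ hout H j := by simp
  rw [e1, e2, scal.coeff_comp, hf.coeff_eq, hg.coeff_eq, s_s]

theorem zero : K.Rel scal (0 : K.w a ⟶ K.w b) (0 : semColor H a ⟶ semColor H b) :=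
  ⟨inferInstance, fun i j => by simp [scal.coeff_zero, s_zero]⟩

theorem add {f g : K.w a ⟶ K.w b} {φ ψ : semColor H a ⟶ semColor H b} (hf : K.Rel scal f φ)
    (hg : K.Rel scal g ψ) : K.Rel scal (f + g) (φ + ψ) := by
  have := hf.nice
  have := hg.nice
  refine ⟨inferInstance, fun i j => ?_⟩
  rw [add_comp, nice_comp_add, hom_add_comp, hom_comp_add, scal.coeff_add, hf.coeff_eq,
    hg.coeff_eq, s_add']

theorem sum {J : Type*} (I : Finset J) {f : J → (K.w a ⟶ K.w b)}
    {φ : J → (semColor H a ⟶ semColor H b)} (h : ∀ i, K.Rel scal (f i) (φ i)) :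
    K.Rel scal (∑ i ∈ I, f i) (∑ i ∈ I, φ i) := by
  classical
  induction I using Finset.induction with
  | empty => exact zero
  | insert i I hi ih => rw [Finset.sum_insert hi, Finset.sum_insert hi]; exact (h i).add ih

theorem kin (i : a.Ix) : K.Rel scal (K.kin i) (hin H i) :=
  ⟨inferInstance, fun k j => by
    have e1 : K.kin (A := .one) k = 𝟙 _ := rfl
    have e2 : hin H (A := .one) k = 𝟙 _ := rfl
    rw [e1, e2, Category.id_comp, Category.id_comp, kin_kout (scal := scal)]⟩

theorem kout (i : a.Ix) : K.Rel scal (K.kout i) (hout H i) :=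
  ⟨inferInstance, fun k j => by
    have e1 : K.kout (A := .one) j = 𝟙 _ := rfl
    have e2 : hout H (A := .one) j = 𝟙 _ := rfl
    rw [e1, e2, Category.comp_id, Category.comp_id, kin_kout (scal := scal)]⟩

theorem scalar (r : R) : K.Rel scal (K.s r a) (semScalar scal r (semColor H a)) :=
  ⟨inferInstance, fun i j => by
    have := (nice_kin K i).unital
    rw [← reassoc_of% (this.s_comp r), kin_kout (scal := scal), s_s,
      reassoc_of% (scal.comp_semScalar (hin H i) r), scal.semScalar_unit, scal.coeff_comp,
      scal.coeff_eq rfl]⟩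

/-- Every semantic morphism has a counterpart in the calculus. -/
theorem exists_rel (φ : semColor H a ⟶ semColor H b) : ∃ f : K.w a ⟶ K.w b, K.Rel scal f φ := by
  have e : φ = ∑ i : a.Ix, ∑ j : b.Ix,
      hout H i ≫ semScalar scal (scal.coeff (hin H i ≫ φ ≫ hout H j)) (𝟙_ H) ≫ hin H j := by
    simp only [scal.semScalar_unit, scal.toFun_coeff, ← hom_comp_sum, Category.assoc,
      sum_hout_hin, Category.comp_id]
    simp only [← Category.assoc (hout H _), ← hom_sum_comp, sum_hout_hin, Category.id_comp]
  refine ⟨∑ i : a.Ix, ∑ j : b.Ix,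
    K.kout i ≫ K.s (scal.coeff (hin H i ≫ φ ≫ hout H j)) .one ≫ K.kin j, ?_⟩
  -- Only the target is expanded; the φ inside the coefficients of the witness stays as it is.
  nth_rw 2 [e]
  exact sum _ fun i => sum _ fun j => (kout i).comp ((scalar _).comp (kin j))

theorem inl : K.Rel scal (K.inl a b) (biprod.inl : semColor H a ⟶ semColor H a ⊞ semColor H b) :=
  ⟨inferInstance, fun i j => by
    rw [← Category.assoc, ← Category.assoc]
    exact kin_kout (a := .plus a b) (.inl i) j⟩

theorem inr : K.Rel scal (K.inr a b) (biprod.inr : semColor H b ⟶ semColor H a ⊞ semColor H b) :=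
  ⟨inferInstance, fun i j => by
    rw [← Category.assoc, ← Category.assoc]
    exact kin_kout (a := .plus a b) (.inr i) j⟩

theorem fst : K.Rel scal (K.fst a b) (biprod.fst : semColor H a ⊞ semColor H b ⟶ semColor H a) :=
  ⟨inferInstance, fun i j => kin_kout (a := .plus a b) i (.inl j)⟩

theorem snd : K.Rel scal (K.snd a b) (biprod.snd : semColor H a ⊞ semColor H b ⟶ semColor H b) :=
  ⟨inferInstance, fun i j => kin_kout (a := .plus a b) i (.inr j)⟩

theorem of_fst_snd {f : K.w a ⟶ K.w (.plus b c)} {φ : semColor H a ⟶ semColor H b ⊞ semColor H c}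
    [hf : K.Nice f] (h1 : K.Rel scal (f ≫ K.fst b c) (φ ≫ biprod.fst))
    (h2 : K.Rel scal (f ≫ K.snd b c) (φ ≫ biprod.snd)) : K.Rel scal (b := .plus b c) f φ :=
  ⟨hf, fun i j => by
    match j with
    | .inl j => simpa [Calculus.kout, hout] using h1.coeff_eq i j
    | .inr j => simpa [Calculus.kout, hout] using h2.coeff_eq i j⟩

theorem tens {f : K.w a ⟶ K.w b} {φ : semColor H a ⟶ semColor H b} {g : K.w c ⟶ K.w d}
    {ψ : semColor H c ⟶ semColor H d} (hf : K.Rel scal f φ) (hg : K.Rel scal g ψ) :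
    K.Rel scal (a := .tensor a c) (b := .tensor b d) (K.tens f g) (φ ⊗ₘ ψ) := by
  have := hf.nice
  have := hg.nice
  refine ⟨inferInstance, fun (i, i') (j, j') => ?_⟩
  have e : hin H (A := .tensor a c) (i, i') ≫ (φ ⊗ₘ ψ) ≫ hout H (A := .tensor b d) (j, j') =
      (λ_ _).inv ≫ ((hin H i ≫ φ ≫ hout H j) ⊗ₘ (hin H i' ≫ ψ ≫ hout H j')) ≫ (λ_ _).hom := by
    simp [hin, hout]
  rw [e, scal.coeff_tensor, Calculus.kin, Calculus.kout, Category.assoc,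
    ← reassoc_of% (tens_comp (K := K)), ← reassoc_of% (tens_comp (K := K)), Category.assoc,
    Category.assoc, hf.coeff_eq, hg.coeff_eq, tens_s_s, s_M, M_inv_assoc]

theorem sw : K.Rel scal (a := .tensor a b) (b := .tensor b a) (K.sw a b)
    (β_ (semColor H a) (semColor H b)).hom := by
  refine ⟨inferInstance, fun (i, i') (j, j') => ?_⟩
  have e : hin H (A := .tensor a b) (i, i') ≫ (β_ (semColor H a) (semColor H b)).hom ≫
      hout H (A := .tensor b a) (j, j') =
      (λ_ _).inv ≫ ((hin H i ≫ hout H j') ⊗ₘ (hin H i' ≫ hout H j)) ≫ (λ_ _).hom := by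
    simp only [hin, hout, Category.assoc, ← BraidedCategory.braiding_naturality_assoc,
      tensorHom_comp_tensorHom_assoc]
    rw [braiding_leftUnitor, ← unitors_equal]
  have e' : K.sw .one .one ≫ K.M (Adapt.oneTensor .one).approx =
      K.M (Adapt.oneTensor .one).approx := by
    rw [Calculus.sw, Category.assoc, Category.assoc,
      ← K.unit_tensor .one (Adapt.tensorOne .one).approx, reassoc_of% (K.tensor_tensor .one .one)]
  rw [e, scal.coeff_tensor, Calculus.kin, Calculus.kout, Category.assoc,
    ← reassoc_of% (tens_sw (K := K)), e', ← reassoc_of% (tens_comp (K := K)),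
    kin_kout (scal := scal), kin_kout (scal := scal), tens_s_s, s_M, M_inv_assoc]

/-- The inverse isomorphism has some counterpart g. By `ext`, g is a right inverse of the adapter,
hence equals the inverse adapter. -/
theorem adapt_symm {h : Approx a b} {e : semColor H a ≅ semColor H b}
    (hr : K.Rel scal (K.M h) e.hom) : K.Rel scal (K.M h.symm) e.inv := by
  obtain ⟨g, hg⟩ := exists_rel (K := K) (scal := scal) e.inv
  have h1 := hr.comp hg
  rw [e.hom_inv_id] at h1
  have h2 : K.M h.symm = g := by
    have h3 := congrArg (K.M h.symm ≫ ·) (h1.ext Rel.id)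
    simpa only [M_inv_assoc, Category.comp_id] using h3.symm
  rwa [h2]

/-- Induction on derivations. `K.M` sees only that a derivation exists, so all derivations of A ≈ A'
have the same coefficients; the coherence of the semantic isomorphisms comes as a by-product, and
the choice made in `semApprox` is harmless. -/
theorem adapt : {a b : Color} → (h : Adapt a b) → K.Rel scal (K.M h.approx) (semAdapt H h).hom
  | _, _, .refl a => by rw [K.M_id]; exact Rel.id
  | _, _, .symm h => (adapt h).adapt_symm
  | _, _, .trans h k => by
    have := (adapt h).comp (adapt k)
    rwa [K.M_M] at this
  | _, _, .plusZero a => by rw [K.M_plusZero]; exact fst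
  | _, _, .zeroPlus a => by rw [K.M_zeroPlus]; exact snd
  | _, _, .tensorOne a => ⟨inferInstance, fun (i, i') j => by
      have e : hin H (A := .tensor a .one) (i, i') ≫ (ρ_ (semColor H a)).hom ≫ hout H j =
          hin H i ≫ hout H j := by
        simp [hin, unitors_inv_equal]
      have e1 : K.kin (A := .one) i' = 𝟙 _ := rfl
      have e2 := (nice_kin K i).unital.tensorOne (Adapt.tensorOne _).approx
        (Adapt.tensorOne _).approx
      rw [semAdapt, e, Calculus.kin, Category.assoc, e1, reassoc_of% e2, M_inv_assoc, kin_kout (scal := scal)]⟩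
  | _, _, .oneTensor a => ⟨inferInstance, fun (i, i') j => by
      have e : hin H (A := .tensor .one a) (i, i') ≫ (λ_ (semColor H a)).hom ≫ hout H j =
          hin H i' ≫ hout H j := by
        simp [hin]
      have e1 : K.kin (A := .one) i = 𝟙 _ := rfl
      have e2 := (nice_kin K i').unital.oneTensor (Adapt.oneTensor _).approx
        (Adapt.oneTensor _).approx
      rw [semAdapt, e, Calculus.kin, Category.assoc, e1, reassoc_of% e2, M_inv_assoc, kin_kout (scal := scal)]⟩
  | _, _, .plusAssoc a b c => by
    obtain ⟨h1, h2, h3⟩ := M_plusAssoc_inv (K := K) (Adapt.plusAssoc a b c).approx.symm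
    refine adapt_symm (h := (Adapt.plusAssoc a b c).approx.symm)
      (e := (biprod.associator (semColor H a) (semColor H b) (semColor H c)).symm) ?_
    refine of_fst_snd (of_fst_snd ?_ ?_) ?_
    · rw [Category.assoc, h1]; simpa using fst
    · rw [Category.assoc, h2]; simpa using snd.comp fst
    · rw [h3]; simpa using snd.comp snd
  | _, _, .tensorAssoc a b c => ⟨inferInstance, fun ((i, j), k) (i', (j', k')) => by
      have e : hin H (A := .tensor (.tensor a b) c) ((i, j), k) ≫
          (α_ (semColor H a) (semColor H b) (semColor H c)).hom ≫
            hout H (A := .tensor a (.tensor b c)) (i', (j', k')) =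
          (λ_ _).inv ≫ ((hin H i ≫ hout H i') ⊗ₘ ((λ_ _).inv ≫
            ((hin H j ≫ hout H j') ⊗ₘ (hin H k ≫ hout H k')) ≫ (λ_ _).hom)) ≫ (λ_ _).hom := by
        have e1 : (hin H (A := .tensor a b) (i, j) ⊗ₘ hin H k) =
            (λ_ (𝟙_ H)).inv ▷ 𝟙_ H ≫ ((hin H i ⊗ₘ hin H j) ⊗ₘ hin H k) := by
          rw [← tensorHom_id, tensorHom_comp_tensorHom, Category.id_comp, hin]
        have e2 : (hout H i' ⊗ₘ hout H (A := .tensor b c) (j', k')) =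
            (hout H i' ⊗ₘ (hout H j' ⊗ₘ hout H k')) ≫ 𝟙_ H ◁ (λ_ (𝟙_ H)).hom := by
          rw [← id_tensorHom, tensorHom_comp_tensorHom, Category.comp_id, hout]
        have e3 : (λ_ (𝟙_ H)).inv ▷ 𝟙_ H ≫ (α_ _ _ _).hom = 𝟙_ H ◁ (λ_ (𝟙_ H)).inv := by
          monoidal
        rw [hin_tensor (A := .tensor a b) (i, j) k, hout_tensor (B := .tensor b c) i' (j', k'), e1, e2]
        simp only [Category.assoc, associator_naturality_assoc, reassoc_of% e3]
        simp only [← id_tensorHom, tensorHom_comp_tensorHom_assoc, Category.id_comp,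
          Category.comp_id]
      have e1 : K.tens (K.kin (A := .tensor a b) (i, j)) (K.kin k) =
          K.M (Adapt.tensorLeft (.symm (.oneTensor .one)) .one).approx ≫
            K.tens (K.tens (K.kin i) (K.kin j)) (K.kin k) := by
        rw [← tens_M_M (Adapt.symm (.oneTensor .one)).approx (Adapt.refl .one).approx, M_id,
          ← tens_comp, Category.id_comp]
        rfl
      have e2 : K.tens (K.kout i') (K.kout (A := .tensor b c) (j', k')) =
          K.tens (K.kout i') (K.tens (K.kout j') (K.kout k')) ≫
            K.M (Adapt.tensorRight .one (.oneTensor .one)).approx := by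
        rw [← tens_M_M (Adapt.refl .one).approx (Adapt.oneTensor .one).approx, M_id,
          ← tens_comp, Category.comp_id]
        rfl
      rw [semAdapt, e, scal.coeff_tensor, scal.coeff_tensor, K.kin_tensor (a := .tensor a b) (i, j) k,
        K.kout_tensor (b := .tensor b c) i' (j', k'), e1, e2]
      simp only [Category.assoc]
      rw [reassoc_of% (tens_tens_M (K := K) (K.kin i) (K.kin j) (K.kin k)
          (Adapt.tensorAssoc .one .one .one).approx), ← reassoc_of% (tens_comp (K := K)),
        ← tens_comp, kin_kout (scal := scal), kin_kout (scal := scal), kin_kout (scal := scal),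
        tens_s_s, tens_s_s, reassoc_of% (K.s_M), s_M, M_M_assoc, M_M_assoc, M_M_assoc, M_inv_assoc]⟩
  | _, _, .plusLeft h c => by
    refine of_fst_snd ?_ ?_
    · rw [M_plus_fst h.approx (Adapt.refl c).approx]; simpa [semAdapt] using fst.comp (adapt h)
    · rw [M_plus_snd h.approx (Adapt.refl c).approx, M_id, Category.comp_id]
      simpa [semAdapt] using snd
  | _, _, .plusRight c h => by
    refine of_fst_snd ?_ ?_
    · rw [M_plus_fst (Adapt.refl c).approx h.approx, M_id, Category.comp_id]
      simpa [semAdapt] using fst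
    · rw [M_plus_snd (Adapt.refl c).approx h.approx]; simpa [semAdapt] using snd.comp (adapt h)
  | _, _, .tensorLeft h c => by
    rw [← tens_M_M h.approx (Adapt.refl c).approx, M_id]
    simpa [semAdapt] using (adapt h).tens Rel.id
  | _, _, .tensorRight c h => by
    rw [← tens_M_M (Adapt.refl c).approx h.approx, M_id]
    simpa [semAdapt] using Rel.id.tens (adapt h)

theorem approx (h : Approx a b) : K.Rel scal (K.M h) (semApprox H h).hom :=
  adapt (Classical.choice h)

end Rel

end Calculus

/-! ### The category of diagrams -/

/-- The objects of the category of diagrams over `R`. -/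
structure FCat (R : Type u) : Type where
  obj : Obj

namespace FCat

variable {R : Type u} [CommSemiring R]

/-- Diagrams up to `≡`. -/
def setoid (X Y : Obj) : Setoid (Diag R X Y) := ⟨Equiv, .refl, .symm, .trans⟩

instance : Category.{u} (FCat R) where
  Hom X Y := Quotient (setoid (R := R) X.obj Y.obj)
  id X := Quotient.mk _ (Diag.id X.obj)
  comp f g := Quotient.map₂ Diag.comp (fun _ _ h _ _ k => Equiv.comp h k) f g
  id_comp := by rintro _ _ ⟨d⟩; exact Quotient.sound (.id_comp d)
  comp_id := by rintro _ _ ⟨d⟩; exact Quotient.sound (.comp_id d)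
  assoc := by rintro _ _ _ _ ⟨d⟩ ⟨e⟩ ⟨f⟩; exact Quotient.sound (.assoc d e f)

/-- The morphism given by a diagram. -/
def ofDiag {X Y : Obj} (d : Diag R X Y) : (⟨X⟩ : FCat R) ⟶ ⟨Y⟩ := Quotient.mk _ d

theorem ofDiag_surjective {X Y : FCat R} (f : X ⟶ Y) : ∃ d, ofDiag d = f := Quotient.exists_rep f

theorem sound {X Y : Obj} {d e : Diag R X Y} (h : Equiv d e) : ofDiag d = ofDiag e :=
  Quotient.sound h

theorem exact {X Y : Obj} {d e : Diag R X Y} (h : ofDiag d = ofDiag e) : Equiv d e :=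
  Quotient.exact h

theorem ofDiag_cast {X X' Y Y' : Obj} (hX : X = X') (hY : Y = Y') (d : Diag R X Y) :
    ofDiag (d.cast hX hY) =
      eqToHom (congrArg FCat.mk hX.symm) ≫ ofDiag d ≫ eqToHom (congrArg FCat.mk hY) := by
  subst hX hY
  simp [Diag.cast]

/-- Parallel composition of objects. -/
@[reducible] def par (X Y : FCat R) : FCat R := ⟨Obj.par X.obj Y.obj⟩

theorem par_assoc (X Y Z : FCat R) : par (par X Y) Z = par X (par Y Z) :=
  congrArg FCat.mk (Obj.par_assoc X.obj Y.obj Z.obj)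

theorem empty_par (X : FCat R) : par ⟨.empty⟩ X = X := congrArg FCat.mk (Obj.empty_par X.obj)

/-- Parallel composition of morphisms. -/
def tensor {X Y X' Y' : FCat R} (f : X ⟶ Y) (g : X' ⟶ Y') : par X X' ⟶ par Y Y' :=
  Quotient.map₂ Diag.par (fun _ _ h _ _ k => Equiv.par h k) f g

theorem tensor_id_id (X Y : FCat R) : tensor (𝟙 X) (𝟙 Y) = 𝟙 (par X Y) :=
  sound (.id_par_id X.obj Y.obj)

theorem tensor_id_eqToHom (X : FCat R) {X' Y' : FCat R} (k : X' = Y') :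
    tensor (𝟙 X) (eqToHom k) = eqToHom (congrArg (par X) k) := by
  subst k
  exact tensor_id_id X X'

theorem tensor_eqToHom_id {X Y : FCat R} (h : X = Y) (X' : FCat R) :
    tensor (eqToHom h) (𝟙 X') = eqToHom (congrArg (par · X') h) := by
  subst h
  exact tensor_id_id X X'

theorem tensor_comp {X Y Z X' Y' Z' : FCat R} (f : X ⟶ Y) (g : Y ⟶ Z) (f' : X' ⟶ Y')
    (g' : Y' ⟶ Z') : tensor (f ≫ g) (f' ≫ g') = tensor f f' ≫ tensor g g' := by
  obtain ⟨d, rfl⟩ := ofDiag_surjective f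
  obtain ⟨e, rfl⟩ := ofDiag_surjective g
  obtain ⟨d', rfl⟩ := ofDiag_surjective f'
  obtain ⟨e', rfl⟩ := ofDiag_surjective g'
  exact sound (.interchange d e d' e')

theorem tensor_assoc {X Y X' Y' X'' Y'' : FCat R} (f : X ⟶ Y) (g : X' ⟶ Y') (h : X'' ⟶ Y'') :
    tensor (tensor f g) h ≫ eqToHom (par_assoc Y Y' Y'') =
      eqToHom (par_assoc X X' X'') ≫ tensor f (tensor g h) := by
  obtain ⟨d, rfl⟩ := ofDiag_surjective f
  obtain ⟨e, rfl⟩ := ofDiag_surjective g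
  obtain ⟨d', rfl⟩ := ofDiag_surjective h
  have := sound (.par_assoc d e d')
  rw [ofDiag_cast, eqToHom_comp_iff] at this
  exact this

theorem tensor_empty {X Y : FCat R} (f : X ⟶ Y) : tensor f (𝟙 (⟨.empty⟩ : FCat R)) = f := by
  obtain ⟨d, rfl⟩ := ofDiag_surjective f
  exact sound (.par_empty d)

theorem empty_tensor {X Y : FCat R} (f : X ⟶ Y) :
    tensor (𝟙 (⟨.empty⟩ : FCat R)) f ≫ eqToHom (empty_par Y) = eqToHom (empty_par X) ≫ f := by
  obtain ⟨d, rfl⟩ := ofDiag_surjective f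
  have := sound (.empty_par d)
  rw [ofDiag_cast, eqToHom_comp_iff] at this
  exact this

/-- `Obj.par` recurses on its right argument. Right unitors are therefore identities on the nose,
whereas left unitors and associators are transports along equalities of objects. -/
instance : MonoidalCategoryStruct (FCat R) where
  tensorObj X Y := par X Y
  whiskerLeft X _ _ f := tensor (𝟙 X) f
  whiskerRight f X := tensor f (𝟙 X)
  tensorHom f g := tensor f g
  tensorUnit := ⟨.empty⟩
  associator X Y Z := eqToIso (par_assoc X Y Z)
  leftUnitor X := eqToIso (empty_par X)
  rightUnitor X := Iso.refl X

instance : MonoidalCategory (FCat R) where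
  tensorHom_def f g := by
    refine Eq.trans ?_ (tensor_comp f (𝟙 _) (𝟙 _) g)
    rw [Category.comp_id, Category.id_comp]; rfl
  id_tensorHom_id X Y := tensor_id_id X Y
  tensorHom_comp_tensorHom f g f' g' := (tensor_comp f f' g g').symm
  whiskerLeft_id X Y := tensor_id_id X Y
  id_whiskerRight X Y := tensor_id_id X Y
  associator_naturality f g h := tensor_assoc f g h
  leftUnitor_naturality f := empty_tensor f
  rightUnitor_naturality f := by
    refine (Category.comp_id _).trans ((tensor_empty f).trans (Category.id_comp _).symm)
  pentagon X Y Z W := by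
    dsimp only [MonoidalCategoryStruct.associator, MonoidalCategoryStruct.whiskerLeft,
      MonoidalCategoryStruct.whiskerRight, MonoidalCategoryStruct.tensorObj, eqToIso]
    rw [tensor_id_eqToHom, tensor_eqToHom_id, eqToHom_trans, eqToHom_trans, eqToHom_trans]
  triangle X Y := by
    dsimp only [MonoidalCategoryStruct.associator, MonoidalCategoryStruct.whiskerLeft,
      MonoidalCategoryStruct.leftUnitor, MonoidalCategoryStruct.tensorUnit,
      MonoidalCategoryStruct.whiskerRight, MonoidalCategoryStruct.tensorObj, eqToIso]
    rw [tensor_id_eqToHom, eqToHom_trans]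
    exact (tensor_id_id X Y).symm

theorem ofDiag_par {X Y X' Y' : Obj} (d : Diag R X Y) (e : Diag R X' Y') :
    ofDiag (Diag.par d e) = ofDiag d ⊗ₘ ofDiag e := rfl

end FCat

namespace FCat

variable {R : Type u} [CommSemiring R]

/-! ### The symmetry -/

/-- A single wire. -/
@[reducible] def single (A : Color) : FCat R := ⟨wire A⟩

theorem obj_induction {P : FCat R → Prop} (h0 : P (𝟙_ _)) (h1 : ∀ X A, P X → P (X ⊗ single A))
    (X : FCat R) : P X := by
  obtain ⟨X⟩ := X
  induction X with
  | empty => exact h0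
  | snoc X A ih => exact h1 ⟨X⟩ A ih

/-- For a single wire in third position the two bracketings are definitionally equal and the
associator is an identity. This is how the strict axioms are matched with the categorical ones. -/
theorem assoc_single_comp {X Y Z : FCat R} {c : Color} (f : X ⊗ (Y ⊗ single c) ⟶ Z) :
    (α_ X Y (single c)).hom ≫ f = (f : (X ⊗ Y) ⊗ single c ⟶ Z) := Category.id_comp f

theorem assoc_inv_single_comp {X Y Z : FCat R} {c : Color} (f : (X ⊗ Y) ⊗ single c ⟶ Z) :
    (α_ X Y (single c)).inv ≫ f = (f : X ⊗ (Y ⊗ single c) ⟶ Z) := Category.id_comp f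

theorem comp_assoc_single {X Y Z : FCat R} {c : Color} (f : Z ⟶ (X ⊗ Y) ⊗ single c) :
    f ≫ (α_ X Y (single c)).hom = (f : Z ⟶ X ⊗ (Y ⊗ single c)) := Category.comp_id f

/-- The crossing of two wires. -/
def cross (A B : Color) : (single A ⊗ single B : FCat R) ⟶ single B ⊗ single A :=
  ofDiag (Diag.swap A B)

/-- A wire crossing an object. -/
def swapSingle (X : FCat R) (B : Color) : X ⊗ single B ⟶ single B ⊗ X :=
  ofDiag (Diag.swapWire X.obj B)

theorem cross_cross (A B : Color) : cross A B ≫ cross B A = 𝟙 (single A ⊗ single B : FCat R) :=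
  sound (.swap_swap A B)

theorem swapSingle_unit (B : Color) :
    swapSingle (𝟙_ (FCat R)) B = (λ_ _).hom ≫ (ρ_ _).inv := by
  refine Eq.trans ?_ (Category.comp_id (λ_ (single B)).hom).symm
  rfl

theorem swapSingle_tensor_single (X : FCat R) (A B : Color) :
    swapSingle (X ⊗ single A) B = (α_ _ _ _).hom ≫ X ◁ cross A B ≫ (α_ _ _ _).inv ≫
      swapSingle X B ▷ single A ≫ (α_ _ _ _).hom := by
  rw [assoc_single_comp, assoc_inv_single_comp, comp_assoc_single]
  rfl

theorem swapSingle_naturality {X Y : FCat R} (f : X ⟶ Y) (B : Color) :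
    f ▷ single B ≫ swapSingle Y B = swapSingle X B ≫ single B ◁ f := by
  obtain ⟨d, rfl⟩ := ofDiag_surjective f
  exact sound (.swap_natural d B)

theorem swapSingle_single (A B : Color) : swapSingle (single A : FCat R) B = cross A B := by
  have e : swapSingle (single A : FCat R) B = 𝟙_ _ ◁ cross A B ≫ 𝟙 (single B) ▷ single A := rfl
  have e' : 𝟙_ _ ◁ (cross A B : (_ : FCat R) ⟶ _) ≫ 𝟙 _ = 𝟙 _ ≫ cross A B :=
    leftUnitor_naturality (cross A B)
  rw [e, id_whiskerRight]
  exact e'.trans (Category.id_comp _)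

/-- One hexagon, proved by adding the wires of Y one at a time; the naturality law of the PROP
transports the equation along associators. -/
theorem swapSingle_tensor (X Y : FCat R) (B : Color) : swapSingle (X ⊗ Y) B =
    (α_ _ _ _).hom ≫ X ◁ swapSingle Y B ≫ (α_ _ _ _).inv ≫ swapSingle X B ▷ Y ≫
      (α_ _ _ _).hom := by
  induction Y using obj_induction with
  | h0 =>
    have h := swapSingle_naturality (ρ_ X).inv B
    rw [← cancel_epi ((ρ_ X).inv ▷ single B), h, swapSingle_unit]
    monoidal
  | h1 Y A ih =>
    have h := swapSingle_naturality (α_ X Y (single A)).inv B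
    rw [swapSingle_tensor_single (X ⊗ Y), ih] at h
    rw [← cancel_mono (single B ◁ (α_ X Y (single A)).inv), ← h, swapSingle_tensor_single Y]
    monoidal

/-- The symmetry of the category of diagrams. -/
def braid (X : FCat R) : (Y : Obj) → (X ⊗ ⟨Y⟩ ⟶ ⟨Y⟩ ⊗ X)
  | .empty => (ρ_ X).hom ≫ (λ_ X).inv
  | .snoc Y B => (α_ X ⟨Y⟩ (single B)).inv ≫ braid X Y ▷ single B ≫ (α_ ⟨Y⟩ X (single B)).hom ≫
      (⟨Y⟩ : FCat R) ◁ swapSingle X B ≫ (α_ ⟨Y⟩ (single B) X).inv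

theorem braid_tensor_single (X Y : FCat R) (B : Color) : braid X (Y ⊗ single B).obj =
    (α_ X Y (single B)).inv ≫ braid X Y.obj ▷ single B ≫ (α_ Y X (single B)).hom ≫
      Y ◁ swapSingle X B ≫ (α_ Y (single B) X).inv := rfl

theorem braid_unit (X : FCat R) : braid X (𝟙_ (FCat R)).obj = (ρ_ X).hom ≫ (λ_ X).inv := rfl

theorem braid_naturality {X X' : FCat R} (f : X ⟶ X') (Y : FCat R) :
    f ▷ Y ≫ braid X' Y.obj = braid X Y.obj ≫ Y ◁ f := by
  induction Y using obj_induction with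
  | h0 =>
    rw [braid_unit, braid_unit]
    simp
  | h1 Y A ih =>
    rw [braid_tensor_single, braid_tensor_single]
    have e1 : f ▷ (Y ⊗ single A) ≫ (α_ X' Y (single A)).inv ≫ braid X' Y.obj ▷ single A =
        (α_ X Y (single A)).inv ≫ (f ▷ Y ≫ braid X' Y.obj) ▷ single A := by monoidal
    have e2 : Y ◁ (swapSingle X A ≫ single A ◁ f) ≫ (α_ _ _ _).inv =
      Y ◁ swapSingle X A ≫ (α_ Y (single A) X).inv ≫ (Y ⊗ single A) ◁ f := by monoidal
    rw [reassoc_of% e1, ih, Category.assoc, Category.assoc, Category.assoc, Category.assoc, ← e2,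
      ← swapSingle_naturality]
    monoidal

theorem braid_tensor (X Y Z : FCat R) : braid X (Y ⊗ Z).obj = (α_ X Y Z).inv ≫
    braid X Y.obj ▷ Z ≫ (α_ Y X Z).hom ≫ Y ◁ braid X Z.obj ≫ (α_ Y Z X).inv := by
  -- `braid` recurses on a list, so rebracketing its second argument has to be undone by transport;
  -- the unitors and associators used below are instances of `eqToHom`.
  have nat {Y Y' : FCat R} (h : Y = Y') : braid X Y.obj =
      X ◁ eqToHom h ≫ braid X Y'.obj ≫ eqToHom h.symm ▷ X := by subst h; simp
  induction Z using obj_induction with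
  | h0 =>
    have e : braid X (Y ⊗ 𝟙_ _).obj = X ◁ (ρ_ Y).hom ≫ braid X Y.obj ≫ (ρ_ Y).inv ▷ X := nat rfl
    rw [e, braid_unit]
    monoidal
  | h1 Z A ih =>
    have e : braid X (Y ⊗ (Z ⊗ single A)).obj = X ◁ (α_ _ _ _).inv ≫
      braid X ((Y ⊗ Z) ⊗ single A).obj ≫ (α_ _ _ _).hom ▷ X := nat (par_assoc Y Z (single A)).symm
    rw [e, braid_tensor_single, ih, braid_tensor_single]
    monoidal

theorem tensor_braid (X Y Z : FCat R) : braid (X ⊗ Y) Z.obj = (α_ X Y Z).hom ≫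
    X ◁ braid Y Z.obj ≫ (α_ X Z Y).inv ≫ braid X Z.obj ▷ Y ≫ (α_ Z X Y).hom := by
  induction Z using obj_induction with
  | h0 =>
    rw [braid_unit, braid_unit, braid_unit]
    monoidal
  | h1 Z A ih =>
    rw [braid_tensor_single, braid_tensor_single, braid_tensor_single, ih, swapSingle_tensor]
    have e := whisker_exchange (braid X Z.obj) (swapSingle Y A)
    have e1 : (X ⊗ Z) ◁ swapSingle Y A = (α_ _ _ _).hom ≫ X ◁ Z ◁ swapSingle Y A ≫ (α_ _ _ _).inv := by simp
    trans (α_ (X ⊗ Y) Z (single A)).inv ≫ ((α_ X Y Z).hom ≫ X ◁ braid Y Z.obj ≫ (α_ X Z Y).inv) ▷ single A ≫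
      (α_ _ _ _).hom ≫ (braid X Z.obj ▷ (Y ⊗ single A) ≫ (Z ⊗ X) ◁ swapSingle Y A) ≫ (α_ _ _ _).hom ≫
      Z ◁ ((α_ X (single A) Y).inv ≫ swapSingle X A ▷ Y ≫ (α_ _ _ _).hom) ≫ (α_ _ _ _).inv
    · monoidal
    · rw [← e]
      monoidal

theorem swapSingle_braid (X : FCat R) (B : Color) :
    swapSingle X B ≫ braid (single B) X.obj = 𝟙 _ := by
  induction X using obj_induction with
  | h0 => rw [swapSingle_unit, braid_unit]; simp
  | h1 X A ih =>
    rw [swapSingle_tensor_single, braid_tensor_single, swapSingle_single]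
    have e : swapSingle X B ▷ single A ≫ braid (single B) X.obj ▷ single A = 𝟙 _ := by
      rw [← comp_whiskerRight, ih, id_whiskerRight]
    have e' : X ◁ cross A B ≫ X ◁ cross B A = 𝟙 _ := by
      rw [← MonoidalCategory.whiskerLeft_comp, cross_cross, MonoidalCategory.whiskerLeft_id]
    simp only [Category.assoc, Iso.hom_inv_id_assoc, reassoc_of% e, Iso.inv_hom_id_assoc,
      reassoc_of% e', Iso.hom_inv_id]

theorem unit_braid (X : FCat R) : braid (𝟙_ _) X.obj = (λ_ X).hom ≫ (ρ_ X).inv := by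
  induction X using obj_induction with
  | h0 => rw [braid_unit]; monoidal
  | h1 X A ih =>
    rw [braid_tensor_single, ih, swapSingle_unit]
    monoidal

theorem braid_braid (X Y : FCat R) : braid X Y.obj ≫ braid Y X.obj = 𝟙 _ := by
  induction Y using obj_induction with
  | h0 =>
    rw [braid_unit, unit_braid]
    simp
  | h1 Y A ih =>
    rw [braid_tensor_single, tensor_braid]
    have e : braid X Y.obj ▷ single A ≫ braid Y X.obj ▷ single A = 𝟙 _ := by
      rw [← comp_whiskerRight, ih, id_whiskerRight]
    have e' : Y ◁ swapSingle X A ≫ Y ◁ braid (single A) X.obj = 𝟙 _ := by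
      rw [← MonoidalCategory.whiskerLeft_comp, swapSingle_braid, MonoidalCategory.whiskerLeft_id]
    simp only [Category.assoc, Iso.inv_hom_id_assoc, reassoc_of% e', Iso.hom_inv_id_assoc,
      reassoc_of% e, Iso.inv_hom_id]

instance : SymmetricCategory (FCat R) where
  braiding X Y := ⟨braid X Y.obj, braid Y X.obj, braid_braid X Y, braid_braid Y X⟩
  braiding_naturality_right X Y Z f := by
    have h : f ▷ X ≫ braid Z X.obj ≫ braid X Z.obj = braid Y X.obj ≫ X ◁ f ≫ braid X Z.obj := by
      rw [← Category.assoc, braid_naturality, Category.assoc]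
    rw [braid_braid, Category.comp_id] at h
    dsimp only
    rw [h, ← Category.assoc, braid_braid, Category.id_comp]
  braiding_naturality_left f Z := braid_naturality f Z
  hexagon_forward X Y Z := by
    dsimp only
    rw [braid_tensor]
    simp
  hexagon_reverse X Y Z := by
    dsimp only
    rw [tensor_braid]
    simp
  symmetry X Y := braid_braid X Y

end FCat

variable {R : Type u} [CommSemiring R]

theorem Diag.mirror_mirror {X Y : Obj} (d : Diag R X Y) : d.mirror.mirror = d := by
  induction d with
  | comp d e hd he => rw [Diag.mirror, Diag.mirror, hd, he]
  | par d e hd he => rw [Diag.mirror, Diag.mirror, hd, he]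
  | _ => rfl

theorem Diag.mirror_cast {X X' Y Y' : Obj} (hX : X = X') (hY : Y = Y') (d : Diag R X Y) :
    (d.cast hX hY).mirror = d.mirror.cast hY hX := by
  subst hX hY
  rfl

namespace FCat

/-! ### The dagger -/

/-- Mirroring a wire that crosses X yields the crossing in the opposite direction, built by a
different recursion. The comparison is needed to mirror the naturality law. -/
theorem mirror_swapWire (X : Obj) (B : Color) :
    ofDiag (Diag.swapWire (R := R) X B).mirror = braid (single B) X := by
  induction X with
  | empty =>
    have e : ofDiag (Diag.swapWire (R := R) .empty B).mirror = 𝟙 (single B) := rfl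
    have e' : braid (R := R) (single B) .empty = (ρ_ _).hom ≫ (λ_ _).inv := rfl
    rw [e, e']
    exact (Category.comp_id (ρ_ (single B : FCat R)).hom).symm
  | snoc X A ih =>
    have e := braid_tensor_single (R := R) (single B) ⟨X⟩ A
    rw [swapSingle_single, ← ih] at e
    erw [assoc_inv_single_comp, assoc_single_comp, Category.comp_id] at e
    exact e.symm

/-- All rules mirror to rules directly, except naturality of the crossing. Its mirror is naturality
in the other variable, which follows once the category is known to be symmetric. -/
theorem mirror_sound {X Y : Obj} {d e : Diag R X Y} (h : Equiv d e) :
    Equiv d.mirror e.mirror := by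
  induction h with
  | refl d => exact .refl _
  | symm _ ih => exact .symm ih
  | trans _ _ ih1 ih2 => exact .trans ih1 ih2
  | comp _ _ ih1 ih2 => exact .comp ih2 ih1
  | par _ _ ih1 ih2 => exact .par ih1 ih2
  | id_comp d => exact .comp_id _
  | comp_id d => exact .id_comp _
  | assoc d e f => exact .symm (.assoc _ _ _)
  | id_par_id X Y => exact .id_par_id X Y
  | interchange d e d' e' => exact .interchange _ _ _ _
  | par_empty d => exact .par_empty _
  | empty_par d => rw [Diag.mirror_cast]; exact .empty_par _
  | par_assoc d e f => rw [Diag.mirror_cast]; exact .par_assoc _ _ _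
  | swap_swap A B => exact .swap_swap A B
  | swap_natural d B =>
    rename_i X Y
    have h := BraidedCategory.braiding_naturality_right (single B : FCat R) (ofDiag d.mirror)
    have e1 : ofDiag (Diag.swapWire X B).mirror = (β_ (single B : FCat R) ⟨X⟩).hom :=
      mirror_swapWire X B
    have e2 : ofDiag (Diag.swapWire Y B).mirror = (β_ (single B : FCat R) ⟨Y⟩).hom :=
      mirror_swapWire Y B
    rw [← e1, ← e2] at h
    exact FCat.exact h.symm
  | ax h => exact .ax_mirror h
  | ax_mirror h => rw [Diag.mirror_mirror, Diag.mirror_mirror]; exact .ax h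

/-- The mirror image of a morphism. -/
def dag {X Y : FCat R} (f : X ⟶ Y) : Y ⟶ X :=
  Quotient.map (sb := setoid (R := R) Y.obj X.obj) Diag.mirror (fun _ _ h => mirror_sound h) f

theorem dag_dag {X Y : FCat R} (f : X ⟶ Y) : dag (dag f) = f := by
  obtain ⟨d, rfl⟩ := ofDiag_surjective f
  exact congrArg ofDiag d.mirror_mirror

theorem dag_id (X : FCat R) : dag (𝟙 X) = 𝟙 X := rfl

theorem dag_comp {X Y Z : FCat R} (f : X ⟶ Y) (g : Y ⟶ Z) : dag (f ≫ g) = dag g ≫ dag f := by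
  obtain ⟨d, rfl⟩ := ofDiag_surjective f
  obtain ⟨e, rfl⟩ := ofDiag_surjective g
  rfl

theorem dag_tensor {X Y X' Y' : FCat R} (f : X ⟶ Y) (g : X' ⟶ Y') :
    dag (f ⊗ₘ g) = dag f ⊗ₘ dag g := by
  obtain ⟨d, rfl⟩ := ofDiag_surjective f
  obtain ⟨e, rfl⟩ := ofDiag_surjective g
  rfl

theorem dag_eqToHom {X Y : FCat R} (h : X = Y) : dag (eqToHom h) = eqToHom h.symm := by
  subst h
  rfl

theorem dag_braid (X Y : FCat R) : dag (braid X Y.obj) = braid Y X.obj := by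
  induction Y using obj_induction with
  | h0 =>
    rw [braid_unit, unit_braid, dag_comp]
    congr 1
    exact dag_eqToHom (empty_par X).symm
  | h1 Y A ih =>
    have e : dag (swapSingle X A) = braid (single A) X.obj := mirror_swapWire X.obj A
    have e1 {X Y X' : FCat R} (f : X ⟶ Y) : dag (X' ◁ f) = X' ◁ dag f := by
      rw [← id_tensorHom, dag_tensor, dag_id, id_tensorHom]
    have e2 {X Y X' : FCat R} (f : X ⟶ Y) : dag (f ▷ X') = dag f ▷ X' := by
      rw [← tensorHom_id, dag_tensor, dag_id, tensorHom_id]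
    have e3 (X Y Z : FCat R) : dag (α_ X Y Z).hom = (α_ X Y Z).inv := dag_eqToHom (par_assoc X Y Z)
    have e4 (X Y Z : FCat R) : dag (α_ X Y Z).inv = (α_ X Y Z).hom :=
      dag_eqToHom (par_assoc X Y Z).symm
    rw [braid_tensor_single, tensor_braid]
    simp only [dag_comp, e, e1, e2, e3, e4, ih, Category.assoc]

/-! ### Null morphisms -/

/-- The null state of an object. -/
def nullDiag : (X : Obj) → Diag R .empty X
  | .empty => Diag.id .empty
  | .snoc X A => Diag.par (nullDiag X) (Diag.null A)

/-- The null state of an object, as a morphism. -/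
def nul (X : FCat R) : 𝟙_ (FCat R) ⟶ X := ofDiag (nullDiag X.obj)

theorem nul_tensor_single (X : FCat R) (A : Color) :
    nul (X ⊗ single A) = (ρ_ _).inv ≫ (nul X ⊗ₘ ofDiag (Diag.null A)) :=
  (Category.id_comp (nul X ⊗ₘ ofDiag (Diag.null A))).symm

theorem nul_unit : nul (𝟙_ (FCat R)) = 𝟙 _ := rfl

theorem nul_single (A : Color) : nul (single A : FCat R) = ofDiag (Diag.null A) := by
  have h : 𝟙_ (FCat R) ◁ ofDiag (Diag.null A) ≫ 𝟙 _ = 𝟙 _ ≫ ofDiag (Diag.null A) :=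
    leftUnitor_naturality (ofDiag (R := R) (Diag.null A))
  rw [Category.comp_id] at h
  exact h.trans (Category.id_comp _)

theorem nul_pair (A B : Color) : nul (single A ⊗ single B : FCat R) =
    ofDiag (Diag.par (Diag.null A) (Diag.null B)) := by
  have h := nul_tensor_single (R := R) (single A) B
  rw [nul_single] at h
  exact h.trans (Category.id_comp _)

theorem nul_tensor (X Y : FCat R) : nul (X ⊗ Y) = (ρ_ _).inv ≫ (nul X ⊗ₘ nul Y) := by
  have nat {Y Y' : FCat R} (h : Y = Y') : nul Y ≫ eqToHom h = nul Y' := by subst h; simp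
  induction Y using obj_induction with
  | h0 =>
    have e : nul X ≫ (ρ_ X).inv = nul (X ⊗ 𝟙_ _) := nat rfl
    rw [nul_unit, ← e]
    simp
  | h1 Y A ih =>
    have e : nul ((X ⊗ Y) ⊗ single A) ≫ (α_ _ _ _).hom = nul (X ⊗ (Y ⊗ single A)) := nat (par_assoc _ _ _)
    rw [← e, nul_tensor_single, nul_tensor_single, ih]
    simp only [MonoidalCategory.tensorHom_def]
    monoidal

theorem braid_single_single (A B : Color) : braid (single A : FCat R) (single B : FCat R).obj = cross A B := by
  have h := swapSingle_braid (R := R) (single B) A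
  rw [swapSingle_single] at h
  rw [← Category.id_comp (braid (single A) _), ← cross_cross, Category.assoc, h, Category.comp_id]

theorem nul_comp_of_equiv {X Y : Obj} {d : Diag R X Y} {z : Diag R .empty X} {z' : Diag R .empty Y}
    (hz : nul ⟨X⟩ = ofDiag z) (hz' : nul ⟨Y⟩ = ofDiag z') (h : Equiv (.comp z d) z') :
    nul ⟨X⟩ ≫ ofDiag d = nul ⟨Y⟩ := by
  rw [hz, hz']
  exact sound h

/-- Every diagram sends null to null, so the empty object is initial, and by mirroring also
terminal. The null axioms treat most generators; for T and P the null input is rewritten as T° or P°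
of a null, and for C the unit law is used. -/
theorem nul_comp_diag {X Y : Obj} (d : Diag R X Y) : nul ⟨X⟩ ≫ ofDiag d = nul ⟨Y⟩ := by
  induction d with
  | id X => exact Category.comp_id _
  | swap A B =>
    refine nul_comp_of_equiv (nul_pair A B) (nul_pair B A) (exact ?_)
    have h := BraidedCategory.braiding_naturality (ofDiag (R := R) (Diag.null A))
      (ofDiag (R := R) (Diag.null B))
    have e : (β_ (single A : FCat R) (single B)).hom = cross A B := braid_single_single A B
    have e' : (β_ (𝟙_ (FCat R)) (𝟙_ _)).hom = 𝟙 _ := Category.comp_id (𝟙 (𝟙_ (FCat R)))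
    erw [e, e', Category.id_comp] at h
    exact h
  | tensor A B =>
    exact nul_comp_of_equiv (nul_pair A B) (nul_single _)
      ((Equiv.comp (.symm (.ax (.null_tensor A B))) (.refl _)).trans <| (Equiv.assoc _ _ _).trans <|
        (Equiv.comp (.refl _) (.ax (.tensor_tensor A B))).trans (.comp_id _))
  | tensorInv A B => exact nul_comp_of_equiv (nul_single _) (nul_pair A B) (.ax (.null_tensor A B))
  | plus A B =>
    exact nul_comp_of_equiv (nul_pair A B) (nul_single _)
      ((Equiv.comp (.symm (.ax (.null_plus A B))) (.refl _)).trans <| (Equiv.assoc _ _ _).trans <|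
        (Equiv.comp (.refl _) (.ax (.plus_plus A B))).trans (.comp_id _))
  | plusInv A B => exact nul_comp_of_equiv (nul_single _) (nul_pair A B) (.ax (.null_plus A B))
  | contr A =>
    have h : Equiv (.par (.null A) (.null A) : Diag R _ _)
        (.comp (.null A) (.par (.id (wire A)) (.null A))) :=
      (Equiv.par (.symm (.comp_id _)) (.symm (.id_comp _))).trans <|
        (Equiv.interchange _ _ _ _).trans (Equiv.comp (.par_empty _) (.refl _))
    exact nul_comp_of_equiv (nul_pair A A) (nul_single _)
      ((Equiv.comp h (.refl _)).trans <| (Equiv.assoc _ _ _).trans <|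
        (Equiv.comp (.refl _) (.ax (.contr_unit A))).trans (.comp_id _))
  | contrInv A => exact nul_comp_of_equiv (nul_single _) (nul_pair A A) (.ax (.null_contr A))
  | null A => exact (Category.id_comp _).trans (nul_single A).symm
  | nullInv A => exact nul_comp_of_equiv (nul_single _) nul_unit (.ax (.null_null A))
  | adapter h => exact nul_comp_of_equiv (nul_single _) (nul_single _) (.ax (.null_adapter h))
  | scalar s A => exact nul_comp_of_equiv (nul_single _) (nul_single _) (.ax (.null_scalar s A))
  | comp d e hd he =>
    refine (Category.assoc (nul _) (ofDiag d) (ofDiag e)).symm.trans ?_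
    rw [hd, he]
  | par d e hd he =>
    rename_i X Y X' Y'
    have h := nul_tensor (R := R) ⟨X⟩ ⟨X'⟩
    have h' := nul_tensor (R := R) ⟨Y⟩ ⟨Y'⟩
    rw [← hd, ← he, ← tensorHom_comp_tensorHom, ← Category.assoc, ← h] at h'
    exact h'.symm

theorem nul_comp {X Y : FCat R} (f : X ⟶ Y) : nul X ≫ f = nul Y := by
  obtain ⟨d, rfl⟩ := ofDiag_surjective f
  exact nul_comp_diag d

theorem comp_dag_nul {X Y : FCat R} (f : X ⟶ Y) : f ≫ dag (nul Y) = dag (nul X) := by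
  rw [← nul_comp (dag f), dag_comp, dag_dag]

/-- Zero is the composite through the empty object: discard everything, then create nulls. -/
instance : HasZeroMorphisms (FCat R) where
  zero X Y := ⟨dag (nul X) ≫ nul Y⟩
  comp_zero f Z := by
    change f ≫ dag (nul _) ≫ nul Z = dag (nul _) ≫ nul Z
    rw [← Category.assoc, comp_dag_nul]
  zero_comp X _ _ f := by
    change (dag (nul X) ≫ nul _) ≫ f = dag (nul _) ≫ nul _
    rw [Category.assoc, nul_comp]

theorem isZero_unit : IsZero (𝟙_ (FCat R)) := by
  rw [IsZero.iff_id_eq_zero]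
  exact (Category.comp_id (𝟙 (𝟙_ (FCat R)))).symm

theorem null_comp_null (A B : Color) : ofDiag (.comp (.nullInv A) (.null B) : Diag R _ _) = 0 := by
  have h : ofDiag (.null B : Diag R _ _) = 0 := isZero_unit.eq_of_src _ _
  refine (congrArg (ofDiag (.nullInv A) ≫ ·) h).trans comp_zero

theorem tensorμ_single (A B C D : Color) :
    tensorμ (single A : FCat R) (single B) (single C) (single D) =
      ofDiag (.par (.par (.id (wire A)) (.swap B C)) (.id (wire D))) := by
  have e : (β_ (single B : FCat R) (single C)).hom = cross B C := braid_single_single B C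
  have e1 : (α_ (single A : FCat R) (single B) (single C ⊗ single D)).hom = 𝟙 _ := rfl
  have e2 : (α_ (single B : FCat R) (single C) (single D)).inv = 𝟙 _ := rfl
  have e3 : (α_ (single C : FCat R) (single B) (single D)).hom = 𝟙 _ := rfl
  have e4 : (α_ (single A : FCat R) (single C) (single B ⊗ single D)).inv = 𝟙 _ := rfl
  rw [tensorμ, e, e1, e2, e3, e4]
  erw [MonoidalCategory.whiskerLeft_id, Category.comp_id, Category.id_comp, Category.id_comp,
    MonoidalCategory.whiskerLeft_id, Category.comp_id]
  exact (sound (.par_assoc (.id (wire A)) (.swap B C) (.id (wire D)))).symm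

end FCat

/-! ### Diagrams as a model of the calculus -/

namespace FCat

variable (R : Type u) [CommSemiring R]

theorem null_eq_zero (A : Color) : ofDiag (.null A : Diag R _ _) = (0 : 𝟙_ (FCat R) ⟶ single A) :=
  isZero_unit.eq_of_src _ _

theorem nullInv_eq_zero (A : Color) :
    ofDiag (.nullInv A : Diag R _ _) = (0 : single A ⟶ 𝟙_ (FCat R)) :=
  isZero_unit.eq_of_tgt _ _

/-- The diagrams form a model of the calculus. -/
@[reducible] def calculus : Calculus R (FCat R) where
  dag := dag
  dag_dag := dag_dag
  dag_id := dag_id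
  dag_comp := dag_comp
  dag_tensor := dag_tensor
  dag_assoc X Y Z := dag_eqToHom (par_assoc X Y Z)
  dag_left X := dag_eqToHom (empty_par X)
  dag_right X := dag_id X
  dag_braid := dag_braid
  isZero_unit := isZero_unit
  w := single
  T a b := ofDiag (.tensor a b)
  P a b := ofDiag (.plus a b)
  Cn a := ofDiag (.contr a)
  M h := ofDiag (.adapter h)
  s r a := ofDiag (.scalar r a)
  dag_M _ := rfl
  dag_s _ _ := rfl
  tensor_tensor a b := sound (.ax (.tensor_tensor a b))
  plus_plus a b := sound (.ax (.plus_plus a b))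
  tensor_plus a b := (sound (.ax (.tensor_plus a b))).trans (null_comp_null _ _)
  id_zero := (sound (.ax .id_zero)).trans (null_comp_null _ _)
  swap_contr a := (congrArg (· ≫ ofDiag (.contr a)) (braid_single_single a a)).trans
    (sound (.ax (.swap_contr a)))
  n_tensor a b c h := by
    rw [assoc_single_comp]
    exact sound (.ax (.n_tensor a b c h))
  x_plus a b h k := by
    have e (f : (single .one ⊗ single .one : FCat R) ⟶ single .one ⊗ single .one) :
        (α_ (single a) (single .one) (single .one ⊗ single b)).hom ≫ single a ◁
          ((α_ (single .one) (single .one) (single b)).inv ≫ f ▷ single b ≫ (α_ _ _ _).hom) ≫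
            (α_ _ _ _).inv = (single a ◁ f) ▷ single b := by
      have h := associator_naturality_middle (single a) f (single b)
      rw [comp_assoc_single, assoc_single_comp] at h
      rw [comp_assoc_single, assoc_inv_single_comp]
      exact (Category.id_comp _).trans ((Category.comp_id _).trans h.symm)
    rw [reassoc_of% e]
    exact sound (.ax (.x_plus a b h k))
  plus_contr a b ha hb h := by
    rw [tensorμ_single]
    exact sound (.ax (.plus_contr a b ha hb h))
  mix a b := by
    rw [tensorμ_single, tensorμ_single]
    exact (sound (.ax (.mix a b))).trans (tensor_id_id (single a) (single b))
  contr_unit a := by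
    rw [← null_eq_zero]
    exact (Category.id_comp _).trans (sound (.ax (.contr_unit a)))
  contr_tensorInv a b := by
    rw [tensorμ_single]
    exact sound (.ax (.contr_tensorInv a b))
  contr_tensor a b := by
    have e : 𝟙 (single a ⊗ single a : FCat R) = 𝟙 (single a) ⊗ₘ 𝟙 (single a) :=
      (tensor_id_id _ _).symm
    rw [tensorμ_single, ← id_tensorHom, e]
    exact sound (.ax (.contr_tensor a b))
  contr_plusInv a b := by
    rw [tensorμ_single]
    exact sound (.ax (.contr_plusInv a b))
  contr_plusPlus a b := by
    have e : (β_ (single a : FCat R) (single b)).hom = cross a b := braid_single_single a b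
    have e' : (β_ (single b : FCat R) (single a)).hom = cross b a := braid_single_single b a
    rw [e, e', assoc_single_comp, assoc_inv_single_comp, assoc_single_comp, assoc_inv_single_comp]
    exact sound (.ax (.contr_plusPlus a b))
  contr_contrInv a := by
    rw [tensorμ_single]
    exact sound (.ax (.contr_contrInv a))
  contr_assoc a := by
    rw [assoc_single_comp]
    exact sound (.ax (.contr_assoc a))
  contr_scalar r a := sound (.ax (.contr_scalar r a))
  contr_adapter h := sound (.ax (.contr_adapter h))
  assoc_tensor a b c h := by
    rw [comp_assoc_single]
    exact sound (.ax (.assoc_tensor a b c h))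
  assoc_plus a b c h := by
    rw [comp_assoc_single]
    exact sound (.ax (.assoc_plus a b c h))
  adapter_tensor h k hk := sound (.ax (.adapter_tensor h k hk))
  adapter_plus h k hk := sound (.ax (.adapter_plus h k hk))
  unit_tensor a h k := by
    have e : (β_ (single a : FCat R) (single .one)).hom = cross a .one := braid_single_single a .one
    rw [e]
    exact sound (.ax (.unit_tensor a h k))
  plus_zero a h := by
    rw [← nullInv_eq_zero]
    exact (sound (.ax (.plus_zero a h))).trans (Category.comp_id _).symm
  zero_plus a h := by
    rw [← nullInv_eq_zero]
    exact (sound (.ax (.zero_plus a h))).trans (Category.comp_id _).symm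
  M_M h k := sound (.ax (.adapter_adapter h k))
  M_id a h := sound (.ax (.adapter_id a h))
  s_one a := sound (.ax (.scalar_one a))
  s_zero a := (sound (.ax (.scalar_zero a))).trans (null_comp_null _ _)
  s_add r t a := sound (.ax (.scalar_add r t a))
  s_tensor r t a b := sound (.ax (.scalar_tensor r t a b))
  s_M r _ _ h := sound (.ax (.scalar_adapter r h))

end FCat

/-! ### The associator of `|` through its seven components -/

section

variable {H : Type v'} [Category.{w'} H] [MonoidalCategory H] [SymmetricCategory H]
  [HasZeroMorphisms H] [HasZeroObject H] [HasBinaryBiproducts H] [Distributive H]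

theorem distL_hom (X Y Z : H) :
    (distL X Y Z).hom = biprod.lift (X ◁ biprod.fst) (X ◁ biprod.snd) := rfl

theorem distL_hom_ext {X Y Z W : H} {f g : W ⟶ X ⊗ (Y ⊞ Z)}
    (h1 : f ≫ X ◁ biprod.fst = g ≫ X ◁ biprod.fst)
    (h2 : f ≫ X ◁ biprod.snd = g ≫ X ◁ biprod.snd) : f = g := by
  rw [← cancel_mono (distL X Y Z).hom, distL_hom]
  apply biprod.hom_ext <;> simpa

theorem distL_inv_fst (X Y Z : H) : (distL X Y Z).inv ≫ X ◁ biprod.fst = biprod.fst := by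
  rw [Iso.inv_comp_eq, distL_hom, biprod.lift_fst]

theorem distL_inv_snd (X Y Z : H) : (distL X Y Z).inv ≫ X ◁ biprod.snd = biprod.snd := by
  rw [Iso.inv_comp_eq, distL_hom, biprod.lift_snd]

/-- By distributivity K | (L | M) is a biproduct of seven terms, whose projections are jointly
monic. -/
theorem vbar_hom_ext {K L M Z : H} {f g : Z ⟶ vbar K (vbar L M)}
    (h1 : f ≫ biprod.fst ≫ K ◁ biprod.fst = g ≫ biprod.fst ≫ K ◁ biprod.fst)
    (h2 : f ≫ biprod.fst ≫ K ◁ (biprod.snd ≫ biprod.fst) =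
      g ≫ biprod.fst ≫ K ◁ (biprod.snd ≫ biprod.fst))
    (h3 : f ≫ biprod.fst ≫ K ◁ (biprod.snd ≫ biprod.snd) =
      g ≫ biprod.fst ≫ K ◁ (biprod.snd ≫ biprod.snd))
    (h4 : f ≫ biprod.snd ≫ biprod.snd ≫ biprod.fst = g ≫ biprod.snd ≫ biprod.snd ≫ biprod.fst)
    (h5 : f ≫ biprod.snd ≫ biprod.snd ≫ biprod.snd ≫ biprod.fst =
      g ≫ biprod.snd ≫ biprod.snd ≫ biprod.snd ≫ biprod.fst)
    (h6 : f ≫ biprod.snd ≫ biprod.snd ≫ biprod.snd ≫ biprod.snd =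
      g ≫ biprod.snd ≫ biprod.snd ≫ biprod.snd ≫ biprod.snd)
    (h7 : f ≫ biprod.snd ≫ biprod.fst = g ≫ biprod.snd ≫ biprod.fst) : f = g := by
  apply biprod.hom_ext
  · apply distL_hom_ext
    · simpa using h1
    · apply distL_hom_ext
      · simpa using h2
      · simpa using h3
  · apply biprod.hom_ext
    · simpa using h7
    · apply biprod.hom_ext
      · simpa using h4
      · apply biprod.hom_ext
        · simpa using h5
        · simpa using h6

section

variable (K L M : H)

/-- This and the six lemmas that follow compute the associator on the seven projections; they are
the semantic forms of the seven hypotheses of `dec_assoc`. -/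
theorem vbarAssoc_hom_one : (vbarAssoc K L M).hom ≫ biprod.fst ≫ K ◁ biprod.fst =
    biprod.fst ≫ biprod.fst ▷ M ≫ (α_ K L M).hom := by
  simp [vbarAssoc, rearrange, distL_inv_fst, distR_hom]

theorem vbarAssoc_hom_two : (vbarAssoc K L M).hom ≫ biprod.fst ≫ K ◁ (biprod.snd ≫ biprod.fst) =
    biprod.snd ≫ biprod.fst ≫ biprod.fst := by
  simp [vbarAssoc, rearrange, distL_inv_fst, reassoc_of% distL_inv_snd, distR_hom]

theorem vbarAssoc_hom_three : (vbarAssoc K L M).hom ≫ biprod.fst ≫ K ◁ (biprod.snd ≫ biprod.snd) =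
    biprod.fst ≫ (biprod.snd ≫ biprod.fst) ▷ M := by
  simp [vbarAssoc, rearrange, distL_inv_snd, reassoc_of% distL_inv_snd, distR_hom]

theorem vbarAssoc_hom_four : (vbarAssoc K L M).hom ≫ biprod.snd ≫ biprod.snd ≫ biprod.fst =
    biprod.fst ≫ (biprod.snd ≫ biprod.snd) ▷ M := by
  simp [vbarAssoc, rearrange, distR_hom]

theorem vbarAssoc_hom_five :
    (vbarAssoc K L M).hom ≫ biprod.snd ≫ biprod.snd ≫ biprod.snd ≫ biprod.fst =
      biprod.snd ≫ biprod.fst ≫ biprod.snd ≫ biprod.snd := by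
  simp [vbarAssoc, rearrange]

theorem vbarAssoc_hom_six :
    (vbarAssoc K L M).hom ≫ biprod.snd ≫ biprod.snd ≫ biprod.snd ≫ biprod.snd =
      biprod.snd ≫ biprod.snd := by
  simp [vbarAssoc, rearrange]

theorem vbarAssoc_hom_seven : (vbarAssoc K L M).hom ≫ biprod.snd ≫ biprod.fst =
    biprod.snd ≫ biprod.fst ≫ biprod.snd ≫ biprod.fst := by
  simp [vbarAssoc, rearrange]

end

theorem vbarMap_id (K L : H) : vbarMap (𝟙 K) (𝟙 L) = 𝟙 (vbar K L) := by
  have : biprod.map (𝟙 K) (𝟙 L) = 𝟙 (K ⊞ L) := by apply biprod.hom_ext <;> simp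
  apply biprod.hom_ext' <;> simp [this]

theorem vbarMap_comp {K L K' L' K'' L'' : H} (f : K ⟶ K') (g : L ⟶ L') (f' : K' ⟶ K'')
    (g' : L' ⟶ L'') : vbarMap f g ≫ vbarMap f' g' = vbarMap (f ≫ f') (g ≫ g') := by
  apply biprod.hom_ext <;> simp
  apply biprod.hom_ext <;> simp

theorem vbarAssoc_naturality {K L M K' L' M' : H} (f : K ⟶ K') (g : L ⟶ L') (k : M ⟶ M') :
    vbarMap (vbarMap f g) k ≫ (vbarAssoc K' L' M').hom =
      (vbarAssoc K L M).hom ≫ vbarMap f (vbarMap g k) := by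
  have t {X Y Z : H} (p : X ⟶ Y) (q : Y ⟶ Z) : (f ⊗ₘ p) ≫ K' ◁ q = K ◁ (p ≫ q) ≫ f ▷ Z := by
    rw [MonoidalCategory.tensorHom_def', Category.assoc, ← whisker_exchange,
      ← MonoidalCategory.whiskerLeft_comp_assoc]
  have t' {X Y Z : H} (p : X ⟶ Y) (q : Y ⟶ Z) : (p ⊗ₘ k) ≫ q ▷ M' = (p ≫ q) ▷ M ≫ Z ◁ k := by
    rw [MonoidalCategory.tensorHom_def, Category.assoc, whisker_exchange, comp_whiskerRight_assoc]
  apply vbar_hom_ext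
  · have r : vbarMap f (vbarMap g k) ≫ biprod.fst ≫ K' ◁ biprod.fst =
        (biprod.fst ≫ K ◁ biprod.fst) ≫ (f ⊗ₘ (g ⊗ₘ k)) := by
      rw [biprod.map_fst_assoc, t, biprod.map_fst]; simp [MonoidalCategory.tensorHom_def']
    rw [Category.assoc, Category.assoc, vbarAssoc_hom_one, r, ← Category.assoc (vbarAssoc K L M).hom, vbarAssoc_hom_one,
      Category.assoc, Category.assoc, ← associator_naturality, biprod.map_fst_assoc, reassoc_of% t', biprod.map_fst]
    simp [MonoidalCategory.tensorHom_def]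
  · have r : vbarMap f (vbarMap g k) ≫ biprod.fst ≫ K' ◁ (biprod.snd ≫ biprod.fst) =
        (biprod.fst ≫ K ◁ (biprod.snd ≫ biprod.fst)) ≫ (f ⊗ₘ g) := by
      rw [biprod.map_fst_assoc, t, biprod.map_snd_assoc, biprod.map_fst]
      simp [MonoidalCategory.tensorHom_def']
    rw [Category.assoc, Category.assoc, vbarAssoc_hom_two, r, ← Category.assoc (vbarAssoc K L M).hom, vbarAssoc_hom_two]
    simp
  · have r : vbarMap f (vbarMap g k) ≫ biprod.fst ≫ K' ◁ (biprod.snd ≫ biprod.snd) =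
        (biprod.fst ≫ K ◁ (biprod.snd ≫ biprod.snd)) ≫ (f ⊗ₘ k) := by
      rw [biprod.map_fst_assoc, t, biprod.map_snd_assoc, biprod.map_snd]
      simp [MonoidalCategory.tensorHom_def']
    rw [Category.assoc, Category.assoc, vbarAssoc_hom_three, r,
      ← Category.assoc (vbarAssoc K L M).hom, vbarAssoc_hom_three, biprod.map_fst_assoc, t', biprod.map_snd_assoc,
      biprod.map_fst]
    simp [MonoidalCategory.tensorHom_def]
  · have r : vbarMap f (vbarMap g k) ≫ biprod.snd ≫ biprod.snd ≫ biprod.fst =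
        (biprod.snd ≫ biprod.snd ≫ biprod.fst) ≫ (g ⊗ₘ k) := by simp
    rw [Category.assoc, Category.assoc, vbarAssoc_hom_four, r,
      ← Category.assoc (vbarAssoc K L M).hom, vbarAssoc_hom_four, biprod.map_fst_assoc, t', biprod.map_snd_assoc,
      biprod.map_snd]
    simp [MonoidalCategory.tensorHom_def]
  · have r : vbarMap f (vbarMap g k) ≫ biprod.snd ≫ biprod.snd ≫ biprod.snd ≫ biprod.fst =
        (biprod.snd ≫ biprod.snd ≫ biprod.snd ≫ biprod.fst) ≫ g := by simp
    rw [Category.assoc, Category.assoc, vbarAssoc_hom_five, r,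
      ← Category.assoc (vbarAssoc K L M).hom, vbarAssoc_hom_five]
    simp
  · have r : vbarMap f (vbarMap g k) ≫ biprod.snd ≫ biprod.snd ≫ biprod.snd ≫ biprod.snd =
        (biprod.snd ≫ biprod.snd ≫ biprod.snd ≫ biprod.snd) ≫ k := by simp
    rw [Category.assoc, Category.assoc, vbarAssoc_hom_six, r, ← Category.assoc (vbarAssoc K L M).hom, vbarAssoc_hom_six]
    simp
  · have r : vbarMap f (vbarMap g k) ≫ biprod.snd ≫ biprod.fst =
        (biprod.snd ≫ biprod.fst) ≫ f := by simp
    rw [Category.assoc, Category.assoc, vbarAssoc_hom_seven, r,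
      ← Category.assoc (vbarAssoc K L M).hom, vbarAssoc_hom_seven]
    simp

end

/-! ### Semantic counterparts of the encoded structure, and associativity of decoding -/

namespace Calculus

attribute [local instance] SemiadditiveOfBinaryBiproducts.addCommMonoidHomOfHasBinaryBiproducts

variable {R : Type u} [CommSemiring R] {C : Type v} [Category.{w} C] [MonoidalCategory C]
  [SymmetricCategory C] [HasZeroMorphisms C] {K : Calculus R C}
  {H : Type v'} [Category.{w'} H] [MonoidalCategory H] [SymmetricCategory H]
  [HasZeroMorphisms H] [HasZeroObject H] [HasBinaryBiproducts H] [Distributive H]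
  {scal : ScalarIso R H} {a b c d : Color}

namespace Rel

theorem plusMap {f : K.w a ⟶ K.w b} {φ : semColor H a ⟶ semColor H b} {g : K.w c ⟶ K.w d}
    {ψ : semColor H c ⟶ semColor H d} (hf : K.Rel scal f φ) (hg : K.Rel scal g ψ) :
    K.Rel scal (a := .plus a c) (b := .plus b d) (plusMap f g) (biprod.map φ ψ) := by
  have := hf.nice
  have := hg.nice
  refine of_fst_snd ?_ ?_
  · rw [plusMap_fst, biprod.map_fst]; exact fst.comp hf
  · rw [plusMap_snd, biprod.map_snd]; exact snd.comp hg

theorem barMap {f : K.w a ⟶ K.w b} {φ : semColor H a ⟶ semColor H b} {g : K.w c ⟶ K.w d}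
    {ψ : semColor H c ⟶ semColor H d} (hf : K.Rel scal f φ) (hg : K.Rel scal g ψ) :
    K.Rel scal (a := .bar a c) (b := .bar b d) (barMap f g) (vbarMap φ ψ) :=
  (hf.tens hg).plusMap (hf.plusMap hg)

theorem plusSwap : K.Rel scal (a := .plus a b) (b := .plus b a) (K.plusSwap a b)
    (biprod.braiding (semColor H a) (semColor H b)).hom := by
  refine of_fst_snd ?_ ?_
  · rw [plusSwap_fst]; simpa using snd
  · rw [plusSwap_snd]; simpa using fst

theorem barSwap : K.Rel scal (a := .bar a b) (b := .bar b a)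
    (Calculus.plusMap (K.sw a b) (K.plusSwap a b))
    (vbarBraiding (semColor H a) (semColor H b)).hom :=
  sw.plusMap plusSwap

theorem desc_one : K.Rel scal (a := .plus a a) (K.fst a a + K.snd a a)
    (biprod.desc (𝟙 (semColor H a)) (𝟙 (semColor H a))) := by
  have e : biprod.desc (𝟙 (semColor H a)) (𝟙 (semColor H a)) = biprod.fst + biprod.snd := by
    apply biprod.hom_ext' <;> simp [hom_comp_add]
  rw [e]
  exact fst.add snd

theorem lift_one : K.Rel scal (b := .plus a a) (K.inl a a + K.inr a a)
    (biprod.lift (𝟙 (semColor H a)) (𝟙 (semColor H a))) := by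
  have e : biprod.lift (𝟙 (semColor H a)) (𝟙 (semColor H a)) = biprod.inl + biprod.inr := by
    apply biprod.hom_ext <;> simp [hom_add_comp]
  rw [e]
  exact inl.add inr

theorem congr {f : K.w a ⟶ K.w b} {φ ψ : semColor H a ⟶ semColor H b} (hf : K.Rel scal f φ)
    (h : φ = ψ) : K.Rel scal f ψ := h ▸ hf

end Rel

/-- The seven equations required by `dec_assoc` relate nice morphisms between single wires. They can
be checked on coefficients, that is, in H. -/
theorem dec_assoc_of_rel {κ : K.w (.bar (.bar a b) c) ⟶ K.w (.bar a (.bar b c))}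
    (hκ : K.Rel scal κ (vbarAssoc (semColor H a) (semColor H b) (semColor H c)).hom) :
    K.dec (.bar a b) c ≫ K.dec a b ▷ K.w c ≫ (α_ _ _ _).hom =
      κ ≫ K.dec a (.bar b c) ≫ K.w a ◁ K.dec b c := by
  have := hκ.nice
  refine K.dec_assoc a b c κ ?_ ?_ ?_ ?_ ?_ ?_ ?_
  · refine Rel.ext (scal := scal) (hκ.comp (Rel.fst.comp (Rel.id.tens Rel.fst))) ?_
    refine (Rel.fst.comp ((Rel.fst.tens Rel.id).comp (Rel.adapt (.tensorAssoc a b c)))).congr ?_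
    simpa [semAdapt] using (vbarAssoc_hom_one _ _ _).symm
  · refine Rel.ext (scal := scal) (hκ.comp (Rel.fst.comp (Rel.id.tens (Rel.snd.comp Rel.fst)))) ?_
    refine (Rel.snd.comp (Rel.fst.comp Rel.fst)).congr ?_
    simpa using (vbarAssoc_hom_two _ _ _).symm
  · refine Rel.ext (scal := scal) (hκ.comp (Rel.fst.comp (Rel.id.tens (Rel.snd.comp Rel.snd)))) ?_
    refine (Rel.fst.comp ((Rel.snd.comp Rel.fst).tens Rel.id)).congr ?_
    simpa using (vbarAssoc_hom_three _ _ _).symm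
  · refine Rel.ext (scal := scal) (hκ.comp (Rel.snd.comp (Rel.snd.comp Rel.fst))) ?_
    refine (Rel.fst.comp ((Rel.snd.comp Rel.snd).tens Rel.id)).congr ?_
    simpa using (vbarAssoc_hom_four _ _ _).symm
  · refine Rel.ext (scal := scal)
      (hκ.comp (Rel.snd.comp (Rel.snd.comp (Rel.snd.comp Rel.fst)))) ?_
    exact (Rel.snd.comp (Rel.fst.comp (Rel.snd.comp Rel.snd))).congr (vbarAssoc_hom_five _ _ _).symm
  · refine Rel.ext (scal := scal)
      (hκ.comp (Rel.snd.comp (Rel.snd.comp (Rel.snd.comp Rel.snd)))) ?_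
    exact (Rel.snd.comp Rel.snd).congr (vbarAssoc_hom_six _ _ _).symm
  · refine Rel.ext (scal := scal) (hκ.comp (Rel.snd.comp Rel.fst)) ?_
    exact (Rel.snd.comp (Rel.fst.comp (Rel.snd.comp Rel.fst))).congr (vbarAssoc_hom_seven _ _ _).symm

end Calculus

/-! ### Encoding objects by colours -/

/-- The colour encoding an object. -/
@[reducible] def Obj.code : Obj → Color
  | .empty => .zero
  | .snoc X B => .bar X.code B

namespace Calculus

variable {R : Type u} [CommSemiring R] {C : Type v} [Category.{w} C] [MonoidalCategory C]
  [SymmetricCategory C] [HasZeroMorphisms C] {K : Calculus R C}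

theorem dag_P_Cn (a : Color) : K.dag (K.P a a) ≫ K.Cn a = K.fst a a + K.snd a a := by
  have e1 : il (K.w a) (K.w a) ≫ K.Cn a = 𝟙 _ := by
    rw [il, Category.assoc]
    exact (Iso.inv_comp_eq _).2 ((MonObj.mul_one (K.w a)).trans (Category.comp_id _).symm)
  have e2 : ir (K.w a) (K.w a) ≫ K.Cn a = 𝟙 _ := by
    rw [ir, Category.assoc]
    exact (Iso.inv_comp_eq _).2 ((MonObj.one_mul (K.w a)).trans (Category.comp_id _).symm)
  rw [dag_P_eq, add_comp, Category.assoc, Category.assoc, e1, e2, Category.comp_id,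
    Category.comp_id]

theorem dec_plusZero (K : Calculus R C) (a : Color) :
    K.dec a .zero ≫ K.w a ◁ 0 ≫ (ρ_ _).hom = K.snd _ _ ≫ K.fst _ _ := by
  rw [← K.plus_zero a (Adapt.plusZero a).approx, ← Category.assoc, dec_P, M_plusZero]

theorem dec_Cn (a : Color) : K.dec a a ≫ K.Cn a = K.snd _ _ ≫ (K.fst a a + K.snd a a) := by
  have h1 : K.dag (K.T a a) ≫ K.Cn a = 0 := by
    rw [← D_Cn, ← Category.assoc, dag_T_D, zero_comp]
  rw [dec, add_comp, Category.assoc, Category.assoc, h1, dag_P_Cn, comp_zero, zero_add]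

theorem dag_Cn_eq (a : Color) : K.dag (K.Cn a) = ((K.inl a a + K.inr a a) ≫ K.inr _ _) ≫ K.dec a a := by
  have h : K.P a a ≫ (K.fst a a + K.snd a a) = K.Cn a := by
    rw [← dag_P_Cn, ← Category.assoc]
    exact K.D_Cn a
  rw [Category.assoc, inr_dec, ← h, dag_comp, dag_add, dag_fst, dag_snd]

end Calculus

namespace FCat

variable {R : Type u} [CommSemiring R]

/-- The decoding of an object from its colour. -/
def decode : (X : Obj) → ((single X.code : FCat R) ⟶ ⟨X⟩)
  | .empty => 0
  | .snoc X B => (calculus R).dec X.code B ≫ decode X ▷ single B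

/-- Iterating `enc_dec`, the mirror of `decode` is a section, so a morphism out of X is determined
by its composite with `decode X`. -/
theorem dag_decode_decode (X : Obj) : dag (decode (R := R) X) ≫ decode X = 𝟙 _ := by
  induction X with
  | empty => exact isZero_unit.eq_of_src _ _
  | snoc X B ih =>
    have e : dag (decode (R := R) X ▷ single B) = dag (decode X) ▷ single B :=
      (calculus R).dag_whiskerRight _ _
    have e' : dag ((calculus R).dec X.code B) ≫ (calculus R).dec X.code B = 𝟙 _ :=
      (calculus R).enc_dec X.code B
    rw [decode, dag_comp, e, Category.assoc, reassoc_of% e', ← comp_whiskerRight, ih]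
    exact id_whiskerRight (⟨X⟩ : FCat R) (single B)

variable {H : Type v'} [Category.{w'} H] [MonoidalCategory H] [SymmetricCategory H]
  [HasZeroMorphisms H] [HasZeroObject H] [HasBinaryBiproducts H] [Distributive H]

variable (H) in
/-- The interpretation of the encoding of an object is the interpretation of the object. -/
noncomputable def semCode : (X : Obj) → (semColor H X.code ≅ semObj H X)
  | .empty => Iso.refl _
  | .snoc X B => vbarIso (semCode X) (Iso.refl (semColor H B))

variable (scal : ScalarIso R H)

/-- A wire decoding to the object `X`, compatibly with the encoding of `X`. -/
def Decodes (X : Obj) (a : Color) (δ : (single a : FCat R) ⟶ ⟨X⟩) (h : semColor H a ≅ semObj H X) :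
    Prop :=
  ∃ v : (single a : FCat R) ⟶ single X.code,
    (calculus R).Rel scal v (h.hom ≫ (semCode H X).inv) ∧ δ = v ≫ decode X

/-- The morphism of diagrams `g` is simulated, on encodings, by the semantic morphism `ψ`. -/
def Simulates {X Y : Obj} (g : (⟨X⟩ : FCat R) ⟶ ⟨Y⟩) (ψ : semObj H X ⟶ semObj H Y) : Prop :=
  ∃ f : (single X.code : FCat R) ⟶ single Y.code,
    (calculus R).Rel scal f ((semCode H X).hom ≫ ψ ≫ (semCode H Y).inv) ∧
      decode X ≫ g = f ≫ decode Y

variable {scal}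

/-- The semantic morphism fixes f by its coefficients, and then g is recovered as the section of
`decode X`, followed by f and `decode Y`. Only this direction, from ψ to g, is needed for
completeness. -/
theorem Simulates.ext {X Y : Obj} {g g' : (⟨X⟩ : FCat R) ⟶ ⟨Y⟩} {ψ : semObj H X ⟶ semObj H Y}
    (h : Simulates scal g ψ) (h' : Simulates scal g' ψ) : g = g' := by
  obtain ⟨f, hf, e⟩ := h
  obtain ⟨f', hf', e'⟩ := h'
  rw [← hf.ext hf'] at e'
  rw [← Category.id_comp g, ← Category.id_comp g', ← dag_decode_decode, Category.assoc,
    Category.assoc, e, e']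

theorem Simulates.comp {X Y Z : Obj} {g : (⟨X⟩ : FCat R) ⟶ ⟨Y⟩} {ψ : semObj H X ⟶ semObj H Y}
    {g' : (⟨Y⟩ : FCat R) ⟶ ⟨Z⟩} {ψ' : semObj H Y ⟶ semObj H Z}
    (h : Simulates scal g ψ) (h' : Simulates scal g' ψ') : Simulates scal (g ≫ g') (ψ ≫ ψ') := by
  obtain ⟨f, hf, e⟩ := h
  obtain ⟨f', hf', e'⟩ := h'
  refine ⟨f ≫ f', (hf.comp hf').congr (by simp), ?_⟩
  rw [reassoc_of% e, e', Category.assoc]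

theorem Simulates.zero {X Y : Obj} :
    Simulates scal (0 : (⟨X⟩ : FCat R) ⟶ ⟨Y⟩) (0 : semObj H X ⟶ semObj H Y) :=
  ⟨0, Calculus.Rel.zero.congr (by simp), by simp⟩

/-- Simulation may be verified on any convenient wire that decodes to the object, such as A itself
for `wire A`. The comparison u back from the code is the counterpart of a semantic isomorphism, and
it is a section of v by `Rel.ext`. -/
theorem Simulates.of_decodes {X Y : Obj} {a b : Color} {δ : (single a : FCat R) ⟶ ⟨X⟩}
    {h : semColor H a ≅ semObj H X} {ε : (single b : FCat R) ⟶ ⟨Y⟩} {k : semColor H b ≅ semObj H Y}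
    (hδ : Decodes scal X a δ h) (hε : Decodes scal Y b ε k) {g : (⟨X⟩ : FCat R) ⟶ ⟨Y⟩}
    {ψ : semObj H X ⟶ semObj H Y} {f : (single a : FCat R) ⟶ single b}
    {φ : semColor H a ⟶ semColor H b} (hf : (calculus R).Rel scal f φ)
    (e : h.hom ≫ ψ ≫ k.inv = φ) (e' : δ ≫ g = f ≫ ε) : Simulates scal g ψ := by
  obtain ⟨v, hv, rfl⟩ := hδ
  obtain ⟨v', hv', rfl⟩ := hε
  obtain ⟨u, hu⟩ := Calculus.Rel.exists_rel (K := calculus R) (scal := scal)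
    ((semCode H X).hom ≫ h.inv)
  have huv : u ≫ v = 𝟙 _ := (hu.comp hv).ext (Calculus.Rel.id.congr (by simp))
  refine ⟨u ≫ f ≫ v', (hu.comp (hf.comp hv')).congr (by simp [← e]), ?_⟩
  rw [← Category.id_comp (decode X), ← huv, Category.assoc, Category.assoc]
  rw [Category.assoc] at e'
  rw [e', Category.assoc, Category.assoc]

theorem decodes_single (A : Color) : Decodes scal (wire A) A (𝟙 (single A : FCat R))
    (semWire H A).symm := by
  -- The code of `wire A` is (𝟘 ⊗ A) ⊕ (𝟘 ⊕ A); the wire A sits in its last summand.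
  refine ⟨(calculus R).inr _ _ ≫ (calculus R).inr _ _, (Calculus.Rel.inr.comp
    Calculus.Rel.inr).congr ?_, ?_⟩
  · have e : (semCode H (wire A)).inv = 𝟙 _ := vbarMap_id _ _
    rw [e]
    simp [semWire, vbarLeftUnitor]
  · have e : (calculus R).inr (.tensor .zero A) _ ≫ decode (wire A) =
        dag ((calculus R).P .zero A) ≫ (0 : single .zero ⟶ 𝟙_ (FCat R)) ▷ single A :=
      (Category.assoc _ _ _).symm.trans (congrArg (· ≫ _) ((calculus R).inr_dec .zero A))
    have e' : (calculus R).inr .zero A ≫ dag ((calculus R).P .zero A) ≫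
        (0 : single .zero ⟶ 𝟙_ (FCat R)) ▷ single A ≫ (λ_ (single A)).hom = 𝟙 _ :=
      (calculus R).inr_snd .zero A
    rw [Category.assoc, e]
    refine e'.symm.trans ?_
    exact congrArg (_ ≫ _ ≫ ·) (Category.comp_id _)

theorem decodes_pair (A B : Color) : Decodes scal ((wire A).par (wire B)) (.bar A B)
    ((calculus R).dec A B) (semWires H A B).symm := by
  obtain ⟨v, hv, e⟩ := decodes_single (R := R) (scal := scal) A
  have := hv.nice
  refine ⟨Calculus.barMap (K := calculus R) v (𝟙 _), (hv.barMap Calculus.Rel.id).congr ?_, ?_⟩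
  · have e : (semCode H ((wire A).par (wire B))).inv =
      vbarMap (semCode H (wire A)).inv (𝟙 (semColor H B)) := rfl
    have e' : (semWires H A B).symm.hom = vbarMap (semWire H A).inv (𝟙 (semColor H B)) := rfl
    rw [e, e', vbarMap_comp, Category.comp_id]
    rfl
  · have e' : (v ≫ decode (wire A)) ▷ single B = 𝟙 _ := by
      rw [← e]; exact id_whiskerRight _ _
    have := Calculus.Nice.id (K := calculus R) (a := B)
    have h := Calculus.barMap_dec (K := calculus R) v (𝟙 (single B))
    rw [tensorHom_id] at h
    rw [decode, reassoc_of% h, ← comp_whiskerRight, e']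
    exact (Category.comp_id _).symm

/-- The code of a concatenation nests to the left, whereas parallel composition pairs the codes of X
and Y. Associativity of decoding and naturality of the associator reconcile them, one wire of Y at a
time. -/
theorem decodes_par (X Y : Obj) : Decodes scal (X.par Y) (.bar X.code Y.code)
    ((calculus R).dec X.code Y.code ≫ (decode X ⊗ₘ decode Y))
    (vbarIso (semCode H X) (semCode H Y) ≪≫ (semPar H X Y).symm) := by
  induction Y with
  | empty =>
    refine ⟨(calculus R).snd _ _ ≫ (calculus R).fst _ _,
      (Calculus.Rel.snd.comp Calculus.Rel.fst).congr ?_, ?_⟩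
    · simp [semPar, semCode, vbarRightUnitor]
    · have h := (calculus R).dec_plusZero X.code
      have e : (𝟙_ (FCat R)).obj = .empty := rfl
      have e1 : decode (R := R) X ⊗ₘ decode (R := R) .empty =
          (single X.code ◁ (0 : single .zero ⟶ 𝟙_ (FCat R)) ≫ (ρ_ _).hom) ≫ decode X := by
        rw [Category.assoc, ← rightUnitor_naturality, MonoidalCategory.tensorHom_def']
        exact congrArg (_ ≫ ·) (Category.comp_id _).symm
      rw [e1, ← Category.assoc]
      exact congrArg (· ≫ decode X) h
  | snoc Y B ih =>
    obtain ⟨v, hv, e⟩ := ih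
    -- No syntactic reindexing is written down: κ and l are counterparts of the semantic associator
    -- and of its inverse, and l ≫ κ is the identity because it has the coefficients of the
    -- identity.
    obtain ⟨κ, hκ⟩ := Calculus.Rel.exists_rel (K := calculus R) (scal := scal)
      (a := .bar (.bar X.code Y.code) B) (b := .bar X.code (.bar Y.code B))
      (vbarAssoc (semColor H X.code) (semColor H Y.code) (semColor H B)).hom
    obtain ⟨l, hl⟩ := Calculus.Rel.exists_rel (K := calculus R) (scal := scal)
      (a := .bar X.code (.bar Y.code B)) (b := .bar (.bar X.code Y.code) B)
      (vbarAssoc (semColor H X.code) (semColor H Y.code) (semColor H B)).inv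
    have hlκ : l ≫ κ = 𝟙 _ := (hl.comp hκ).ext (Calculus.Rel.id.congr (by simp))
    have := hv.nice
    refine ⟨l ≫ Calculus.barMap (K := calculus R) v (𝟙 _),
      (hl.comp (hv.barMap Calculus.Rel.id)).congr ?_, ?_⟩
    · have e1 : (vbarIso (semCode H X) (semCode H (Y.snoc B)) ≪≫
          (semPar H X (Y.snoc B)).symm).hom ≫ (semCode H (X.par (Y.snoc B))).inv =
            (vbarMap (semCode H X).hom (vbarMap (semCode H Y).hom (𝟙 (semColor H B))) ≫
              (vbarAssoc (semObj H X) (semObj H Y) (semColor H B)).inv ≫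
                vbarMap (semPar H X Y).inv (𝟙 (semColor H B))) ≫
                  vbarMap (semCode H (X.par Y)).inv (𝟙 (semColor H B)) := rfl
      have e2 : (vbarIso (semCode H X) (semCode H Y) ≪≫ (semPar H X Y).symm).hom =
          vbarMap (semCode H X).hom (semCode H Y).hom ≫ (semPar H X Y).inv := rfl
      have e3 : vbarMap (semCode H X).hom (vbarMap (semCode H Y).hom (𝟙 (semColor H B))) ≫
          (vbarAssoc (semObj H X) (semObj H Y) (semColor H B)).inv =
          (vbarAssoc _ _ _).inv ≫ vbarMap (vbarMap (semCode H X).hom (semCode H Y).hom) (𝟙 _) := by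
        rw [Iso.comp_inv_eq, Category.assoc, vbarAssoc_naturality, Iso.inv_hom_id_assoc]
      rw [e1, e2, ← Category.assoc (vbarMap (semCode H X).hom _), e3]
      simp only [Category.assoc, vbarMap_comp, Category.comp_id]
    · have h := Calculus.dec_assoc_of_rel hκ
      have := Calculus.Nice.id (K := calculus R) (a := B)
      have h' := Calculus.barMap_dec (K := calculus R) v (𝟙 (single B))
      rw [tensorHom_id] at h'
      rw [decode, decode, Category.assoc, reassoc_of% h', ← comp_whiskerRight, ← e,
        ← comp_assoc_single (l ≫ _), comp_whiskerRight, Category.assoc, Category.assoc,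
        Category.assoc, ← tensorHom_id (decode X ⊗ₘ decode Y), associator_naturality,
        reassoc_of% h, reassoc_of% hlκ, tensorHom_id, ← id_tensorHom, tensorHom_comp_tensorHom,
        Category.id_comp]

/-- Each generator is, through `dec`, a biproduct injection or projection, a symmetry, an adapter, a
scalar, a zero morphism, or a (co)diagonal combined with a projection or injection, all with known
coefficients. Parallel composition becomes `barMap`. -/
theorem simulates {X Y : Obj} (d : Diag R X Y) : Simulates scal (ofDiag d) (sem scal d) := by
  induction d with
  | id X => exact ⟨𝟙 _, Calculus.Rel.id.congr (by simp [sem]), (Category.comp_id _).trans (Category.id_comp _).symm⟩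
  | swap A B =>
    refine .of_decodes (decodes_pair A B) (decodes_pair B A) Calculus.Rel.barSwap ?_ ?_
    · simp [sem]
    · rw [Calculus.barSwap_dec]
      exact congrArg (_ ≫ ·) (braid_single_single A B).symm
  | tensor A B =>
    refine .of_decodes (decodes_pair A B) (decodes_single _) Calculus.Rel.fst ?_ ?_
    · simp [sem]
    · exact ((calculus R).dec_T A B).trans (Category.comp_id _).symm
  | tensorInv A B =>
    refine .of_decodes (decodes_single _) (decodes_pair A B) Calculus.Rel.inl ?_ ?_
    · simp [sem]
    · exact (Category.id_comp _).trans ((calculus R).inl_dec A B).symm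
  | plus A B =>
    refine .of_decodes (decodes_pair A B) (decodes_single _) Calculus.Rel.snd ?_ ?_
    · simp [sem]
    · exact ((calculus R).dec_P A B).trans (Category.comp_id _).symm
  | plusInv A B =>
    refine .of_decodes (decodes_single _) (decodes_pair A B) Calculus.Rel.inr ?_ ?_
    · simp [sem]
    · exact (Category.id_comp _).trans ((calculus R).inr_dec A B).symm
  | contr A =>
    refine .of_decodes (decodes_pair A A) (decodes_single A)
      (Calculus.Rel.snd.comp Calculus.Rel.desc_one) ?_ ?_
    · simp [sem]
    · exact (Calculus.dec_Cn (K := calculus R) A).trans (Category.comp_id _).symm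
  | contrInv A =>
    refine .of_decodes (decodes_single A) (decodes_pair A A)
      (Calculus.Rel.lift_one.comp Calculus.Rel.inr) ?_ ?_
    · simp [sem]
    · exact (Category.id_comp _).trans (Calculus.dag_Cn_eq (K := calculus R) A)
  | null A => rw [null_eq_zero]; exact .zero
  | nullInv A => rw [nullInv_eq_zero]; exact .zero
  | adapter h =>
    refine .of_decodes (decodes_single _) (decodes_single _) (Calculus.Rel.approx h) ?_ ?_
    · simp [sem]
    · exact (Category.id_comp _).trans (Category.comp_id _).symm
  | scalar s A =>
    refine .of_decodes (decodes_single A) (decodes_single A) (Calculus.Rel.scalar s) ?_ ?_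
    · simp [sem]
    · exact (Category.id_comp _).trans (Category.comp_id _).symm
  | comp d e hd he => exact hd.comp he
  | par d e hd he =>
    obtain ⟨f, hf, hd⟩ := hd
    obtain ⟨f', hf', he⟩ := he
    have := hf.nice
    have := hf'.nice
    refine .of_decodes (decodes_par _ _) (decodes_par _ _) (hf.barMap hf') ?_ ?_
    · have e1 : sem scal (d.par e) = (semPar H _ _).hom ≫ vbarMap (sem scal d) (sem scal e) ≫
          (semPar H _ _).inv := rfl
      have e2 (X Y : Obj) : (vbarIso (semCode H X) (semCode H Y) ≪≫ (semPar H X Y).symm).hom =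
          vbarMap (semCode H X).hom (semCode H Y).hom ≫ (semPar H X Y).inv := rfl
      have e3 (X Y : Obj) : (vbarIso (semCode H X) (semCode H Y) ≪≫ (semPar H X Y).symm).inv =
          (semPar H X Y).hom ≫ vbarMap (semCode H X).inv (semCode H Y).inv := rfl
      rw [e1, e2, e3]
      simp only [Category.assoc, Iso.inv_hom_id_assoc]
      rw [vbarMap_comp, vbarMap_comp]
    · rw [Category.assoc, ← Category.assoc (Calculus.barMap _ _), Calculus.barMap_dec,
        Category.assoc, tensorHom_comp_tensorHom, ← hd, ← he, ofDiag_par, tensorHom_comp_tensorHom]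

end FCat

end TensorPlus

theorem mainTheorem1
    {R : Type*} [CommSemiring R]
    {H : Type*} [Category H] [MonoidalCategory H] [SymmetricCategory H]
    [HasZeroMorphisms H] [HasZeroObject H] [HasBinaryBiproducts H] [TensorPlus.Distributive H]
    (scal : TensorPlus.ScalarIso R H)
    {X Y : TensorPlus.Obj} (d e : TensorPlus.Diag R X Y)
    (h : TensorPlus.sem scal d = TensorPlus.sem scal e) :
    TensorPlus.Equiv d e :=
  TensorPlus.FCat.exact <| (TensorPlus.FCat.simulates (scal := scal) d).ext
    (h ▸ TensorPlus.FCat.simulates e)
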